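/- **Theorem (convergence of MTAC-CA).** *Setting.* There are $K$ tasks. Task $k$ is a Markov decision process with state space $\mathcal S$, action space $\mathcal A$, discount factor $\gamma\in[0,1)$, transition kernel $P_k$, reward $r_k:\mathcal S\times\mathcal A\to[0,1]$ and initial law $\xi_0^k$. Let $\pi_\theta(a|s)>0$, $\theta\in\mathbb R^p$, be a policy class (densities with respect to a fixed $\sigma$-finite measure on $\mathcal A$), differentiable in $\theta$, with score $\psi_\theta(s,a)=\nabla_\theta\log\pi_\theta(a|s)$, and let $\phi^k:\mathcal S\times\mathcal A\to\mathbb R^m$ be feature maps. Let $J^k(\theta)=\mathbb E[\sum_t\gamma^t r_k(s_t,a_t)\mid s_0\sim\xi_0^k,\pi_\theta,P_k]$, let $Q^k_{\pi_\theta}(s,a)$ be the same expectation given $s_0=s,a_0=a$, and let $d^k_\theta=(1-\gamma)\sum_t\gamma^t\,\mathbb P((s_t,a_t)\in\cdot\mid s_0\sim\xi_0^k,\pi_\theta,P_k)$. Let $L_J$ be the (least) common Lipschitz constant of the maps $\nabla J^k$. Put $$A^k_\theta=\mathbb E[\phi^k(s,a)(\gamma\phi^k(s',a')-\phi^k(s,a))^\top],\qquad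 b^k_\theta=\mathbb E[\phi^k(s,a)r_k(s,a)],$$ where $(s,a)\sim d^k_\theta$, $s'\sim P_k(\cdot|s,a)$, $a'\sim\pi_\theta(\cdot|s')$; let $w^{*k}_\theta$ solve $A^k_\theta w+b^k_\theta=0$, and $$\epsilon_{\rm app}=\sup_\theta\max_k\sqrt{\mathbb E_{d^k_\theta}\big[(\phi^k(s,a)^\top w^{*k}_\theta-Q^k_{\pi_\theta}(s,a))^2\big]}.$$ Let $\Lambda$ be the probability simplex in $\mathbb R^K$, write $\lambda^\top\nabla J(\theta)=\sum_k\lambda^k\nabla J^k(\theta)$, and let $\mathcal T_\Lambda$ and $\mathcal T_B$ be the Euclidean projections onto $\Lambda$ and onto the ball $\{\|w\|\le B\}$ of $\mathbb R^m$. *Assumptions.* For all $k,\theta,\theta',s,a,t$, with constants $C_\phi,C_\pi,L_\phi,\kappa,\lambda_A,B>0$ and $\rho\in(0,1)$: 1. $\|\psi_\theta(s,a)\|\le C_\phi$, $\|\phi^k(s,a)\|\le C_\phi$, $|\pi_\theta(a|s)-\pi_{\theta'}(a|s)|\le C_\pi\|\theta-\theta'\|$, $\|\psi_\theta(s,a)-\psi_{\theta'}(s,a)\|\le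 L_\phi\|\theta-\theta'\|$; 2. $\|\mathbb P((s_t,a_t)\in\cdot\mid s_0=s,\pi_\theta,P_k)-d^k_\theta\|_{TV}\le\kappa\rho^t$; 3. $x^\top A^k_\theta x\le-\lambda_A\|x\|^2$ for all $x\in\mathbb R^m$; 4. $\|w^{*k}_\theta\|\le B$. *Algorithm.* Start from $\theta_0\in\mathbb R^p$, $w_0^k$ with $\|w_0^k\|\le B$, and $\lambda_0\in\Lambda$. For $t=0,1,\dots$: - *Critic.* Independently for each $k$: draw $(s_0,a_0)\sim d^k_{\theta_t}$, set $w^k_{t,0}=w^k_t$; for $0\le j<N_{\rm critic}$ draw $s_{j+1}\sim P_k(\cdot|s_j,a_j)$, $a_{j+1}\sim\pi_{\theta_t}(\cdot|s_{j+1})$ and set $w^k_{t,j+1}=\mathcal T_B\big(w^k_{t,j}+\tfrac{1}{2\lambda_A(j+1)}\,\delta_j\,\phi^k(s_j,a_j)\big)$ with $\delta_j=r_k(s_j,a_j)+\gamma\langle\phi^k(s_{j+1},a_{j+1}),w^k_{t,j}\rangle-\langle\phi^k(s_j,a_j),w^k_{t,j}\rangle$. Put $w^k_{t+1}=w^k_{t,N_{\rm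 critic}}$. - *CA weights.* From one sample $(s^k,a^k)$ per task, let $\widetilde\nabla J^k=\phi^k(s^k,a^k)^\top w^k_{t+1}\,\psi_{\theta_t}(s^k,a^k)$. Set $\lambda_{t,0}=\lambda_t$. For $i=1,\dots,N_{\rm CA}$ use two fresh independent families of samples $(s^k,a^k)\sim d^k_{\theta_t}$, independent over $k$, giving $\widetilde\nabla J_i$ and $\widetilde\nabla J_{i'}$, and set $\lambda_{t,i}=\mathcal T_\Lambda\big(\lambda_{t,i-1}-\tfrac{c}{\sqrt i}\,\lambda_{t,i-1}^\top\widetilde\nabla J_i(\widetilde\nabla J_{i'})^\top\big)$. Put $\lambda_{t+1}=\lambda_{t,N_{\rm CA}}$. - *Actor.* With $N_{\rm actor}$ further independent such families, $\theta_{t+1}=\theta_t+\beta\sum_k\lambda^k_{t+1}\frac1{N_{\rm actor}}\sum_l\phi^k(s^k_l,a^k_l)^\top w^k_{t+1}\,\psi_{\theta_t}(s^k_l,a^k_l)$. *Conclusion.* For all $K,\gamma,C_\phi,C_\pi,L_\phi,\kappa,\rho,\lambda_A,B$ and $c>0$ there is a constant $C>0$, depending only on these numbers, such that under the assumptions above,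 for all $T,N_{\rm actor},N_{\rm critic},N_{\rm CA}\ge1$, all $\beta>0$ with $\beta L_J\le1$ (i.e. $\beta\le1/L_J$), and all $\lambda_t^*\in\arg\min_{\lambda\in\Lambda}\|\lambda^\top\nabla J(\theta_t)\|^2$, $$\frac1T\sum_{t=0}^{T-1}\mathbb E\big[\|(\lambda_t^*)^\top\nabla J(\theta_t)\|^2\big]\le C\Big(\frac1{\beta T}+\epsilon_{\rm app}+\frac{\beta}{N_{\rm actor}}+\frac1{\sqrt{N_{\rm critic}}}+\frac1{N_{\rm CA}^{1/4}}\Big),$$ where the random variables on the left are integrable. -/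

import Mathlib

open MeasureTheory ProbabilityTheory
open scoped ENNReal RealInnerProductSpace

namespace MTAC

/-- Euclidean space of dimension `n`. -/
abbrev Vec (n : ℕ) : Type := EuclideanSpace ℝ (Fin n)

/-! ### Preliminaries: nearest points and products of kernels -/

section Nearest

variable {E : Type*} [NormedAddCommGroup E] [InnerProductSpace ℝ E]

open Classical in
/-- The Euclidean projection `argmin_{w ∈ C} ‖v - w‖` (unique for nonempty closed convex `C`). -/
noncomputable def nearest (C : Set E) (v : E) : E :=
  if h : ∃ w ∈ C, ∀ u ∈ C, ‖v - w‖ ≤ ‖v - u‖ then h.choose else 0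

theorem nearest_spec [CompleteSpace E] {C : Set E} (hne : C.Nonempty) (hcl : IsClosed C)
    (hcv : Convex ℝ C) (v : E) :
    nearest C v ∈ C ∧ ∀ u ∈ C, ‖v - nearest C v‖ ≤ ‖v - u‖ := by
  have h : ∃ w ∈ C, ∀ u ∈ C, ‖v - w‖ ≤ ‖v - u‖ := by
    obtain ⟨w, hw, hmin⟩ := exists_norm_eq_iInf_of_complete_convex hne hcl.isComplete hcv v
    refine ⟨w, hw, fun u hu => ?_⟩
    rw [hmin]
    exact ciInf_le ⟨0, by rintro _ ⟨x, rfl⟩; exact norm_nonneg _⟩ (⟨u, hu⟩ : C)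
  rw [nearest, dif_pos h]
  exact h.choose_spec

theorem nearest_inner_le [CompleteSpace E] {C : Set E} (hne : C.Nonempty) (hcl : IsClosed C)
    (hcv : Convex ℝ C) (v : E) : ∀ u ∈ C, ⟪v - nearest C v, u - nearest C v⟫ ≤ 0 := by
  obtain ⟨hm, hle⟩ := nearest_spec hne hcl hcv v
  refine (norm_eq_iInf_iff_real_inner_le_zero hcv hm).1 (le_antisymm ?_ ?_)
  · have : Nonempty C := ⟨⟨_, hm⟩⟩
    exact le_ciInf fun u => hle u u.2
  · exact ciInf_le ⟨0, by rintro _ ⟨x, rfl⟩; exact norm_nonneg _⟩ (⟨_, hm⟩ : C)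

theorem continuous_nearest [CompleteSpace E] {C : Set E} (hcl : IsClosed C)
    (hcv : Convex ℝ C) : Continuous (nearest C) := by
  rcases C.eq_empty_or_nonempty with rfl | hne
  · have : nearest (∅ : Set E) = fun _ => 0 := by
      funext v; simp [nearest]
    rw [this]; exact continuous_const
  · refine (LipschitzWith.of_dist_le_mul (K := 1) fun x y => ?_).continuous
    rw [dist_eq_norm, dist_eq_norm, NNReal.coe_one, one_mul]
    set a := nearest C x with ha
    set b := nearest C y with hb
    have h1 := nearest_inner_le hne hcl hcv x b (nearest_spec hne hcl hcv y).1
    have h2 := nearest_inner_le hne hcl hcv y a (nearest_spec hne hcl hcv x).1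
    rw [← ha] at h1
    rw [← hb] at h2
    have h3 : ‖a - b‖ ^ 2 ≤ ⟪x - y, a - b⟫ := by
      have e : ⟪x - y, a - b⟫ - ⟪a - b, a - b⟫ = -(⟪x - a, b - a⟫ + ⟪y - b, a - b⟫) := by
        simp only [inner_sub_left, inner_sub_right]; ring
      rw [← real_inner_self_eq_norm_sq]; linarith
    have h4 := real_inner_le_norm (x - y) (a - b)
    rcases eq_or_lt_of_le (norm_nonneg (a - b)) with h0 | h0
    · rw [← h0]; exact norm_nonneg _
    · exact le_of_mul_le_mul_right (by nlinarith) h0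

end Nearest

/-- The probability simplex over the `K` tasks. -/
def simplex (K : ℕ) : Set (Vec K) := {l | (∀ k, 0 ≤ l k) ∧ ∑ k, l k = 1}

theorem isClosed_simplex (K : ℕ) : IsClosed (simplex K) := by
  have h : simplex K = (⋂ k, {l : Vec K | 0 ≤ l k}) ∩ {l : Vec K | ∑ k, l k = 1} := by
    ext l; simp [simplex]
  rw [h]
  refine (isClosed_iInter fun k => isClosed_le continuous_const (by fun_prop)).inter
    (isClosed_eq (by fun_prop) continuous_const)

theorem convex_simplex (K : ℕ) : Convex ℝ (simplex K) := by
  intro x hx y hy a b ha hb hab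
  refine ⟨fun k => ?_, ?_⟩
  · have h1 := mul_nonneg ha (hx.1 k)
    have h2 := mul_nonneg hb (hy.1 k)
    simpa using add_nonneg h1 h2
  · simp [Finset.sum_add_distrib, ← Finset.mul_sum, hx.2, hy.2, hab]

section PiKernel

variable {ι α β : Type*} [Fintype ι] [MeasurableSpace α] [MeasurableSpace β]

/-- The kernel drawing, given `a`, independent coordinates `i` with laws `κ i a`. -/
noncomputable def piKernel (κ : ι → Kernel α β) [∀ i, IsMarkovKernel (κ i)] :
    Kernel α (ι → β) where
  toFun a := Measure.pi fun i => κ i a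
  measurable' := by
    refine Measurable.measure_of_isPiSystem_of_isProbabilityMeasure
      generateFrom_pi.symm isPiSystem_pi ?_
    rintro _ ⟨s, hs, rfl⟩
    simp only [Measure.pi_pi]
    exact Finset.measurable_prod _ fun i _ =>
      (κ i).measurable_coe (hs i (Set.mem_univ i))

instance (κ : ι → Kernel α β) [∀ i, IsMarkovKernel (κ i)] : IsMarkovKernel (piKernel κ) :=
  ⟨fun a => inferInstanceAs (IsProbabilityMeasure (Measure.pi fun i => κ i a))⟩

end PiKernel

/-! ### The multi-task Markov decision process, the policy class and the features -/

/-- `K` discounted Markov decision processes with common state space `S` and action space `A`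
(transition kernels `P k`, rewards `r k` with values in `[0, 1]`, initial laws `ξ k`), a policy
class `π_θ(a|s)`, `θ ∈ ℝ^p`, given by positive densities with respect to a reference measure `ν`
on the actions (the counting measure when `A` is countable), and feature maps `φ k`
with values in `ℝ^m`. -/
structure Model (S A : Type*) [MeasurableSpace S] [MeasurableSpace A] (K p m : ℕ) where
  γ : ℝ
  γ_nonneg : 0 ≤ γ
  γ_lt_one : γ < 1
  P : Fin K → Kernel (S × A) S
  P_markov : ∀ k, IsMarkovKernel (P k)
  r : Fin K → S × A → ℝ
  r_meas : ∀ k, Measurable (r k)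
  r_mem : ∀ k z, r k z ∈ Set.Icc (0 : ℝ) 1
  ξ : Fin K → Measure S
  ξ_prob : ∀ k, IsProbabilityMeasure (ξ k)
  ν : Measure A
  ν_sigmaFinite : SigmaFinite ν
  dens : Vec p → S → A → ℝ
  dens_meas : Measurable fun x : (Vec p × S) × A => dens x.1.1 x.1.2 x.2
  dens_pos : ∀ θ s a, 0 < dens θ s a
  dens_total : ∀ θ s, ∫⁻ a, ENNReal.ofReal (dens θ s a) ∂ν = 1
  dens_diff : ∀ s a, Differentiable ℝ fun θ => dens θ s a
  φ : Fin K → S × A → Vec m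
  φ_meas : ∀ k, Measurable (φ k)

attribute [instance] Model.P_markov Model.ξ_prob Model.ν_sigmaFinite

namespace Model

variable {S A : Type*} [MeasurableSpace S] [MeasurableSpace A] {K p m : ℕ} (M : Model S A K p m)

/-- The policy: `(θ, s) ↦ π_θ(· | s)`. -/
noncomputable def policy : Kernel (Vec p × S) A :=
  (Kernel.const (Vec p × S) M.ν).withDensity fun x a => ENNReal.ofReal (M.dens x.1 x.2 a)

theorem policy_apply (x : Vec p × S) :
    M.policy x = M.ν.withDensity fun a => ENNReal.ofReal (M.dens x.1 x.2 a) := by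
  rw [policy, Kernel.withDensity_apply _ (by exact M.dens_meas.ennreal_ofReal),
    Kernel.const_apply]

instance : IsMarkovKernel M.policy := by
  refine ⟨fun x => ⟨?_⟩⟩
  rw [policy_apply, withDensity_apply _ MeasurableSet.univ, Measure.restrict_univ]
  exact M.dens_total _ _

/-- The score function `ψ_θ(s, a) = ∇_θ log π_θ(a|s)`. -/
noncomputable def score (θ : Vec p) (z : S × A) : Vec p :=
  gradient (fun η => Real.log (M.dens η z.1 z.2)) θ

theorem measurable_score : Measurable fun x : Vec p × (S × A) => M.score x.1 x.2 := by
  let b := EuclideanSpace.basisFun (Fin p) ℝ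
  let f : Vec p × (S × A) → ℝ := fun x => Real.log (M.dens x.1 x.2.1 x.2.2)
  have hf : Measurable f := Real.measurable_log.comp
    (M.dens_meas.comp (by fun_prop : Measurable fun x : Vec p × (S × A) =>
      (((x.1, x.2.1), x.2.2) : (Vec p × S) × A)))
  have hrep : (fun x : Vec p × (S × A) => M.score x.1 x.2) =
      fun x => ∑ i, ⟪b i, M.score x.1 x.2⟫ • b i := by
    funext x; exact (b.sum_repr' _).symm
  rw [hrep]
  refine Finset.measurable_sum _ fun i _ => Measurable.smul_const ?_ _
  refine measurable_of_tendsto_metrizable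
    (f := fun (n : ℕ) x => ((n : ℝ)) * (f (x.1 + ((n : ℝ))⁻¹ • b i, x.2) - f x)) ?_ ?_
  · intro n
    exact ((hf.comp (by fun_prop)).sub hf).const_mul _
  · rw [tendsto_pi_nhds]
    intro x
    have hd : DifferentiableAt ℝ (fun η => Real.log (M.dens η x.2.1 x.2.2)) x.1 :=
      (M.dens_diff x.2.1 x.2.2 x.1).log (M.dens_pos _ _ _).ne'
    have h1 := hd.hasFDerivAt.lim (b i) (c := fun n : ℕ => (n : ℝ)) (l := Filter.atTop)
      (tendsto_norm_atTop_atTop.comp tendsto_natCast_atTop_atTop)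
    have h2 : ⟪b i, M.score x.1 x.2⟫ =
        fderiv ℝ (fun η => Real.log (M.dens η x.2.1 x.2.2)) x.1 (b i) := by
      rw [real_inner_comm, score, gradient, InnerProductSpace.toDual_symm_apply]
    rw [h2]
    simpa [smul_eq_mul, f] using h1

/-- One step of the state-action chain of task `k` under `π_θ`:
`(θ, (s, a)) ↦` law of `(s', a')` with `s' ∼ P k (· | s, a)`, `a' ∼ π_θ(· | s')`. -/
noncomputable def next (k : Fin K) : Kernel (Vec p × (S × A)) (S × A) :=
  Kernel.prodMkLeft (Vec p) (M.P k) ⊗ₖ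
    M.policy.comap (fun x : (Vec p × (S × A)) × S => (x.1.1, x.2)) (by fun_prop)

instance (k : Fin K) : IsMarkovKernel (M.next k) := by unfold next; infer_instance

/-- `t` steps of the state-action chain, started at a given state-action pair. -/
noncomputable def steps (k : Fin K) : ℕ → Kernel (Vec p × (S × A)) (S × A)
  | 0 => Kernel.deterministic Prod.snd measurable_snd
  | t + 1 => M.next k ∘ₖ (Kernel.deterministic Prod.fst measurable_fst ×ₖ steps k t)

instance (k : Fin K) (t : ℕ) : IsMarkovKernel (M.steps k t) := by
  induction t with
  | zero => unfold steps; infer_instance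
  | succ t ih => unfold steps; infer_instance

/-- `(θ, s) ↦` law of `(s_t, a_t)` given `s_0 = s`, under `π_θ` and `P k`. -/
noncomputable def lawFrom (k : Fin K) (t : ℕ) : Kernel (Vec p × S) (S × A) :=
  M.steps k t ∘ₖ (Kernel.deterministic Prod.fst measurable_fst ×ₖ
    (Kernel.deterministic Prod.snd measurable_snd ×ₖ M.policy))

/-- `θ ↦` law of `(s_t, a_t)` when `s_0 ∼ ξ k`, under `π_θ` and `P k`. -/
noncomputable def lawInit (k : Fin K) (t : ℕ) : Kernel (Vec p) (S × A) :=
  M.steps k t ∘ₖ (Kernel.id ×ₖ (Kernel.const (Vec p) (M.ξ k) ⊗ₖ M.policy))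

instance (k : Fin K) (t : ℕ) : IsMarkovKernel (M.lawInit k t) := by
  unfold lawInit; infer_instance

/-- The discounted visitation distribution
`d_θ^k = (1 - γ) ∑_t γ^t ℙ((s_t, a_t) ∈ · | s_0 ∼ ξ k, π_θ, P k)`. -/
noncomputable def visit (k : Fin K) : Kernel (Vec p) (S × A) where
  toFun θ := Measure.sum fun t : ℕ =>
    ENNReal.ofReal ((1 - M.γ) * M.γ ^ t) • M.lawInit k t θ
  measurable' := by
    refine Measure.measurable_of_measurable_coe _ fun s hs => ?_
    simp only [Measure.sum_apply _ hs, Measure.smul_apply, smul_eq_mul]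
    exact Measurable.tsum fun t => ((M.lawInit k t).measurable_coe hs).const_mul _

instance (k : Fin K) : IsMarkovKernel (M.visit k) := by
  refine ⟨fun θ => ⟨?_⟩⟩
  change (Measure.sum fun t : ℕ =>
    ENNReal.ofReal ((1 - M.γ) * M.γ ^ t) • M.lawInit k t θ) Set.univ = 1
  rw [Measure.sum_apply _ MeasurableSet.univ]
  simp only [Measure.smul_apply, measure_univ, smul_eq_mul, mul_one]
  have h0 := M.γ_nonneg
  have h1 := M.γ_lt_one
  rw [← ENNReal.ofReal_tsum_of_nonneg
    (fun t => mul_nonneg (by linarith) (pow_nonneg h0 t))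
    ((summable_geometric_of_lt_one h0 h1).mul_left _),
    tsum_mul_left, tsum_geometric_of_lt_one h0 h1, mul_inv_cancel₀ (by linarith),
    ENNReal.ofReal_one]

/-- The action-value function `Q_{π_θ}^k(s, a) = 𝔼[∑_t γ^t r_k(s_t, a_t) | s_0 = s, a_0 = a]`. -/
noncomputable def Q (k : Fin K) (θ : Vec p) (z : S × A) : ℝ :=
  ∑' t : ℕ, M.γ ^ t * ∫ y, M.r k y ∂(M.steps k t (θ, z))

/-- The objective `J^k(θ) = 𝔼[∑_t γ^t r_k(s_t, a_t) | s_0 ∼ ξ k]`. -/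
noncomputable def J (k : Fin K) (θ : Vec p) : ℝ :=
  ∑' t : ℕ, M.γ ^ t * ∫ y, M.r k y ∂(M.lawInit k t θ)

/-- The weighted policy gradient `λ^⊤ ∇J(θ) = ∑_k λ^k ∇J^k(θ)`. -/
noncomputable def wgrad (l : Vec K) (θ : Vec p) : Vec p := ∑ k, l k • gradient (M.J k) θ

/-- `λ ∈ argmin_{λ ∈ Λ} ‖λ^⊤ ∇J(θ)‖²`. -/
def IsMinNormWeight (θ : Vec p) (l : Vec K) : Prop :=
  l ∈ simplex K ∧ IsMinOn (fun l' => ‖M.wgrad l' θ‖ ^ 2) (simplex K) l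

/-- The common Lipschitz constant `L_J` of the gradients `∇J^k`: the least `L` such that
`‖∇J^k(θ) - ∇J^k(θ')‖ ≤ L ‖θ - θ'‖` for all `k, θ, θ'`. -/
noncomputable def LJ : ℝ :=
  sInf {L : ℝ | 0 ≤ L ∧ ∀ k θ θ',
    ‖gradient (M.J k) θ - gradient (M.J k) θ'‖ ≤ L * ‖θ - θ'‖}

/-- `A_{π_θ}^k = 𝔼[φ(s, a) (γ φ(s', a') - φ(s, a))^⊤]`, `(s, a) ∼ d_θ^k`,
`s' ∼ P k (· | s, a)`, `a' ∼ π_θ(· | s')`. -/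
noncomputable def tdA (k : Fin K) (θ : Vec p) : Matrix (Fin m) (Fin m) ℝ := fun i j =>
  ∫ z, (∫ z', M.φ k z i * (M.γ * M.φ k z' j - M.φ k z j) ∂(M.next k (θ, z))) ∂(M.visit k θ)

/-- `b_{π_θ}^k = 𝔼_{d_θ^k}[φ(s, a) r_k(s, a)]`. -/
noncomputable def tdb (k : Fin K) (θ : Vec p) : Fin m → ℝ := fun i =>
  ∫ z, M.φ k z i * M.r k z ∂(M.visit k θ)

/-- The TD limiting point `w_θ^{*k}`, i.e. the solution `w` of `A w + b = 0`. -/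
noncomputable def wstar (k : Fin K) (θ : Vec p) : Vec m :=
  WithLp.toLp 2 (-((M.tdA k θ)⁻¹.mulVec (M.tdb k θ)))

/-- The function approximation error
`ε_app = sup_θ max_k (𝔼_{d_θ^k}[(φ^k(s, a)^⊤ w_θ^{*k} - Q_{π_θ}^k(s, a))²])^{1/2}`. -/
noncomputable def epsApp : ℝ :=
  ⨆ θ : Vec p, ⨆ k : Fin K,
    √(∫ z, (⟪M.φ k z, M.wstar k θ⟫ - M.Q k θ z) ^ 2 ∂(M.visit k θ))

/-! ### Assumptions -/

/-- Boundedness and smoothness of the policy class and of the features. -/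
structure Smooth (Cφ Cπ Lφ : ℝ) : Prop where
  score_le : ∀ θ z, ‖M.score θ z‖ ≤ Cφ
  feature_le : ∀ k z, ‖M.φ k z‖ ≤ Cφ
  policy_lip : ∀ θ θ' s a, |M.dens θ s a - M.dens θ' s a| ≤ Cπ * ‖θ - θ'‖
  score_lip : ∀ θ θ' z, ‖M.score θ z - M.score θ' z‖ ≤ Lφ * ‖θ - θ'‖

/-- Uniform ergodicity: the total variation distance between the law of `(s_t, a_t)` given
`s_0 = s` and `d_θ^k` is at most `κ ρ^t`. -/
def UniformlyErgodic (κ ρ : ℝ) : Prop :=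
  ∀ (k : Fin K) (θ : Vec p) (s : S) (t : ℕ) (D : Set (S × A)), MeasurableSet D →
    |(M.lawFrom k t (θ, s)).real D - (M.visit k θ).real D| ≤ κ * ρ ^ t

/-- Problem solvability: `A_{π_θ}^k` is negative definite, `x^⊤ A x ≤ -λ_A ‖x‖²`,
uniformly in `θ` and `k`. -/
def Solvable (lamA : ℝ) : Prop :=
  ∀ (k : Fin K) (θ : Vec p) (x : Fin m → ℝ),
    dotProduct x ((M.tdA k θ).mulVec x) ≤ -lamA * dotProduct x x

/-! ### The algorithm MTAC-CA -/

/-- The TD(0) update `𝒯_B(w + α δ φ^k(s, a))` with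
`δ = r_k(s, a) + γ ⟨φ^k(s', a'), w⟩ - ⟨φ^k(s, a), w⟩`, where `z = (s, a)`, `z' = (s', a')`. -/
noncomputable def tdUpdate (B α : ℝ) (k : Fin K) (z z' : S × A) (w : Vec m) : Vec m :=
  nearest (Metric.closedBall 0 B)
    (w + (α * (M.r k z + M.γ * ⟪M.φ k z', w⟫ - ⟪M.φ k z, w⟫)) • M.φ k z)

theorem measurable_tdUpdate (B α : ℝ) (k : Fin K) :
    Measurable fun x : ((S × A) × Vec m) × (S × A) =>
      (x.2, M.tdUpdate B α k x.1.1 x.2 x.1.2) := by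
  have h1 := M.r_meas k
  have h2 := M.φ_meas k
  refine measurable_snd.prodMk ?_
  refine (continuous_nearest Metric.isClosed_closedBall
    (convex_closedBall _ _)).measurable.comp ?_
  fun_prop

/-- The critic of task `k`, after `j` TD(0) steps: `(θ, w) ↦` law of `((s_j, a_j), w_j)` with
`(s_0, a_0) ∼ d_θ^k`, `w_0 = w`, `(s_{j+1}, a_{j+1})` the successor of `(s_j, a_j)` under `P k` and
`π_θ`, and step size `α_j = 1 / (2 λ_A (j + 1))`. -/
noncomputable def criticIter (B lamA : ℝ) (k : Fin K) :
    ℕ → Kernel (Vec p × Vec m) ((S × A) × Vec m)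
  | 0 => (M.visit k).comap Prod.fst measurable_fst ×ₖ
      Kernel.deterministic Prod.snd measurable_snd
  | j + 1 => Kernel.map
      (criticIter B lamA k j ⊗ₖ
        (M.next k).comap
          (fun x : (Vec p × Vec m) × ((S × A) × Vec m) => (x.1.1, x.2.1)) (by fun_prop))
      fun x => (x.2, M.tdUpdate B (1 / (2 * lamA * (j + 1))) k x.1.1 x.2 x.1.2)

instance (B lamA : ℝ) (k : Fin K) (j : ℕ) : IsMarkovKernel (M.criticIter B lamA k j) := by
  induction j with
  | zero => unfold criticIter; infer_instance
  | succ j ih =>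
    unfold criticIter
    exact Kernel.IsMarkovKernel.map _ (M.measurable_tdUpdate B _ k)

/-- The critic of all tasks: `(θ, 𝐰) ↦` law of the `N`-th TD iterates, the tasks being
independent, each started at its component of `𝐰`. -/
noncomputable def critic (B lamA : ℝ) (N : ℕ) :
    Kernel (Vec p × (Fin K → Vec m)) (Fin K → Vec m) :=
  piKernel fun k => (M.criticIter B lamA k N).snd.comap
    (fun x : Vec p × (Fin K → Vec m) => (x.1, x.2 k)) (by fun_prop)

instance (B lamA : ℝ) (N : ℕ) : IsMarkovKernel (M.critic B lamA N) := by
  unfold critic; infer_instance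

/-- One sample `(s^k, a^k) ∼ d_θ^k` for every task, independently. -/
noncomputable def sample : Kernel (Vec p) (Fin K → S × A) := piKernel fun k => M.visit k

instance : IsMarkovKernel M.sample := by unfold sample; infer_instance

/-- The estimated gradient `φ^k(s, a)^⊤ w^k ψ_θ(s, a)` of task `k`. -/
noncomputable def gradEst (θ : Vec p) (w : Fin K → Vec m) (z : Fin K → S × A) (k : Fin K) :
    Vec p := ⟪M.φ k (z k), w k⟫ • M.score θ (z k)

theorem measurable_gradEst {Ω : Type*} [MeasurableSpace Ω] {f : Ω → Vec p}
    {g : Ω → Fin K → Vec m} {h : Ω → Fin K → S × A} (hf : Measurable f) (hg : Measurable g)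
    (hh : Measurable h) (k : Fin K) : Measurable fun x => M.gradEst (f x) (g x) (h x) k := by
  have hz : Measurable fun x => h x k := (measurable_pi_apply k).comp hh
  have hw : Measurable fun x => g x k := (measurable_pi_apply k).comp hg
  have h1 : Measurable fun x => ⟪M.φ k (h x k), g x k⟫ :=
    Measurable.inner (𝕜 := ℝ) ((M.φ_meas k).comp hz) hw
  exact h1.smul (M.measurable_score.comp (hf.prodMk hz))

/-- The weight update `𝒯_Λ(λ - c_i (λ^⊤ ∇̃J_i(θ)) ∇̃J_{i'}(θ)^⊤)` from two samples `z`, `z'`. -/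
noncomputable def weightUpdate (ci : ℝ) (θ : Vec p) (w : Fin K → Vec m)
    (z z' : Fin K → S × A) (l : Vec K) : Vec K :=
  nearest (simplex K) (l - ci • WithLp.toLp 2 fun k =>
    ⟪∑ j, l j • M.gradEst θ w z j, M.gradEst θ w z' k⟫)

/-- State of the algorithm: policy parameter `θ`, critic parameters `𝐰`, weights `λ`. -/
abbrev State (K p m : ℕ) : Type := Vec p × (Fin K → Vec m) × Vec K

theorem measurable_weightUpdate {Ω : Type*} [MeasurableSpace Ω] (ci : ℝ) {f : Ω → Vec p}
    {g : Ω → Fin K → Vec m} {h h' : Ω → Fin K → S × A} {l : Ω → Vec K} (hf : Measurable f)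
    (hg : Measurable g) (hh : Measurable h) (hh' : Measurable h') (hl : Measurable l) :
    Measurable fun x => M.weightUpdate ci (f x) (g x) (h x) (h' x) (l x) := by
  refine (continuous_nearest (isClosed_simplex K) (convex_simplex K)).measurable.comp ?_
  refine hl.sub (Measurable.const_smul ?_ ci)
  refine (PiLp.continuous_toLp 2 _).measurable.comp (measurable_pi_lambda _ fun k => ?_)
  refine Measurable.inner (Finset.measurable_sum _ fun j _ => ?_)
    (M.measurable_gradEst hf hg hh' k)
  exact ((EuclideanSpace.proj (𝕜 := ℝ) j).continuous.measurable.comp hl).smul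
    (M.measurable_gradEst hf hg hh j)

/-- The CA subprocedure: `(θ, 𝐰, λ) ↦` law of the weights after `i` updates from `λ`, the
`i`-th update using two fresh independent samples and the step size `c / √i`. -/
noncomputable def caIter (c : ℝ) : ℕ → Kernel (State K p m) (Vec K)
  | 0 => Kernel.deterministic (fun x => x.2.2) (by fun_prop)
  | i + 1 => Kernel.map
      (Kernel.id ×ₖ (caIter c i ×ₖ (M.sample.comap Prod.fst measurable_fst ×ₖ
        M.sample.comap Prod.fst measurable_fst)))
      fun x => M.weightUpdate (c / √((i : ℝ) + 1)) x.1.1 x.1.2.1 x.2.2.1 x.2.2.2 x.2.1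

instance (c : ℝ) (i : ℕ) : IsMarkovKernel (M.caIter c i) := by
  induction i with
  | zero => unfold caIter; infer_instance
  | succ i ih =>
    unfold caIter
    exact Kernel.IsMarkovKernel.map _ (M.measurable_weightUpdate _ measurable_fst.fst
      measurable_fst.snd.fst measurable_snd.snd.fst measurable_snd.snd.snd measurable_snd.fst)

/-- The actor update `θ + β λ^⊤ ((1/N) ∑_l φ(s_l, a_l)^⊤ 𝐰 ψ_θ(s_l, a_l))`. -/
noncomputable def actorUpdate (β : ℝ) {N : ℕ} (x : State K p m) (z : Fin N → Fin K → S × A) :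
    Vec p :=
  x.1 + β • ∑ k, x.2.2 k • ((N : ℝ)⁻¹ • ∑ l, M.gradEst x.1 x.2.1 (z l) k)

theorem measurable_actorUpdate {Ω : Type*} [MeasurableSpace Ω] (β : ℝ) {N : ℕ}
    {f : Ω → State K p m} {h : Ω → Fin N → Fin K → S × A} (hf : Measurable f)
    (hh : Measurable h) : Measurable fun x => M.actorUpdate β (f x) (h x) := by
  refine hf.fst.add (Measurable.const_smul ?_ β)
  refine Finset.measurable_sum _ fun k _ => ?_
  have h1 : Measurable fun x => (f x).2.2 k :=
    (EuclideanSpace.proj (𝕜 := ℝ) k).continuous.measurable.comp hf.snd.snd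
  have h2 : Measurable fun x => ∑ l, M.gradEst (f x).1 (f x).2.1 (h x l) k :=
    Finset.measurable_sum _ fun l _ => M.measurable_gradEst hf.fst hf.snd.fst
      ((measurable_pi_apply l).comp hh) k
  have h3 : Measurable fun x => (N : ℝ)⁻¹ • ∑ l, M.gradEst (f x).1 (f x).2.1 (h x l) k :=
    h2.fun_const_smul _
  exact h1.smul h3

/-- The actor: `(θ, 𝐰, λ) ↦` law of the new policy parameter, from `N` independent samples. -/
noncomputable def actor (β : ℝ) (N : ℕ) : Kernel (State K p m) (Vec p) :=
  Kernel.map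
    (Kernel.id ×ₖ piKernel fun _ : Fin N => M.sample.comap Prod.fst measurable_fst)
    fun x => M.actorUpdate β x.1 x.2

instance (β : ℝ) (N : ℕ) : IsMarkovKernel (M.actor β N) := by
  unfold actor
  exact Kernel.IsMarkovKernel.map _ (M.measurable_actorUpdate β measurable_fst measurable_snd)

end Model

/-- Parameters of MTAC-CA: projection radius `B`, critic step-size parameter `λ_A`, actor step
size `β`, CA step-size parameter `c`, and the numbers of inner iterations and samples. -/
structure Params where
  B : ℝ
  lamA : ℝ
  β : ℝ
  c : ℝ
  Ncritic : ℕ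
  NCA : ℕ
  Nactor : ℕ

namespace Model

variable {S A : Type*} [MeasurableSpace S] [MeasurableSpace A] {K p m : ℕ} (M : Model S A K p m)

/-- One outer iteration `(θ_t, 𝐰_t, λ_t) ↦ (θ_{t+1}, 𝐰_{t+1}, λ_{t+1})`: the critic gives
`𝐰_{t+1}` from `(θ_t, 𝐰_t)`, CA gives `λ_{t+1}` from `(θ_t, 𝐰_{t+1}, λ_t)`, the actor gives
`θ_{t+1}` from `(θ_t, 𝐰_{t+1}, λ_{t+1})`. -/
noncomputable def outer (q : Params) : Kernel (State K p m) (State K p m) :=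
  Kernel.map
    (((M.critic q.B q.lamA q.Ncritic).comap
        (fun x : State K p m => (x.1, x.2.1)) (by fun_prop) ⊗ₖ
      (M.caIter q.c q.NCA).comap
        (fun x : State K p m × (Fin K → Vec m) => (x.1.1, x.2, x.1.2.2)) (by fun_prop)) ⊗ₖ
      (M.actor q.β q.Nactor).comap
        (fun x : State K p m × ((Fin K → Vec m) × Vec K) => (x.1.1, x.2.1, x.2.2))
        (by fun_prop))
    fun y => (y.2, y.1.1, y.1.2)

instance (q : Params) : IsMarkovKernel (M.outer q) := by
  unfold outer
  exact Kernel.IsMarkovKernel.map _ (by fun_prop)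

/-- The law of `(θ_t, 𝐰_t, λ_t)` when the algorithm starts at `x₀ = (θ_0, 𝐰_0, λ_0)`. -/
noncomputable def stateLaw (q : Params) (x₀ : State K p m) : ℕ → Measure (State K p m)
  | 0 => Measure.dirac x₀
  | t + 1 => (stateLaw q x₀ t).bind (M.outer q)

instance (q : Params) (x₀ : State K p m) (t : ℕ) : IsProbabilityMeasure (M.stateLaw q x₀ t) := by
  induction t with
  | zero => unfold stateLaw; infer_instance
  | succ t ih => unfold stateLaw; infer_instance

end Model

end MTAC

set_option linter.unusedSectionVars false

namespace MTAC

/-! ### Projected stochastic gradient steps for a convex quadratic function -/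

section ProjectedSGD

variable {E : Type*} [NormedAddCommGroup E] [InnerProductSpace ℝ E]

/-! Fix one task k and use its objective J^k, which lies in [0, 1/(1-γ)], as a potential. Let G_j be
the mean gradient estimate of task j for the current critic, and let v = ∑ λ_j G_j. By smoothness,
one actor step changes J^k in expectation by at least β⟨∇J^k, v⟩ - (L_J/2) β² (‖v‖² + O(1/N_actor)).
Up to the factor 1/(1-γ) and the critic error, ∇J^k is G_k. If λ minimized ‖∑ λ_j G_j‖ over the
simplex, first-order optimality would give ⟨G_k, v⟩ ≥ ‖v‖². The CA iterate satisfies this up to its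
regret against the vertex e_k. As β L_J ≤ 1, each iteration then gains a multiple of β‖v‖² minus
errors. Up to critic error and constants, ‖v‖² dominates the minimal ‖λ^⊤∇J‖², since any λ in the
simplex is admissible there. Telescoping J^k gives the term 1/(βT) (`weights_ascent`,
`outer_ascent`, `average_min_norm_le`).

Smoothness. `performance_difference` writes J^k(θ') - J^k(θ) as one integral against the visitation
measure of θ. Expanding the likelihood ratio there gives a quadratic first-order expansion
(`J_quadratic`). This yields at once the policy gradient formula, a Lipschitz gradient, and a bound
on L_J by the constants of the assumptions.

Critic. With step 1/(2λ_A(j+1)) and drift at least λ_A, the quantity j · E‖w_j - w*‖² grows only by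
noise and by second-order terms of size 1/(j+1). The Markov noise is summed through a truncated
Poisson equation (`MarkovRecursion.noise_le`), which leads to a mean square error O(1/√N_critic)
(`projected_markov_recursion`).

Weights. The rate N_CA^(-1/4) for the last iterate, free of logarithms, rests on a coupling. Some
time n in [N/2, N) has expected regret O(1/√N) against a minimizer, and from there the chain moves
in j ≤ 2√N steps by a squared distance of only O(1/√N). Running the chain and its time shift with
common samples up to time N nearly preserves this, because the gradient of a convex quadratic is
monotone. Hence the laws at times N and N + j are within O(N^(-1/4)) in mean
(`exists_coupling_last`). Over a window of about √N steps after N the step lengths add up to order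
c, while the potential ‖x - z‖² changes in expectation by O(N^(-1/4)). So the averaged regret there
is O(N^(-1/4)), and closeness transfers it to time N, against every point z of the simplex
(`regret_last_le`). -/

theorem norm_nearest_sub_nearest_le [CompleteSpace E] {C : Set E} (hne : C.Nonempty)
    (hcl : IsClosed C) (hcv : Convex ℝ C) (x y : E) :
    ‖nearest C x - nearest C y‖ ≤ ‖x - y‖ := by
  set a := nearest C x with ha
  set b := nearest C y with hb
  have h1 := nearest_inner_le hne hcl hcv x b (nearest_spec hne hcl hcv y).1
  have h2 := nearest_inner_le hne hcl hcv y a (nearest_spec hne hcl hcv x).1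
  rw [← ha] at h1
  rw [← hb] at h2
  have h3 : ‖a - b‖ ^ 2 ≤ ⟪x - y, a - b⟫ := by
    have e : ⟪x - y, a - b⟫ - ⟪a - b, a - b⟫ = -(⟪x - a, b - a⟫ + ⟪y - b, a - b⟫) := by
      simp only [inner_sub_left, inner_sub_right]; ring
    rw [← real_inner_self_eq_norm_sq]; linarith
  have h4 := real_inner_le_norm (x - y) (a - b)
  rcases eq_or_lt_of_le (norm_nonneg (a - b)) with h0 | h0
  · rw [← h0]; exact norm_nonneg _
  · exact le_of_mul_le_mul_right (by nlinarith) h0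

theorem nearest_eq_self {C : Set E} {x : E} (hx : x ∈ C) : nearest C x = x := by
  have h : ∃ w ∈ C, ∀ u ∈ C, ‖x - w‖ ≤ ‖x - u‖ := ⟨x, hx, fun u _ => by simp⟩
  rw [nearest, dif_pos h]
  have := h.choose_spec.2 x hx
  rw [sub_self, norm_zero, norm_le_zero_iff, sub_eq_zero] at this
  exact this.symm

/-- A step of length `a` from `x` against the stochastic gradient `H ω x`, projected to `C`. -/
noncomputable def sgStep {Ω : Type*} (C : Set E) (H : Ω → E → E) (a : ℝ) (ω : Ω) (x : E) : E :=
  nearest C (x - a • H ω x)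

variable {F Ω : Type*} [NormedAddCommGroup F] [InnerProductSpace ℝ F] [MeasurableSpace Ω]
  [CompleteSpace E] [SecondCountableTopology E] [MeasurableSpace E] [BorelSpace E]

/-- `H` is a bounded unbiased estimator of the gradient of `x ↦ ‖G x‖² / 2` on `C`. -/
structure IsGradEstimator (C : Set E) (P : Measure Ω) (H : Ω → E → E) (G : E →L[ℝ] F)
    (L : ℝ) : Prop where
  nonempty : C.Nonempty
  closed : IsClosed C
  convex : Convex ℝ C
  diam : ∀ x ∈ C, ∀ y ∈ C, ‖x - y‖ ≤ 2
  meas : Measurable fun p : E × Ω => H p.2 p.1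
  bound : ∀ ω, ∀ x ∈ C, ‖H ω x‖ ≤ L
  lip : ∀ ω, ∀ x ∈ C, ∀ y ∈ C, ‖H ω x - H ω y‖ ≤ L * ‖x - y‖
  mean : ∀ x ∈ C, ∀ y, ∫ ω, ⟪H ω x, y⟫ ∂P = ⟪G x, G y⟫

namespace IsGradEstimator

variable {C : Set E} {P : Measure Ω} [IsProbabilityMeasure P] {H : Ω → E → E} {G : E →L[ℝ] F}
  {L : ℝ}

theorem step_mem (h : IsGradEstimator C P H G L) (a : ℝ) (ω : Ω) (x : E) :
    sgStep C H a ω x ∈ C :=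
  (nearest_spec h.nonempty h.closed h.convex _).1

theorem measurable_step (h : IsGradEstimator C P H G L) (a : ℝ) :
    Measurable fun p : E × Ω => sgStep C H a p.2 p.1 :=
  (continuous_nearest h.closed h.convex).measurable.comp
    (measurable_fst.sub (h.meas.const_smul a))

theorem measurable_pairStep (h : IsGradEstimator C P H G L) (a b : ℝ) :
    Measurable fun p : (E × E) × Ω => (sgStep C H a p.2 p.1.1, sgStep C H b p.2 p.1.2) :=
  ((h.measurable_step a).comp (measurable_fst.fst.prodMk measurable_snd)).prodMk
    ((h.measurable_step b).comp (measurable_fst.snd.prodMk measurable_snd))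

/-- Length zero freezes a point of C. So `sgPair` with second length 0 moves one chain against a
frozen copy, which serves both for the regret against a fixed point and for the displacement since
an earlier time. -/
theorem step_zero {x : E} (hx : x ∈ C) (ω : Ω) : sgStep C H 0 ω x = x := by
  rw [sgStep, zero_smul, sub_zero, nearest_eq_self hx]

theorem bound_nonneg (h : IsGradEstimator C P H G L) : 0 ≤ L := by
  obtain ⟨x, hx⟩ := h.nonempty
  obtain ⟨ω⟩ := nonempty_of_isProbabilityMeasure P
  exact (norm_nonneg _).trans (h.bound ω x hx)

theorem integrable_inner (h : IsGradEstimator C P H G L) {x : E} (hx : x ∈ C) (y : E) :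
    Integrable (fun ω => ⟪H ω x, y⟫) P := by
  have hm : Measurable fun ω => H ω x := h.meas.comp (measurable_const.prodMk measurable_id)
  refine Integrable.of_bound (hm.inner measurable_const).aestronglyMeasurable (L * ‖y‖)
    (Filter.Eventually.of_forall fun ω => ?_)
  exact (norm_inner_le_norm _ _).trans
    (mul_le_mul_of_nonneg_right (h.bound ω x hx) (norm_nonneg y))

/-- Expected squared distance after steps of lengths `a` and `b` with a common sample. -/
theorem integral_dist_le (h : IsGradEstimator C P H G L) {x y : E} (hx : x ∈ C) (hy : y ∈ C)
    {a b e : ℝ} (he : ∀ ω, ‖a • H ω x - b • H ω y‖ ≤ e) :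
    ∫ ω, ‖sgStep C H a ω x - sgStep C H b ω y‖ ^ 2 ∂P ≤
      ‖x - y‖ ^ 2 - 2 * ⟪G (x - y), G (a • x - b • y)⟫ + e ^ 2 := by
  have h1 := (h.integrable_inner hx (x - y)).const_mul a
  have h2 := (h.integrable_inner hy (x - y)).const_mul b
  have h3 : Integrable (fun ω => 2 * (a * ⟪H ω x, x - y⟫ - b * ⟪H ω y, x - y⟫)) P :=
    (h1.sub h2).const_mul 2
  have h4 : Integrable (fun ω =>
      ‖x - y‖ ^ 2 - 2 * (a * ⟪H ω x, x - y⟫ - b * ⟪H ω y, x - y⟫)) P :=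
    (integrable_const _).sub h3
  have hi : Integrable (fun ω => ‖x - y‖ ^ 2 - 2 * (a * ⟪H ω x, x - y⟫ - b * ⟪H ω y, x - y⟫)
      + e ^ 2) P := h4.add (integrable_const _)
  have hm : Measurable fun ω => ‖sgStep C H a ω x - sgStep C H b ω y‖ ^ 2 :=
    ((((h.measurable_step a).comp (measurable_const.prodMk measurable_id)).sub
      ((h.measurable_step b).comp (measurable_const.prodMk measurable_id))).norm).pow_const 2
  calc ∫ ω, ‖sgStep C H a ω x - sgStep C H b ω y‖ ^ 2 ∂P
      ≤ ∫ ω, (‖x - y‖ ^ 2 - 2 * (a * ⟪H ω x, x - y⟫ - b * ⟪H ω y, x - y⟫) + e ^ 2) ∂P := by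
        refine integral_mono (Integrable.of_bound hm.aestronglyMeasurable (2 ^ 2)
          (Filter.Eventually.of_forall fun ω => ?_)) hi fun ω => ?_
        · rw [Real.norm_of_nonneg (by positivity)]
          exact pow_le_pow_left₀ (norm_nonneg _)
            (h.diam _ (h.step_mem _ _ _) _ (h.step_mem _ _ _)) 2
        · have h1 : ‖sgStep C H a ω x - sgStep C H b ω y‖ ^ 2 ≤
              ‖(x - y) - (a • H ω x - b • H ω y)‖ ^ 2 := by
            refine pow_le_pow_left₀ (norm_nonneg _) ?_ 2
            refine (norm_nearest_sub_nearest_le h.nonempty h.closed h.convex _ _).trans_eq ?_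
            congr 1; abel
          rw [norm_sub_sq_real (x - y)] at h1
          have h2 : ‖a • H ω x - b • H ω y‖ ^ 2 ≤ e ^ 2 :=
            pow_le_pow_left₀ (norm_nonneg _) (he ω) 2
          have h3 : ⟪x - y, a • H ω x - b • H ω y⟫ =
              a * ⟪H ω x, x - y⟫ - b * ⟪H ω y, x - y⟫ := by
            rw [real_inner_comm, inner_sub_left, real_inner_smul_left, real_inner_smul_left]
          rw [h3] at h1; linarith
    _ = _ := by
        rw [integral_add h4 (integrable_const _), integral_sub (integrable_const _) h3,
          integral_const_mul, integral_sub h1 h2, integral_const_mul, integral_const_mul,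
          h.mean x hx, h.mean y hy]
        simp only [integral_const, probReal_univ, smul_eq_mul, one_mul, map_sub, map_smul,
          inner_sub_right, inner_sub_left, real_inner_smul_right]
        rw [real_inner_comm (G x) (G y)]
        ring

end IsGradEstimator

/-- The law after one step of length `a` from the law `μ`. -/
noncomputable def sgNext (C : Set E) (P : Measure Ω) (H : Ω → E → E) (a : ℝ) (μ : Measure E) :
    Measure E :=
  (μ.prod P).map fun p => sgStep C H a p.2 p.1

/-- The law of the `n`-th iterate from `x₀` with step lengths `α`. -/
noncomputable def sgLaw (C : Set E) (P : Measure Ω) (H : Ω → E → E) (α : ℕ → ℝ) (x₀ : E) :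
    ℕ → Measure E
  | 0 => Measure.dirac x₀
  | n + 1 => sgNext C P H (α n) (sgLaw C P H α x₀ n)

/-- The joint law after steps of lengths `a` and `b` with a common sample. -/
noncomputable def sgPair (C : Set E) (P : Measure Ω) (H : Ω → E → E) (a b : ℝ)
    (ν : Measure (E × E)) : Measure (E × E) :=
  (ν.prod P).map fun p => (sgStep C H a p.2 p.1.1, sgStep C H b p.2 p.1.2)

/-- `ν` is a coupling of the laws `μ` and `μ'` on `C`. -/
structure IsCouplingOn (C : Set E) (ν : Measure (E × E)) (μ μ' : Measure E) : Prop where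
  prob : IsProbabilityMeasure ν
  mem : ∀ᵐ p ∂ν, p.1 ∈ C ∧ p.2 ∈ C
  fst : ν.map Prod.fst = μ
  snd : ν.map Prod.snd = μ'

namespace IsGradEstimator

variable {C : Set E} {P : Measure Ω} [IsProbabilityMeasure P] {H : Ω → E → E} {G : E →L[ℝ] F}
  {L : ℝ}

theorem sgNext_zero (_h : IsGradEstimator C P H G L) {μ : Measure E} [SFinite μ]
    (hμ : ∀ᵐ x ∂μ, x ∈ C) : sgNext C P H 0 μ = μ := by
  have h1 : (fun p : E × Ω => sgStep C H 0 p.2 p.1) =ᵐ[μ.prod P] Prod.fst := by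
    have h2 : ∀ᵐ p ∂μ.prod P, p.1 ∈ C := Measure.quasiMeasurePreserving_fst.ae hμ
    filter_upwards [h2] with p hp using step_zero hp _
  rw [sgNext, Measure.map_congr h1, ← Measure.fst, Measure.fst_prod]

/-- Sharing the sample does not affect the marginals, so each coordinate still makes its own step.
Couplings are thus built one step at a time, without a probability space carrying the whole run. -/
theorem isCouplingOn_sgPair (h : IsGradEstimator C P H G L) {ν : Measure (E × E)}
    {μ μ' : Measure E} (hν : IsCouplingOn C ν μ μ') (a b : ℝ) :
    IsCouplingOn C (sgPair C P H a b ν) (sgNext C P H a μ) (sgNext C P H b μ') := by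
  have := hν.prob
  refine ⟨Measure.isProbabilityMeasure_map (h.measurable_pairStep a b).aemeasurable, ?_, ?_, ?_⟩
  · have hm : MeasurableSet {p : E × E | p.1 ∈ C ∧ p.2 ∈ C} :=
      (h.closed.measurableSet.preimage measurable_fst).inter
        (h.closed.measurableSet.preimage measurable_snd)
    rw [sgPair, ae_map_iff (h.measurable_pairStep a b).aemeasurable hm]
    exact Filter.Eventually.of_forall fun p => ⟨h.step_mem _ _ _, h.step_mem _ _ _⟩
  · have e : P = P.map id := Measure.map_id.symm
    rw [sgPair, Measure.map_map measurable_fst (h.measurable_pairStep a b), sgNext, ← hν.fst]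
    nth_rewrite 2 [e]
    rw [Measure.map_prod_map _ _ measurable_fst measurable_id,
      Measure.map_map (h.measurable_step a) (measurable_fst.prodMap measurable_id)]
    rfl
  · have e : P = P.map id := Measure.map_id.symm
    rw [sgPair, Measure.map_map measurable_snd (h.measurable_pairStep a b), sgNext, ← hν.snd]
    nth_rewrite 2 [e]
    rw [Measure.map_prod_map _ _ measurable_snd measurable_id,
      Measure.map_map (h.measurable_step b) (measurable_snd.prodMap measurable_id)]
    rfl

theorem integral_sgPair (h : IsGradEstimator C P H G L) {ν : Measure (E × E)}
    [IsProbabilityMeasure ν] (a b : ℝ) :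
    Integrable (fun p : E × E => ∫ ω, ‖sgStep C H a ω p.1 - sgStep C H b ω p.2‖ ^ 2 ∂P) ν ∧
    ∫ p, ‖p.1 - p.2‖ ^ 2 ∂(sgPair C P H a b ν) =
      ∫ p : E × E, (∫ ω, ‖sgStep C H a ω p.1 - sgStep C H b ω p.2‖ ^ 2 ∂P) ∂ν := by
  have hc : Measurable fun p : E × E => ‖p.1 - p.2‖ ^ 2 := by fun_prop
  have hi : Integrable (fun p : (E × E) × Ω =>
      ‖sgStep C H a p.2 p.1.1 - sgStep C H b p.2 p.1.2‖ ^ 2) (ν.prod P) := by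
    refine Integrable.of_bound (hc.comp (h.measurable_pairStep a b)).aestronglyMeasurable (2 ^ 2)
      (Filter.Eventually.of_forall fun p => ?_)
    rw [Real.norm_of_nonneg (by positivity)]
    exact pow_le_pow_left₀ (norm_nonneg _)
      (h.diam _ (h.step_mem _ _ _) _ (h.step_mem _ _ _)) 2
  refine ⟨hi.integral_prod_left, ?_⟩
  rw [sgPair, integral_map (h.measurable_pairStep a b).aemeasurable hc.aestronglyMeasurable,
    integral_prod _ hi]

theorem integrable_of_continuous (_h : IsGradEstimator C P H G L) {ν : Measure (E × E)}
    {μ μ' : Measure E} (hν : IsCouplingOn C ν μ μ') {f : E × E → ℝ} (hf : Continuous f)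
    {b : ℝ} (hb : ∀ x ∈ C, ∀ y ∈ C, |f (x, y)| ≤ b) : Integrable f ν := by
  have := hν.prob
  refine Integrable.of_bound hf.measurable.aestronglyMeasurable b ?_
  filter_upwards [hν.mem] with p hp using hb _ hp.1 _ hp.2

/-- By unbiasedness the form ⟨G x, G y⟩ inherits the bounds of the estimator, so all later constants
depend on L alone and not on the norm of G. -/
theorem abs_inner_map_le (h : IsGradEstimator C P H G L) {x : E} (hx : x ∈ C) (y : E) :
    |⟪G x, G y⟫| ≤ L * ‖y‖ := by
  rw [← h.mean x hx, ← Real.norm_eq_abs]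
  refine (norm_integral_le_of_norm_le_const (C := L * ‖y‖)
    (Filter.Eventually.of_forall fun ω => ?_)).trans_eq (by simp)
  exact (norm_inner_le_norm _ _).trans
    (mul_le_mul_of_nonneg_right (h.bound ω x hx) (norm_nonneg y))

theorem abs_inner_map_sub_le (h : IsGradEstimator C P H G L) {x y : E} (hx : x ∈ C) (hy : y ∈ C)
    (z : E) : |⟪G x - G y, G z⟫| ≤ L * ‖x - y‖ * ‖z‖ := by
  rw [inner_sub_left, ← h.mean x hx, ← h.mean y hy, ← integral_sub (h.integrable_inner hx z)
    (h.integrable_inner hy z), ← Real.norm_eq_abs]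
  refine (norm_integral_le_of_norm_le_const (C := L * ‖x - y‖ * ‖z‖)
    (Filter.Eventually.of_forall fun ω => ?_)).trans_eq (by simp)
  rw [← inner_sub_left]
  exact (norm_inner_le_norm _ _).trans
    (mul_le_mul_of_nonneg_right (h.lip ω x hx y hy) (norm_nonneg z))

theorem integrable_sq (h : IsGradEstimator C P H G L) {ν : Measure (E × E)}
    {μ μ' : Measure E} (hν : IsCouplingOn C ν μ μ') :
    Integrable (fun p : E × E => ‖p.1 - p.2‖ ^ 2) ν := by
  refine h.integrable_of_continuous hν (by fun_prop) (b := 2 ^ 2) fun x hx y hy => ?_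
  rw [abs_of_nonneg (by positivity)]
  exact pow_le_pow_left₀ (norm_nonneg _) (h.diam _ hx _ hy) 2

theorem integrable_regret (h : IsGradEstimator C P H G L) {ν : Measure (E × E)}
    {μ μ' : Measure E} (hν : IsCouplingOn C ν μ μ') :
    Integrable (fun p : E × E => ⟪G p.1, G (p.1 - p.2)⟫) ν := by
  refine h.integrable_of_continuous hν (by fun_prop) (b := L * 2) fun x hx y hy => ?_
  exact (h.abs_inner_map_le hx _).trans
    (mul_le_mul_of_nonneg_left (h.diam _ hx _ hy) h.bound_nonneg)

/-- The regret inequality of a step of length `a` against a fixed point. -/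
theorem sgPair_zero_le (h : IsGradEstimator C P H G L) {ν : Measure (E × E)}
    {μ μ' : Measure E} (hν : IsCouplingOn C ν μ μ') {a : ℝ} (ha : 0 ≤ a) :
    ∫ p, ‖p.1 - p.2‖ ^ 2 ∂(sgPair C P H a 0 ν) + 2 * a * ∫ p, ⟪G p.1, G (p.1 - p.2)⟫ ∂ν ≤
      ∫ p, ‖p.1 - p.2‖ ^ 2 ∂ν + (a * L) ^ 2 := by
  have := hν.prob
  obtain ⟨hi, he⟩ := h.integral_sgPair (ν := ν) a 0
  have hs := h.integrable_sq hν
  have hr := h.integrable_regret hν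
  rw [he, ← integral_const_mul, ← integral_add hi (hr.const_mul _)]
  have h2 : ∫ p : E × E, ‖p.1 - p.2‖ ^ 2 ∂ν + (a * L) ^ 2 =
      ∫ p : E × E, (‖p.1 - p.2‖ ^ 2 + (a * L) ^ 2) ∂ν := by
    rw [integral_add hs (integrable_const _)]; simp
  rw [h2]
  refine integral_mono_ae (hi.add (hr.const_mul _)) (hs.add (integrable_const _)) ?_
  filter_upwards [hν.mem] with p hp
  have h3 := h.integral_dist_le hp.1 hp.2 (a := a) (b := 0) (e := a * L) fun ω => by
    rw [zero_smul, sub_zero, norm_smul, Real.norm_of_nonneg ha]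
    exact mul_le_mul_of_nonneg_left (h.bound ω _ hp.1) ha
  rw [zero_smul, sub_zero, map_smul, real_inner_smul_right, real_inner_comm] at h3
  linarith

/-- Two chains with a common sample and step lengths `a ≤ b` hardly separate. -/
theorem sgPair_le (h : IsGradEstimator C P H G L) {ν : Measure (E × E)}
    {μ μ' : Measure E} (hν : IsCouplingOn C ν μ μ') {z : E} (hz : z ∈ C)
    (hmin : ∀ x ∈ C, ‖G z‖ ≤ ‖G x‖) {a b : ℝ} (ha : 0 ≤ a) (hab : a ≤ b) :
    ∫ p, ‖p.1 - p.2‖ ^ 2 ∂(sgPair C P H a b ν) ≤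
      (1 + 2 * (b * L) ^ 2) * ∫ p, ‖p.1 - p.2‖ ^ 2 ∂ν +
        2 * (b - a) * ∫ x, ⟪G x, G (x - z)⟫ ∂μ + 2 * ((b - a) * L) ^ 2 := by
  have := hν.prob
  obtain ⟨hi, he⟩ := h.integral_sgPair (ν := ν) a b
  have hs := h.integrable_sq hν
  have hr : Integrable (fun p : E × E => ⟪G p.1, G (p.1 - z)⟫) ν := by
    refine h.integrable_of_continuous hν (by fun_prop) (b := L * 2) fun x hx y hy => ?_
    exact (h.abs_inner_map_le hx _).trans
      (mul_le_mul_of_nonneg_left (h.diam _ hx _ hz) h.bound_nonneg)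
  have h1 : ∫ x, ⟪G x, G (x - z)⟫ ∂μ = ∫ p : E × E, ⟪G p.1, G (p.1 - z)⟫ ∂ν := by
    rw [← hν.fst, integral_map measurable_fst.aemeasurable
      (Continuous.aestronglyMeasurable (by fun_prop))]
  rw [he, h1, ← integral_const_mul, ← integral_const_mul]
  have h3 : Integrable (fun p : E × E => (1 + 2 * (b * L) ^ 2) * ‖p.1 - p.2‖ ^ 2 +
      2 * (b - a) * ⟪G p.1, G (p.1 - z)⟫) ν := (hs.const_mul _).add (hr.const_mul _)
  have h2 : (∫ p : E × E, (1 + 2 * (b * L) ^ 2) * ‖p.1 - p.2‖ ^ 2 ∂ν) +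
      (∫ p : E × E, 2 * (b - a) * ⟪G p.1, G (p.1 - z)⟫ ∂ν) + 2 * ((b - a) * L) ^ 2 =
      ∫ p : E × E, ((1 + 2 * (b * L) ^ 2) * ‖p.1 - p.2‖ ^ 2 +
        2 * (b - a) * ⟪G p.1, G (p.1 - z)⟫ + 2 * ((b - a) * L) ^ 2) ∂ν := by
    rw [integral_add h3 (integrable_const _),
      integral_add (hs.const_mul _) (hr.const_mul _)]
    simp
  rw [h2]
  refine integral_mono_ae hi
    (h3.add (integrable_const _)) ?_
  filter_upwards [hν.mem] with p hp
  obtain ⟨x, y⟩ := p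
  obtain ⟨hx, hy⟩ := hp
  dsimp only at hx hy ⊢
  have h3 := h.integral_dist_le hx hy (a := a) (b := b)
    (e := b * L * ‖x - y‖ + (b - a) * L) fun ω => by
      have e1 : a • H ω x - b • H ω y = b • (H ω x - H ω y) - (b - a) • H ω x := by module
      rw [e1]
      refine (norm_sub_le _ _).trans ?_
      rw [norm_smul, norm_smul, Real.norm_of_nonneg (ha.trans hab),
        Real.norm_of_nonneg (sub_nonneg.2 hab)]
      have h5 := mul_le_mul_of_nonneg_left (h.lip ω x hx y hy) (ha.trans hab)
      have h6 := mul_le_mul_of_nonneg_left (h.bound ω x hx) (sub_nonneg.2 hab)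
      linarith
  have h4 : (b * L * ‖x - y‖ + (b - a) * L) ^ 2 ≤
      2 * (b * L) ^ 2 * ‖x - y‖ ^ 2 + 2 * ((b - a) * L) ^ 2 := by
    nlinarith [sq_nonneg (b * L * ‖x - y‖ - (b - a) * L)]
  -- The monotone part of the cross term is a nonnegative square. What is left is due to the unequal
  -- step lengths and equals a difference of objective values. Since ‖G y‖ ≥ ‖G z‖, that difference
  -- is controlled by the regret of x against the minimizer z.
  have h5 : ⟪G (x - y), G (a • x - b • y)⟫ =
      (a + b) / 2 * ‖G x - G y‖ ^ 2 - (b - a) / 2 * (‖G x‖ ^ 2 - ‖G y‖ ^ 2) := by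
    simp only [map_sub, map_smul, inner_sub_left, inner_sub_right, real_inner_smul_right,
      ← real_inner_self_eq_norm_sq, real_inner_comm (G x) (G y)]
    ring
  have h6 : ⟪G x, G (x - z)⟫ = (‖G x‖ ^ 2 - ‖G z‖ ^ 2) / 2 + ‖G x - G z‖ ^ 2 / 2 := by
    simp only [map_sub, inner_sub_left, inner_sub_right,
      ← real_inner_self_eq_norm_sq, real_inner_comm (G x) (G z)]
    ring
  have h7 : ‖G z‖ ^ 2 ≤ ‖G y‖ ^ 2 := pow_le_pow_left₀ (norm_nonneg _) (hmin y hy) 2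
  have h8 : 0 ≤ (a + b) / 2 * ‖G x - G y‖ ^ 2 := by
    have := ha.trans hab; positivity
  have h9 : 0 ≤ (b - a) * (‖G y‖ ^ 2 - ‖G z‖ ^ 2) :=
    mul_nonneg (sub_nonneg.2 hab) (sub_nonneg.2 h7)
  have h10 : 0 ≤ (b - a) * ‖G x - G z‖ ^ 2 := mul_nonneg (sub_nonneg.2 hab) (sq_nonneg _)
  rw [h5] at h3
  rw [h6]
  nlinarith

end IsGradEstimator
end ProjectedSGD
-- Laws of the iterates, and couplings of the chain with its time shift
section ProjectedSGD

variable {E : Type*} [NormedAddCommGroup E] [InnerProductSpace ℝ E]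
variable {F Ω : Type*} [NormedAddCommGroup F] [InnerProductSpace ℝ F] [MeasurableSpace Ω]
  [CompleteSpace E] [SecondCountableTopology E] [MeasurableSpace E] [BorelSpace E]

namespace IsGradEstimator

variable {C : Set E} {P : Measure Ω} [IsProbabilityMeasure P] {H : Ω → E → E} {G : E →L[ℝ] F}
  {L : ℝ}

theorem sgLaw_spec (h : IsGradEstimator C P H G L) (α : ℕ → ℝ) {x₀ : E} (hx₀ : x₀ ∈ C) (n : ℕ) :
    IsProbabilityMeasure (sgLaw C P H α x₀ n) ∧ ∀ᵐ x ∂(sgLaw C P H α x₀ n), x ∈ C := by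
  induction n with
  | zero => exact ⟨Measure.dirac.isProbabilityMeasure,
      (ae_dirac_iff h.closed.measurableSet).2 hx₀⟩
  | succ n ih =>
    have := ih.1
    refine ⟨Measure.isProbabilityMeasure_map (h.measurable_step _).aemeasurable, ?_⟩
    have hC : MeasurableSet {x | x ∈ C} := h.closed.measurableSet
    rw [sgLaw, sgNext, ae_map_iff (h.measurable_step _).aemeasurable hC]
    exact Filter.Eventually.of_forall fun p => h.step_mem _ _ _

theorem isCouplingOn_diag (h : IsGradEstimator C P H G L) {μ : Measure E}
    [IsProbabilityMeasure μ] (hμ : ∀ᵐ x ∂μ, x ∈ C) :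
    IsCouplingOn C (μ.map fun x => (x, x)) μ μ := by
  have hm : Measurable fun x : E => (x, x) := by fun_prop
  refine ⟨Measure.isProbabilityMeasure_map hm.aemeasurable, ?_, ?_, ?_⟩
  · have hs : MeasurableSet {p : E × E | p.1 ∈ C ∧ p.2 ∈ C} :=
      (h.closed.measurableSet.preimage measurable_fst).inter
        (h.closed.measurableSet.preimage measurable_snd)
    rw [ae_map_iff hm.aemeasurable hs]
    filter_upwards [hμ] with x hx using ⟨hx, hx⟩
  · rw [Measure.map_map measurable_fst hm]; exact Measure.map_id
  · rw [Measure.map_map measurable_snd hm]; exact Measure.map_id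

theorem isCouplingOn_dirac (h : IsGradEstimator C P H G L) {μ : Measure E}
    [IsProbabilityMeasure μ] (hμ : ∀ᵐ x ∂μ, x ∈ C) {z : E} (hz : z ∈ C) :
    IsCouplingOn C (μ.map fun x => (x, z)) μ (Measure.dirac z) := by
  have hm : Measurable fun x : E => (x, z) := by fun_prop
  refine ⟨Measure.isProbabilityMeasure_map hm.aemeasurable, ?_, ?_, ?_⟩
  · have hs : MeasurableSet {p : E × E | p.1 ∈ C ∧ p.2 ∈ C} :=
      (h.closed.measurableSet.preimage measurable_fst).inter
        (h.closed.measurableSet.preimage measurable_snd)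
    rw [ae_map_iff hm.aemeasurable hs]
    filter_upwards [hμ] with x hx using ⟨hx, hz⟩
  · rw [Measure.map_map measurable_fst hm]; exact Measure.map_id
  · rw [Measure.map_map measurable_snd hm]
    change μ.map (fun _ => z) = _
    rw [Measure.map_const]; simp

theorem integral_fst (_h : IsGradEstimator C P H G L) {ν : Measure (E × E)} {μ μ' : Measure E}
    (hν : IsCouplingOn C ν μ μ') {f : E → ℝ} (hf : Continuous f) :
    ∫ x, f x ∂μ = ∫ p, f p.1 ∂ν := by
  rw [← hν.fst, integral_map measurable_fst.aemeasurable hf.measurable.aestronglyMeasurable]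

theorem integral_snd (_h : IsGradEstimator C P H G L) {ν : Measure (E × E)} {μ μ' : Measure E}
    (hν : IsCouplingOn C ν μ μ') {f : E → ℝ} (hf : Continuous f) :
    ∫ x, f x ∂μ' = ∫ p, f p.2 ∂ν := by
  rw [← hν.snd, integral_map measurable_snd.aemeasurable hf.measurable.aestronglyMeasurable]

/-- The regret inequality for one step of the chain. -/
theorem sgLaw_regret (h : IsGradEstimator C P H G L) {α : ℕ → ℝ} (hα : ∀ i, 0 ≤ α i)
    {x₀ : E} (hx₀ : x₀ ∈ C) {z : E} (hz : z ∈ C) (n : ℕ) :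
    ∫ x, ‖x - z‖ ^ 2 ∂(sgLaw C P H α x₀ (n + 1)) +
        2 * α n * ∫ x, ⟪G x, G (x - z)⟫ ∂(sgLaw C P H α x₀ n) ≤
      ∫ x, ‖x - z‖ ^ 2 ∂(sgLaw C P H α x₀ n) + (α n * L) ^ 2 := by
  obtain ⟨h1, h2⟩ := h.sgLaw_spec α hx₀ n
  have hν := h.isCouplingOn_dirac h2 hz
  have hν' := h.isCouplingOn_sgPair hν (α n) 0
  rw [h.sgNext_zero ((ae_dirac_iff h.closed.measurableSet).2 hz)] at hν'
  have hae : ∀ {ν : Measure (E × E)} {μ : Measure E},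
      IsCouplingOn C ν μ (Measure.dirac z) → ∀ᵐ p ∂ν, p.2 = z := by
    intro ν μ hc
    have : ∀ᵐ y ∂(ν.map Prod.snd), y = z := by
      rw [hc.snd]; exact (ae_dirac_iff (measurableSet_singleton z)).2 rfl
    exact ae_of_ae_map measurable_snd.aemeasurable this
  have key := h.sgPair_zero_le hν (hα n)
  rw [sgLaw, h.integral_fst hν' (f := fun x => ‖x - z‖ ^ 2) (by fun_prop),
    h.integral_fst hν (f := fun x => ‖x - z‖ ^ 2) (by fun_prop),
    h.integral_fst hν (f := fun x => ⟪G x, G (x - z)⟫) (by fun_prop)]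
  have e1 : ∫ p : E × E, ‖p.1 - z‖ ^ 2 ∂(sgPair C P H (α n) 0
      ((sgLaw C P H α x₀ n).map fun x => (x, z))) =
      ∫ p : E × E, ‖p.1 - p.2‖ ^ 2 ∂(sgPair C P H (α n) 0
      ((sgLaw C P H α x₀ n).map fun x => (x, z))) :=
    integral_congr_ae (by filter_upwards [hae hν'] with p hp; rw [hp])
  have e2 : ∫ p : E × E, ‖p.1 - z‖ ^ 2 ∂((sgLaw C P H α x₀ n).map fun x => (x, z)) =
      ∫ p : E × E, ‖p.1 - p.2‖ ^ 2 ∂((sgLaw C P H α x₀ n).map fun x => (x, z)) :=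
    integral_congr_ae (by filter_upwards [hae hν] with p hp; rw [hp])
  have e3 : ∫ p : E × E, ⟪G p.1, G (p.1 - z)⟫ ∂((sgLaw C P H α x₀ n).map fun x => (x, z)) =
      ∫ p : E × E, ⟪G p.1, G (p.1 - p.2)⟫ ∂((sgLaw C P H α x₀ n).map fun x => (x, z)) :=
    integral_congr_ae (by filter_upwards [hae hν] with p hp; rw [hp])
  rw [e1, e2, e3]
  exact key

/-- The chain moves at most diffusively away from a time with small regret. -/
theorem exists_coupling_shift (h : IsGradEstimator C P H G L) {α : ℕ → ℝ} (hα : ∀ i, 0 ≤ α i)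
    {x₀ : E} (hx₀ : x₀ ∈ C) {z : E} (hz : z ∈ C) (hmin : ∀ x ∈ C, ‖G z‖ ≤ ‖G x‖) {n : ℕ}
    {a : ℝ} (ha : ∀ i, α (n + i) ≤ a) (j : ℕ) :
    ∃ ν, IsCouplingOn C ν (sgLaw C P H α x₀ (n + j)) (sgLaw C P H α x₀ n) ∧
      ∫ p, ‖p.1 - p.2‖ ^ 2 ∂ν ≤
        j * (2 * a * ∫ x, ⟪G x, G (x - z)⟫ ∂(sgLaw C P H α x₀ n) + (a * L) ^ 2) := by
  obtain ⟨h1, h2⟩ := h.sgLaw_spec α hx₀ n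
  set e := ∫ x, ⟪G x, G (x - z)⟫ ∂(sgLaw C P H α x₀ n) with he
  -- The regret of x against y can be negative only as far as y itself is suboptimal. This is why a
  -- starting time of small regret e keeps the later displacement small.
  have hpt : ∀ x ∈ C, ∀ y ∈ C, -⟪G y, G (y - z)⟫ ≤ ⟪G x, G (x - y)⟫ := by
    intro x hx y hy
    have h6 : ⟪G x, G (x - y)⟫ = (‖G x‖ ^ 2 - ‖G y‖ ^ 2) / 2 + ‖G x - G y‖ ^ 2 / 2 := by
      simp only [map_sub, inner_sub_left, inner_sub_right,
        ← real_inner_self_eq_norm_sq, real_inner_comm (G x) (G y)]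
      ring
    have h7 : ⟪G y, G (y - z)⟫ = (‖G y‖ ^ 2 - ‖G z‖ ^ 2) / 2 + ‖G y - G z‖ ^ 2 / 2 := by
      simp only [map_sub, inner_sub_left, inner_sub_right,
        ← real_inner_self_eq_norm_sq, real_inner_comm (G y) (G z)]
      ring
    have h8 := pow_le_pow_left₀ (norm_nonneg _) (hmin x hx) 2
    nlinarith [sq_nonneg ‖G x - G y‖, sq_nonneg ‖G y - G z‖]
  have he0 : 0 ≤ e := by
    refine integral_nonneg_of_ae ?_
    filter_upwards [h2] with x hx
    have := hpt z hz x hx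
    have h6 := hpt x hx z hz
    simp only [sub_self, map_zero, inner_zero_right, neg_zero] at h6
    exact h6
  induction j with
  | zero => exact ⟨_, h.isCouplingOn_diag h2, by
      rw [integral_map (by fun_prop) (Continuous.aestronglyMeasurable (by fun_prop))]; simp⟩
  | succ j ih =>
    obtain ⟨ν, hν, hle⟩ := ih
    -- The second coordinate stays frozen at its position at time n while the first one advances.
    refine ⟨sgPair C P H (α (n + j)) 0 ν, ?_, ?_⟩
    · have := h.isCouplingOn_sgPair hν (α (n + j)) 0
      rwa [h.sgNext_zero h2] at this
    · have h3 := h.sgPair_zero_le hν (hα (n + j))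
      have h4 : -e ≤ ∫ p, ⟪G p.1, G (p.1 - p.2)⟫ ∂ν := by
        have := hν.prob
        have hint : Integrable (fun p : E × E => ⟪G p.2, G (p.2 - z)⟫) ν := by
          refine h.integrable_of_continuous hν (by fun_prop) (b := L * 2) fun x hx y hy => ?_
          exact (h.abs_inner_map_le hy _).trans
            (mul_le_mul_of_nonneg_left (h.diam _ hy _ hz) h.bound_nonneg)
        rw [he, h.integral_snd hν (f := fun x => ⟪G x, G (x - z)⟫) (by fun_prop),
          ← integral_neg]
        refine integral_mono_ae hint.neg (h.integrable_regret hν) ?_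
        filter_upwards [hν.mem] with p hp using hpt _ hp.1 _ hp.2
      have h5 := hα (n + j)
      have h6 := ha j
      have h7 : (α (n + j) * L) ^ 2 ≤ (a * L) ^ 2 :=
        pow_le_pow_left₀ (mul_nonneg h5 h.bound_nonneg)
          (mul_le_mul_of_nonneg_right h6 h.bound_nonneg) 2
      push_cast
      nlinarith [mul_le_mul_of_nonneg_left h4 h5, mul_le_mul_of_nonneg_right h6 he0]

/-- Running the chain and its time shift with common samples keeps them close. -/
theorem exists_coupling_run (h : IsGradEstimator C P H G L) {α : ℕ → ℝ} (hα : ∀ i, 0 ≤ α i)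
    (hanti : Antitone α) {x₀ z : E} (hz : z ∈ C)
    (hmin : ∀ x ∈ C, ‖G z‖ ≤ ‖G x‖) {n j : ℕ} {a d R : ℝ} (ha : ∀ i, α (n + i) ≤ a)
    (hd : ∀ i, α (n + i) - α (n + j + i) ≤ d)
    (hR : ∃ ν, IsCouplingOn C ν (sgLaw C P H α x₀ (n + j)) (sgLaw C P H α x₀ n) ∧
      ∫ p, ‖p.1 - p.2‖ ^ 2 ∂ν ≤ R)
    (he : ∀ i, 0 ≤ ∫ x, ⟪G x, G (x - z)⟫ ∂(sgLaw C P H α x₀ i)) (m : ℕ) :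
    ∃ ν, IsCouplingOn C ν (sgLaw C P H α x₀ (n + j + m)) (sgLaw C P H α x₀ (n + m)) ∧
      ∫ p, ‖p.1 - p.2‖ ^ 2 ∂ν ≤ (1 + 2 * (a * L) ^ 2) ^ m * (R + ∑ i ∈ Finset.range m,
        (2 * d * ∫ x, ⟪G x, G (x - z)⟫ ∂(sgLaw C P H α x₀ (n + j + i)) + 2 * (d * L) ^ 2)) := by
  have hL := h.bound_nonneg
  have hd0 : 0 ≤ d := (sub_nonneg.2 (hanti (by omega))).trans (hd 0)
  induction m with
  | zero => simpa using hR
  | succ m ih =>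
    obtain ⟨ν, hν, hle⟩ := ih
    refine ⟨sgPair C P H (α (n + j + m)) (α (n + m)) ν, h.isCouplingOn_sgPair hν _ _, ?_⟩
    have h1 := h.sgPair_le hν hz hmin (hα (n + j + m)) (hanti (by omega : n + m ≤ n + j + m))
    set e := ∫ x, ⟪G x, G (x - z)⟫ ∂(sgLaw C P H α x₀ (n + j + m)) with hedef
    set S := ∑ i ∈ Finset.range m,
        (2 * d * ∫ x, ⟪G x, G (x - z)⟫ ∂(sgLaw C P H α x₀ (n + j + i)) + 2 * (d * L) ^ 2)
    have hI : 0 ≤ ∫ p, ‖p.1 - p.2‖ ^ 2 ∂ν := integral_nonneg fun p => by positivity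
    have h2 : (α (n + m) * L) ^ 2 ≤ (a * L) ^ 2 :=
      pow_le_pow_left₀ (mul_nonneg (hα _) hL) (mul_le_mul_of_nonneg_right (ha m) hL) 2
    have h3 : ((α (n + m) - α (n + j + m)) * L) ^ 2 ≤ (d * L) ^ 2 :=
      pow_le_pow_left₀ (mul_nonneg (sub_nonneg.2 (hanti (by omega))) hL)
        (mul_le_mul_of_nonneg_right (hd m) hL) 2
    have h4 : (α (n + m) - α (n + j + m)) * e ≤ d * e :=
      mul_le_mul_of_nonneg_right (hd m) (he _)
    have h5 : (1 + 2 * (α (n + m) * L) ^ 2) * ∫ p, ‖p.1 - p.2‖ ^ 2 ∂ν ≤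
        (1 + 2 * (a * L) ^ 2) * ((1 + 2 * (a * L) ^ 2) ^ m * (R + S)) :=
      mul_le_mul (by linarith) hle hI (by positivity)
    -- As the growth factor is at least 1, the newly added error may be placed inside the product as
    -- well.
    have h6 : 1 ≤ (1 + 2 * (a * L) ^ 2) ^ (m + 1) := one_le_pow₀ (by nlinarith [sq_nonneg (a * L)])
    have h7 : 0 ≤ 2 * d * e + 2 * (d * L) ^ 2 :=
      add_nonneg (mul_nonneg (by positivity) (he _)) (by positivity)
    rw [Finset.sum_range_succ]
    have h8 := mul_le_mul_of_nonneg_right h6 h7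
    have h9 : (1 + 2 * (a * L) ^ 2) ^ (m + 1) *
        (R + (S + (2 * d * e + 2 * (d * L) ^ 2))) =
        (1 + 2 * (a * L) ^ 2) * ((1 + 2 * (a * L) ^ 2) ^ m * (R + S)) +
        (1 + 2 * (a * L) ^ 2) ^ (m + 1) * (2 * d * e + 2 * (d * L) ^ 2) := by ring
    rw [h9]
    linarith

end IsGradEstimator
end ProjectedSGD

/-- This is nonnegativity of the variance. -/
theorem sq_integral_le {α : Type*} [MeasurableSpace α] {μ : Measure α} [IsProbabilityMeasure μ]
    {f : α → ℝ} (hf : Integrable f μ) (hf2 : Integrable (fun x => f x ^ 2) μ) :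
    (∫ x, f x ∂μ) ^ 2 ≤ ∫ x, f x ^ 2 ∂μ := by
  set m := ∫ x, f x ∂μ with hm
  have h1 : Integrable (fun x => 2 * m * f x) μ := hf.const_mul _
  have h2 : Integrable (fun x => f x ^ 2 - 2 * m * f x) μ := hf2.sub h1
  have h0 : 0 ≤ ∫ x, (f x ^ 2 - 2 * m * f x + m ^ 2) ∂μ :=
    integral_nonneg fun x => by
      have := sq_nonneg (f x - m)
      change 0 ≤ f x ^ 2 - 2 * m * f x + m ^ 2
      linarith
  rw [integral_add h2 (integrable_const _), integral_sub hf2 h1, integral_const_mul, ← hm] at h0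
  simp only [integral_const, probReal_univ, smul_eq_mul, one_mul] at h0
  linarith

/-! ### Step lengths at times comparable to N -/

section StepLength

/-- The step lengths `c / √(i + 1)`. -/
noncomputable def stepLen (c : ℝ) (i : ℕ) : ℝ := c / √((i : ℝ) + 1)

variable {c : ℝ}

theorem stepLen_nonneg (hc : 0 < c) (i : ℕ) : 0 ≤ stepLen c i := by
  unfold stepLen; positivity

theorem antitone_stepLen (hc : 0 < c) : Antitone (stepLen c) := fun i j hij =>
  div_le_div_of_nonneg_left hc.le (by positivity)
    (Real.sqrt_le_sqrt (by exact_mod_cast Nat.add_le_add_right hij 1))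

theorem stepLen_le (hc : 0 < c) {N i : ℕ} (hN : 1 ≤ N) (hi : N ≤ 4 * (i + 1)) :
    stepLen c i ≤ 2 * c / √N := by
  have hN' : (0 : ℝ) < N := by exact_mod_cast hN
  have h1 : √(N : ℝ) ≤ 2 * √((i : ℝ) + 1) := by
    rw [Real.sqrt_le_left (by positivity), mul_pow, Real.sq_sqrt (by positivity)]
    have : (N : ℝ) ≤ 4 * (i + 1) := by exact_mod_cast hi
    linarith
  rw [stepLen, div_le_div_iff₀ (by positivity) (by positivity)]
  nlinarith

theorem le_stepLen (hc : 0 < c) {N i : ℕ} (hN : 1 ≤ N) (hi : i + 1 ≤ 4 * N) :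
    c / (2 * √N) ≤ stepLen c i := by
  have hN' : (0 : ℝ) < N := by exact_mod_cast hN
  refine div_le_div_of_nonneg_left hc.le (by positivity) ?_
  rw [Real.sqrt_le_left (by positivity), mul_pow, Real.sq_sqrt (by positivity)]
  have : (i : ℝ) + 1 ≤ 4 * N := by exact_mod_cast hi
  linarith

/-- A time shift by j ≤ 2√N moves √(i+1) by at most 2 once i is of order N. Step lengths of the
shifted chain therefore differ by O(1/N), a factor √N below the steps themselves. Hence the mismatch
can be summed over about N steps. -/
theorem stepLen_sub_le (hc : 0 < c) {N i j : ℕ} (hN : 1 ≤ N) (hi : N ≤ 4 * (i + 1))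
    (hj : (j : ℝ) ≤ 2 * √N) : stepLen c i - stepLen c (i + j) ≤ 8 * c / N := by
  have hN' : (0 : ℝ) < N := by exact_mod_cast hN
  set s := √(N : ℝ) with hs
  have hs0 : 0 < s := Real.sqrt_pos.2 hN'
  have hss : s ^ 2 = N := Real.sq_sqrt hN'.le
  set u := √((i : ℝ) + 1) with hu
  set v := √(((i + j : ℕ) : ℝ) + 1) with hv
  have hu2 : u ^ 2 = (i : ℝ) + 1 := Real.sq_sqrt (by positivity)
  have hv2 : v ^ 2 = ((i + j : ℕ) : ℝ) + 1 := Real.sq_sqrt (by positivity)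
  have hu0 : 0 < u := Real.sqrt_pos.2 (by positivity)
  have huv : u ≤ v := Real.sqrt_le_sqrt (by push_cast; linarith [Nat.cast_nonneg (α := ℝ) j])
  have h1 : s ≤ 2 * u := by
    have : (N : ℝ) ≤ 4 * (i + 1) := by exact_mod_cast hi
    exact le_of_sq_le_sq (by nlinarith) (by positivity)
  have h2 : (v - u) * (v + u) ≤ 2 * s := by
    have : (v - u) * (v + u) = j := by
      have : (v - u) * (v + u) = v ^ 2 - u ^ 2 := by ring
      rw [this, hu2, hv2]; push_cast; ring
    rw [this]; exact hj
  have h3 : (v - u) * s ≤ 2 * s := by nlinarith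
  have h4 : v - u ≤ 2 := le_of_mul_le_mul_right h3 hs0
  have h5 : (v - u) * s ^ 2 ≤ 8 * (u * v) := by nlinarith
  have h6 : stepLen c i - stepLen c (i + j) = c * (v - u) / (u * v) := by
    have hv0 : 0 < v := hu0.trans_le huv
    rw [stepLen, stepLen, ← hu, ← hv]
    field_simp
  rw [h6, div_le_div_iff₀ (by nlinarith) hN', ← hss]
  nlinarith

end StepLength

/-! ### Regret of the last iterate -/

section ProjectedSGD

variable {E : Type*} [NormedAddCommGroup E] [InnerProductSpace ℝ E]
variable {F Ω : Type*} [NormedAddCommGroup F] [InnerProductSpace ℝ F] [MeasurableSpace Ω]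
  [CompleteSpace E] [SecondCountableTopology E] [MeasurableSpace E] [BorelSpace E]

namespace IsGradEstimator

variable {C : Set E} {P : Measure Ω} [IsProbabilityMeasure P] {H : Ω → E → E} {G : E →L[ℝ] F}
  {L : ℝ}

theorem regret_nonneg (_h : IsGradEstimator C P H G L) {x z : E} (hx : x ∈ C)
    (hmin : ∀ x ∈ C, ‖G z‖ ≤ ‖G x‖) : 0 ≤ ⟪G x, G (x - z)⟫ := by
  have h7 : ⟪G x, G (x - z)⟫ = (‖G x‖ ^ 2 - ‖G z‖ ^ 2) / 2 + ‖G x - G z‖ ^ 2 / 2 := by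
    simp only [map_sub, inner_sub_left, inner_sub_right,
      ← real_inner_self_eq_norm_sq, real_inner_comm (G x) (G z)]
    ring
  have h8 := pow_le_pow_left₀ (norm_nonneg _) (hmin x hx) 2
  nlinarith [sq_nonneg ‖G x - G z‖]

/-- The one-step inequality telescopes. Both end distances are kept because over a window of √N
steps it is their difference that is small, not the distances themselves. -/
theorem sum_regret_le (h : IsGradEstimator C P H G L) {α : ℕ → ℝ} (hα : ∀ i, 0 ≤ α i)
    {x₀ : E} (hx₀ : x₀ ∈ C) {z : E} (hz : z ∈ C) {a : ℝ} {n : ℕ} (m : ℕ)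
    (ha : ∀ i, α (n + i) ≤ a) :
    ∑ i ∈ Finset.range m,
        2 * α (n + i) * ∫ x, ⟪G x, G (x - z)⟫ ∂(sgLaw C P H α x₀ (n + i)) ≤
      ∫ x, ‖x - z‖ ^ 2 ∂(sgLaw C P H α x₀ n) - ∫ x, ‖x - z‖ ^ 2 ∂(sgLaw C P H α x₀ (n + m)) +
        m * (a * L) ^ 2 := by
  induction m with
  | zero => simp
  | succ m ih =>
    rw [Finset.sum_range_succ]
    have h1 := h.sgLaw_regret hα hx₀ hz (n + m)
    have h7 : (α (n + m) * L) ^ 2 ≤ (a * L) ^ 2 :=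
      pow_le_pow_left₀ (mul_nonneg (hα _) h.bound_nonneg)
        (mul_le_mul_of_nonneg_right (ha m) h.bound_nonneg) 2
    rw [← add_assoc]
    push_cast
    linarith

theorem integral_sq_le_four (h : IsGradEstimator C P H G L) {μ : Measure E}
    [IsProbabilityMeasure μ] (hμ : ∀ᵐ x ∂μ, x ∈ C) {z : E} (hz : z ∈ C) :
    ∫ x, ‖x - z‖ ^ 2 ∂μ ≤ 4 := by
  have h1 : ∀ᵐ x ∂μ, ‖‖x - z‖ ^ 2‖ ≤ 4 := by
    filter_upwards [hμ] with x hx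
    rw [Real.norm_of_nonneg (by positivity)]
    have := pow_le_pow_left₀ (norm_nonneg _) (h.diam x hx z hz) 2
    linarith
  have := norm_integral_le_of_norm_le_const h1
  rw [probReal_univ, mul_one] at this
  exact (le_abs_self _).trans this

/-- Summed regret against a minimizer over the times between `N / 2` and `3 N`. -/
theorem sum_minRegret_le (h : IsGradEstimator C P H G L) {c : ℝ} (hc : 0 < c)
    {x₀ : E} (hx₀ : x₀ ∈ C) {z : E} (hz : z ∈ C) (hmin : ∀ x ∈ C, ‖G z‖ ≤ ‖G x‖) {N : ℕ}
    (hN : 1 ≤ N) :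
    ∑ i ∈ Finset.range (3 * N - N / 2),
        ∫ x, ⟪G x, G (x - z)⟫ ∂(sgLaw C P H (stepLen c) x₀ (N / 2 + i)) ≤
      (4 + 12 * (c * L) ^ 2) / c * √N := by
  have hN' : (0 : ℝ) < N := by exact_mod_cast hN
  have hs : 0 < √(N : ℝ) := Real.sqrt_pos.2 hN'
  have hss : √(N : ℝ) ^ 2 = N := Real.sq_sqrt hN'.le
  have he : ∀ i, 0 ≤ ∫ x, ⟪G x, G (x - z)⟫ ∂(sgLaw C P H (stepLen c) x₀ i) := fun i => by
    refine integral_nonneg_of_ae ?_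
    filter_upwards [(h.sgLaw_spec (stepLen c) hx₀ i).2] with x hx using h.regret_nonneg hx hmin
  obtain ⟨h1, h2⟩ := h.sgLaw_spec (stepLen c) hx₀ (N / 2)
  have h3 := h.sum_regret_le (stepLen_nonneg hc) hx₀ hz (n := N / 2) (a := 2 * c / √N)
    (3 * N - N / 2) fun i => stepLen_le hc hN (by omega)
  have h4 := h.integral_sq_le_four h2 hz
  have h5 : 0 ≤ ∫ x, ‖x - z‖ ^ 2 ∂(sgLaw C P H (stepLen c) x₀ (N / 2 + (3 * N - N / 2))) :=
    integral_nonneg fun x => by positivity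
  have h6 : ((3 * N - N / 2 : ℕ) : ℝ) * (2 * c / √N * L) ^ 2 ≤ 12 * (c * L) ^ 2 := by
    have : ((3 * N - N / 2 : ℕ) : ℝ) ≤ 3 * N := by exact_mod_cast Nat.sub_le _ _
    have e : (2 * c / √N * L) ^ 2 = 4 * (c * L) ^ 2 / N := by
      rw [mul_pow, div_pow, hss]; ring
    rw [e]
    calc ((3 * N - N / 2 : ℕ) : ℝ) * (4 * (c * L) ^ 2 / N) ≤ 3 * N * (4 * (c * L) ^ 2 / N) := by
          gcongr
      _ = 12 * (c * L) ^ 2 := by field_simp; ring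
  have h7 : c / √N * ∑ i ∈ Finset.range (3 * N - N / 2),
        ∫ x, ⟪G x, G (x - z)⟫ ∂(sgLaw C P H (stepLen c) x₀ (N / 2 + i)) ≤
      ∑ i ∈ Finset.range (3 * N - N / 2), 2 * stepLen c (N / 2 + i) *
        ∫ x, ⟪G x, G (x - z)⟫ ∂(sgLaw C P H (stepLen c) x₀ (N / 2 + i)) := by
    rw [Finset.mul_sum]
    refine Finset.sum_le_sum fun i hi => mul_le_mul_of_nonneg_right ?_ (he _)
    have := le_stepLen hc hN (i := N / 2 + i) (by have := Finset.mem_range.1 hi; omega)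
    calc c / √N = 2 * (c / (2 * √N)) := by field_simp
      _ ≤ _ := by linarith
  have h8 := h7.trans (h3.trans (by linarith : _ ≤ 4 + 12 * (c * L) ^ 2))
  rw [div_mul_eq_mul_div, div_le_iff₀ hs] at h8
  rw [div_mul_eq_mul_div, le_div_iff₀ hc]
  linarith

/-- The laws at the times `N` and `N + j`, `j ≤ 2 √N`, are close. -/
theorem exists_coupling_last (h : IsGradEstimator C P H G L) {c : ℝ} (hc : 0 < c)
    {x₀ : E} (hx₀ : x₀ ∈ C) {z : E} (hz : z ∈ C) (hmin : ∀ x ∈ C, ‖G z‖ ≤ ‖G x‖) {N : ℕ}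
    (hN : 1 ≤ N) {j : ℕ} (hj : (j : ℝ) ≤ 2 * √N) :
    ∃ ν, IsCouplingOn C ν (sgLaw C P H (stepLen c) x₀ (N + j)) (sgLaw C P H (stepLen c) x₀ N) ∧
      ∫ p, ‖p.1 - p.2‖ ^ 2 ∂ν ≤ Real.exp (8 * (c * L) ^ 2) *
        (32 * (4 + 12 * (c * L) ^ 2) + 136 * (c * L) ^ 2) / √N := by
  have hN' : (1 : ℝ) ≤ N := by exact_mod_cast hN
  have hN0 : (0 : ℝ) < N := by linarith
  set s := √(N : ℝ) with hsdef
  have hs : 0 < s := Real.sqrt_pos.2 hN0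
  have hss : s ^ 2 = N := Real.sq_sqrt hN0.le
  have hs1 : 1 ≤ s := Real.one_le_sqrt.2 hN'
  set g := 4 + 12 * (c * L) ^ 2 with hg
  have hg0 : 0 < g := by positivity
  have he : ∀ i, 0 ≤ ∫ x, ⟪G x, G (x - z)⟫ ∂(sgLaw C P H (stepLen c) x₀ i) := fun i => by
    refine integral_nonneg_of_ae ?_
    filter_upwards [(h.sgLaw_spec (stepLen c) hx₀ i).2] with x hx using h.regret_nonneg hx hmin
  set e : ℕ → ℝ := fun i => ∫ x, ⟪G x, G (x - z)⟫ ∂(sgLaw C P H (stepLen c) x₀ i) with hedef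
  have hsum : ∑ i ∈ Finset.Ico (N / 2) (3 * N), e i ≤ g / c * s := by
    rw [Finset.sum_Ico_eq_sum_range]
    exact h.sum_minRegret_le hc hx₀ hz hmin hN
  have hsub : ∀ {a b : ℕ}, N / 2 ≤ a → b ≤ 3 * N →
      ∑ i ∈ Finset.Ico a b, e i ≤ g / c * s := fun {a b} h1 h2 =>
    (Finset.sum_le_sum_of_subset_of_nonneg (Finset.Ico_subset_Ico h1 h2)
      fun i _ _ => he i).trans hsum
  -- Pigeonhole: at least N/2 nonnegative terms have sum at most (g/c)√N.
  obtain ⟨n, hn, hen⟩ : ∃ n ∈ Finset.Ico (N / 2) N, e n ≤ 2 * g / (c * s) := by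
    refine Finset.exists_le_of_sum_le ⟨N / 2, Finset.mem_Ico.2 ⟨le_rfl, by omega⟩⟩ ?_
    refine (hsub le_rfl (by omega)).trans ?_
    rw [Finset.sum_const, Nat.card_Ico, nsmul_eq_mul]
    have h1 : (N : ℝ) / 2 ≤ ((N - N / 2 : ℕ) : ℝ) := by
      have : N ≤ 2 * (N - N / 2) := by omega
      have : (N : ℝ) ≤ 2 * ((N - N / 2 : ℕ) : ℝ) := by exact_mod_cast this
      linarith
    calc g / c * s = (N : ℝ) / 2 * (2 * g / (c * s)) := by rw [← hss]; field_simp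
      _ ≤ _ := by gcongr
  obtain ⟨hn1, hn2⟩ := Finset.mem_Ico.1 hn
  have ha : ∀ i, stepLen c (n + i) ≤ 2 * c / s := fun i => stepLen_le hc hN (by omega)
  have hjN : j ≤ 2 * N := by
    have : (j : ℝ) ≤ 2 * N := by nlinarith
    exact_mod_cast this
  have hrun := h.exists_coupling_run (stepLen_nonneg hc) (antitone_stepLen hc) hz hmin
    (n := n) (j := j) (a := 2 * c / s) (d := 8 * c / N) ha
    (fun i => by
      have := stepLen_sub_le hc hN (i := n + i) (j := j) (by omega) hj
      rwa [show n + j + i = n + i + j by omega])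
    (h.exists_coupling_shift (stepLen_nonneg hc) hx₀ hz hmin ha j) he (N - n)
  rw [show n + j + (N - n) = N + j by omega, show n + (N - n) = N by omega] at hrun
  obtain ⟨ν, hν, hle⟩ := hrun
  refine ⟨ν, hν, hle.trans ?_⟩
  -- Each common step expands squared distances by 1 + O(1/N), so at most N of them cost a constant
  -- factor.
  have b1 : (1 + 2 * (2 * c / s * L) ^ 2) ^ (N - n) ≤ Real.exp (8 * (c * L) ^ 2) := by
    have e1 : 2 * (2 * c / s * L) ^ 2 = 8 * (c * L) ^ 2 / N := by
      rw [← hss]; field_simp; ring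
    rw [e1]
    calc (1 + 8 * (c * L) ^ 2 / N) ^ (N - n) ≤ (1 + 8 * (c * L) ^ 2 / N) ^ N :=
          pow_le_pow_right₀ (by linarith [show 0 ≤ 8 * (c * L) ^ 2 / N by positivity]) (by omega)
      _ ≤ (Real.exp (8 * (c * L) ^ 2 / N)) ^ N := by
          refine pow_le_pow_left₀ (by positivity) ?_ N
          rw [add_comm]; exact Real.add_one_le_exp _
      _ = _ := by rw [← Real.exp_nat_mul]; congr 1; field_simp
  -- Squared displacement over the shift: O(√N) steps, each contributing O(1/N) thanks to the choice
  -- of n.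
  have b2 : (j : ℝ) * (2 * (2 * c / s) * e n + (2 * c / s * L) ^ 2) ≤
      (16 * g + 8 * (c * L) ^ 2) / s := by
    calc (j : ℝ) * (2 * (2 * c / s) * e n + (2 * c / s * L) ^ 2)
        ≤ (2 * s) * (2 * (2 * c / s) * (2 * g / (c * s)) + (2 * c / s * L) ^ 2) := by
          have := he n
          gcongr
      _ = _ := by field_simp; ring
  -- Cost of the unequal step lengths: differences O(1/N) against a total regret O(√N), plus at most
  -- N terms of size O(1/N²).
  have b3 : ∑ i ∈ Finset.range (N - n), (2 * (8 * c / N) * e (n + j + i) +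
      2 * (8 * c / N * L) ^ 2) ≤ (16 * g + 128 * (c * L) ^ 2) / s := by
    rw [Finset.sum_add_distrib, ← Finset.mul_sum, Finset.sum_const, Finset.card_range,
      nsmul_eq_mul]
    have h1 : ∑ i ∈ Finset.range (N - n), e (n + j + i) ≤ g / c * s := by
      have := hsub (a := n + j) (b := N + j) (by omega) (by omega)
      rwa [Finset.sum_Ico_eq_sum_range, show N + j - (n + j) = N - n by omega] at this
    have h2 : ((N - n : ℕ) : ℝ) ≤ N := by exact_mod_cast Nat.sub_le _ _
    calc 2 * (8 * c / N) * ∑ i ∈ Finset.range (N - n), e (n + j + i) +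
          ((N - n : ℕ) : ℝ) * (2 * (8 * c / N * L) ^ 2)
        ≤ 2 * (8 * c / N) * (g / c * s) + N * (2 * (8 * c / N * L) ^ 2) := by gcongr
      _ = 16 * g / s + 128 * (c * L) ^ 2 / s ^ 2 := by rw [← hss]; field_simp; ring
      _ ≤ 16 * g / s + 128 * (c * L) ^ 2 / s := by
          gcongr
          nlinarith
      _ = _ := by ring
  have b4 : 0 ≤ (j : ℝ) * (2 * (2 * c / s) * e n + (2 * c / s * L) ^ 2) := by
    have := he n; positivity
  have b5 : 0 ≤ ∑ i ∈ Finset.range (N - n), (2 * (8 * c / N) * e (n + j + i) +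
      2 * (8 * c / N * L) ^ 2) := Finset.sum_nonneg fun i _ => by
    have := he (n + j + i); positivity
  calc _ ≤ Real.exp (8 * (c * L) ^ 2) * ((16 * g + 8 * (c * L) ^ 2) / s +
          (16 * g + 128 * (c * L) ^ 2) / s) :=
        mul_le_mul b1 (add_le_add b2 b3) (add_nonneg b4 b5) (Real.exp_nonneg _)
    _ = _ := by ring

/-- The last iterate of the projected stochastic gradient method with step lengths `c / √i` has
expected regret of order `N ^ (-1/4)` against every point. -/
theorem regret_last_le (h : IsGradEstimator C P H G L) {c : ℝ} (hc : 0 < c)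
    {x₀ : E} (hx₀ : x₀ ∈ C) {z₀ : E} (hz₀ : z₀ ∈ C) (hmin : ∀ x ∈ C, ‖G z₀‖ ≤ ‖G x‖) {N : ℕ}
    (hN : 1 ≤ N) {z : E} (hz : z ∈ C) :
    ∫ x, ⟪G x, G (x - z)⟫ ∂(sgLaw C P H (stepLen c) x₀ N) ≤
      ((3 * L + 4 / c) * √(Real.exp (8 * (c * L) ^ 2) *
        (32 * (4 + 12 * (c * L) ^ 2) + 136 * (c * L) ^ 2)) + 8 * c * L ^ 2) / √√N := by
  have hN' : (1 : ℝ) ≤ N := by exact_mod_cast hN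
  have hN0 : (0 : ℝ) < N := by linarith
  set s := √(N : ℝ) with hsdef
  have hs : 0 < s := Real.sqrt_pos.2 hN0
  have hss : s ^ 2 = N := Real.sq_sqrt hN0.le
  have hs1 : 1 ≤ s := Real.one_le_sqrt.2 hN'
  set q := √s with hq
  have hq0 : 0 < q := Real.sqrt_pos.2 hs
  have hqq : q ^ 2 = s := Real.sq_sqrt hs.le
  have hq1 : 1 ≤ q := Real.one_le_sqrt.2 hs1
  set D := Real.exp (8 * (c * L) ^ 2) * (32 * (4 + 12 * (c * L) ^ 2) + 136 * (c * L) ^ 2) with hD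
  have hL := h.bound_nonneg
  set r : ℕ → ℝ := fun i => ∫ x, ⟪G x, G (x - z)⟫ ∂(sgLaw C P H (stepLen c) x₀ i) with hr
  set V : ℕ → ℝ := fun i => ∫ x, ‖x - z‖ ^ 2 ∂(sgLaw C P H (stepLen c) x₀ i) with hV
  set δ := √D / q with hδ
  have hδ0 : 0 ≤ δ := by positivity
  -- Here δ = √D · N^(-1/4) bounds the mean distance in the coupling. On C the regret is
  -- 3L-Lipschitz and the squared distance to z is 4-Lipschitz, because the diameter is at most 2.
  have key : ∀ j : ℕ, (j : ℝ) ≤ 2 * s → r N - 3 * L * δ ≤ r (N + j) ∧ V N - V (N + j) ≤ 4 * δ := by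
    intro j hj
    obtain ⟨ν, hν, hle⟩ := h.exists_coupling_last hc hx₀ hz₀ hmin hN hj
    have := hν.prob
    have hi1 : Integrable (fun p : E × E => ‖p.1 - p.2‖) ν := by
      refine h.integrable_of_continuous hν (by fun_prop) (b := 2) fun x hx y hy => ?_
      rw [abs_norm]; exact h.diam x hx y hy
    have hd : ∫ p, ‖p.1 - p.2‖ ∂ν ≤ δ := by
      have h1 := (sq_integral_le hi1 (h.integrable_sq hν)).trans hle
      have h2 : δ ^ 2 = D / s := by
        rw [hδ, div_pow, Real.sq_sqrt (by positivity), hqq]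
      exact le_of_sq_le_sq (by rw [h2]; exact h1) hδ0
    have hir : ∀ {f : E × E → E}, Continuous f → (∀ x ∈ C, ∀ y ∈ C, f (x, y) ∈ C) →
        Integrable (fun p => ⟪G (f p), G (f p - z)⟫) ν := by
      intro f hf hfC
      refine h.integrable_of_continuous hν (by fun_prop) (b := L * 2) fun x hx y hy => ?_
      exact (h.abs_inner_map_le (hfC x hx y hy) _).trans
        (mul_le_mul_of_nonneg_left (h.diam _ (hfC x hx y hy) _ hz) hL)
    have hiv : ∀ {f : E × E → E}, Continuous f → (∀ x ∈ C, ∀ y ∈ C, f (x, y) ∈ C) →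
        Integrable (fun p => ‖f p - z‖ ^ 2) ν := by
      intro f hf hfC
      refine h.integrable_of_continuous hν (by fun_prop) (b := 2 ^ 2) fun x hx y hy => ?_
      rw [abs_of_nonneg (by positivity)]
      exact pow_le_pow_left₀ (norm_nonneg _) (h.diam _ (hfC x hx y hy) _ hz) 2
    have i1 := hir continuous_fst (fun x hx _ _ => hx)
    have i2 := hir continuous_snd (fun _ _ y hy => hy)
    have i3 := hiv continuous_fst (fun x hx _ _ => hx)
    have i4 := hiv continuous_snd (fun _ _ y hy => hy)
    constructor
    · have h1 : r N - r (N + j) ≤ ∫ p, 3 * L * ‖p.1 - p.2‖ ∂ν := by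
        rw [hr]
        dsimp only
        rw [h.integral_fst hν (f := fun x => ⟪G x, G (x - z)⟫) (by fun_prop),
          h.integral_snd hν (f := fun x => ⟪G x, G (x - z)⟫) (by fun_prop), ← integral_sub i2 i1]
        refine integral_mono_ae (i2.sub i1) (hi1.const_mul _) ?_
        filter_upwards [hν.mem] with p hp
        obtain ⟨x, y⟩ := p
        obtain ⟨hx, hy⟩ := hp
        dsimp only at hx hy ⊢
        have e1 : ⟪G y, G (y - z)⟫ - ⟪G x, G (x - z)⟫ =
            -⟪G x - G y, G (y - z)⟫ - ⟪G x, G (x - y)⟫ := by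
          simp only [map_sub, inner_sub_left, inner_sub_right]; ring
        have e2 := (abs_le.1 (h.abs_inner_map_sub_le hx hy (y - z))).1
        have e3 := (abs_le.1 (h.abs_inner_map_le hx (x - y))).1
        have e4 := mul_le_mul_of_nonneg_left (h.diam y hy z hz)
          (mul_nonneg hL (norm_nonneg (x - y)))
        rw [e1]; linarith
      rw [integral_const_mul] at h1
      have := mul_le_mul_of_nonneg_left hd (by positivity : 0 ≤ 3 * L)
      linarith
    · have h1 : V N - V (N + j) ≤ ∫ p, 4 * ‖p.1 - p.2‖ ∂ν := by
        rw [hV]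
        dsimp only
        rw [h.integral_fst hν (f := fun x => ‖x - z‖ ^ 2) (by fun_prop),
          h.integral_snd hν (f := fun x => ‖x - z‖ ^ 2) (by fun_prop), ← integral_sub i4 i3]
        refine integral_mono_ae (i4.sub i3) (hi1.const_mul _) ?_
        filter_upwards [hν.mem] with p hp
        obtain ⟨x, y⟩ := p
        obtain ⟨hx, hy⟩ := hp
        dsimp only at hx hy ⊢
        have e1 := h.diam x hx z hz
        have e2 := h.diam y hy z hz
        have e3 : ‖y - z‖ ≤ ‖x - z‖ + ‖x - y‖ := by
          have := norm_sub_le (x - z) (x - y)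
          rwa [show x - z - (x - y) = y - z by abel] at this
        nlinarith [norm_nonneg (x - y), norm_nonneg (y - z), norm_nonneg (x - z)]
      rw [integral_const_mul] at h1
      linarith
  -- A window of length about √N balances the two effects: its step lengths add up to order c, yet
  -- the law hardly moves along it.
  set m := ⌈s⌉₊ with hm
  have hm1 : s ≤ m := Nat.le_ceil s
  have hm2 : (m : ℝ) ≤ 2 * s := by
    have := Nat.ceil_lt_add_one hs.le
    linarith
  have hmN : m ≤ 2 * N := by
    have : (m : ℝ) ≤ 2 * N := by nlinarith
    exact_mod_cast this
  have hsum := h.sum_regret_le (stepLen_nonneg hc) hx₀ hz (n := N) (a := 2 * c / s) m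
    fun i => stepLen_le hc hN (by omega)
  have hV4 := (key m hm2).2
  have hm3 : (m : ℝ) * (2 * c / s * L) ^ 2 ≤ 8 * (c * L) ^ 2 / q := by
    calc (m : ℝ) * (2 * c / s * L) ^ 2 ≤ 2 * s * (2 * c / s * L) ^ 2 := by gcongr
      _ = 8 * (c * L) ^ 2 / s := by field_simp; ring
      _ ≤ 8 * (c * L) ^ 2 / q := by
          gcongr
          nlinarith
  have hgoal : ((3 * L + 4 / c) * √D + 8 * c * L ^ 2) / q =
      3 * L * δ + (4 * δ + 8 * (c * L) ^ 2 / q) / c := by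
    rw [hδ]; field_simp
    ring
  rw [hgoal]
  change r N ≤ _
  -- The lower bound on the step lengths may be multiplied by this number only when it is positive.
  -- Otherwise the claim is immediate.
  rcases le_or_gt (r N - 3 * L * δ) 0 with h0 | h0
  · have : 0 ≤ (4 * δ + 8 * (c * L) ^ 2 / q) / c := by positivity
    linarith
  · have hlow : c * (r N - 3 * L * δ) ≤
        ∑ i ∈ Finset.range m, 2 * stepLen c (N + i) * r (N + i) := by
      calc c * (r N - 3 * L * δ) ≤ (m * (c / s)) * (r N - 3 * L * δ) := by
            refine mul_le_mul_of_nonneg_right ?_ h0.le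
            rw [mul_div_assoc', le_div_iff₀ hs]
            nlinarith
        _ = ∑ i ∈ Finset.range m, c / s * (r N - 3 * L * δ) := by
            rw [Finset.sum_const, Finset.card_range, nsmul_eq_mul]; ring
        _ ≤ _ := by
            refine Finset.sum_le_sum fun i hi => ?_
            have hi' := Finset.mem_range.1 hi
            have hi2 : (i : ℝ) ≤ 2 * s := (by exact_mod_cast hi'.le : (i : ℝ) ≤ m).trans hm2
            have h1 := le_stepLen hc hN (i := N + i) (by omega)
            refine mul_le_mul ?_ (key i hi2).1 h0.le
              (mul_nonneg zero_le_two (stepLen_nonneg hc _))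
            calc c / s = 2 * (c / (2 * s)) := by field_simp
              _ ≤ _ := by linarith
    have h2 := hlow.trans hsum
    have h3 : c * (r N - 3 * L * δ) ≤ 4 * δ + 8 * (c * L) ^ 2 / q := by
      refine h2.trans ?_
      change V N - V (N + m) + _ ≤ _
      linarith
    have h4 : r N - 3 * L * δ ≤ (4 * δ + 8 * (c * L) ^ 2 / q) / c := by
      rw [le_div_iff₀ hc]; linarith
    linarith

end IsGradEstimator
end ProjectedSGD

/-! ### Bounded measurable functions and Markov kernels -/

/-- `g` is measurable and bounded by `b` in absolute value. -/
structure BddMeas {α : Type*} [MeasurableSpace α] (g : α → ℝ) (b : ℝ) : Prop where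
  meas : Measurable g
  bound : ∀ x, |g x| ≤ b

namespace BddMeas

variable {α β : Type*} [MeasurableSpace α] [MeasurableSpace β] {g f : α → ℝ} {b b' : ℝ}

theorem integrable (hg : BddMeas g b) (μ : Measure α) [IsFiniteMeasure μ] : Integrable g μ :=
  Integrable.of_bound hg.meas.aestronglyMeasurable b (Filter.Eventually.of_forall hg.bound)

theorem abs_integral_le (hg : BddMeas g b) (μ : Measure α) [IsProbabilityMeasure μ] :
    |∫ x, g x ∂μ| ≤ b := by
  have := norm_integral_le_of_norm_le_const (μ := μ) 
    (Filter.Eventually.of_forall fun x => (Real.norm_eq_abs (g x)).trans_le (hg.bound x))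
  rwa [probReal_univ, mul_one] at this

theorem kernel (hg : BddMeas g b) (κ : Kernel β α) [IsMarkovKernel κ] :
    BddMeas (fun y => ∫ x, g x ∂κ y) b :=
  ⟨(hg.meas.stronglyMeasurable.integral_kernel (κ := κ)).measurable,
    fun y => hg.abs_integral_le (κ y)⟩

theorem comp (hg : BddMeas g b) {h : β → α} (hh : Measurable h) :
    BddMeas (fun y => g (h y)) b := ⟨hg.meas.comp hh, fun _ => hg.bound _⟩

theorem add (hf : BddMeas f b') (hg : BddMeas g b) : BddMeas (fun x => f x + g x) (b' + b) :=
  ⟨hf.meas.add hg.meas, fun x => (abs_add_le _ _).trans (add_le_add (hf.bound x) (hg.bound x))⟩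

theorem sub (hf : BddMeas f b') (hg : BddMeas g b) : BddMeas (fun x => f x - g x) (b' + b) :=
  ⟨hf.meas.sub hg.meas, fun x => (abs_sub _ _).trans (add_le_add (hf.bound x) (hg.bound x))⟩

theorem mul (hf : BddMeas f b') (hg : BddMeas g b) : BddMeas (fun x => f x * g x) (b' * b) :=
  ⟨hf.meas.mul hg.meas, fun x => by
    rw [abs_mul]
    exact mul_le_mul (hf.bound x) (hg.bound x) (abs_nonneg _) ((abs_nonneg _).trans (hf.bound x))⟩

theorem const_mul (hg : BddMeas g b) (a : ℝ) : BddMeas (fun x => a * g x) (|a| * b) :=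
  ⟨hg.meas.const_mul a, fun x => by
    rw [abs_mul]; exact mul_le_mul_of_nonneg_left (hg.bound x) (abs_nonneg a)⟩

end BddMeas

/-- A discounted sum of uniformly bounded measurable functions is bounded and measurable. -/
theorem bddMeas_tsum {α : Type*} [MeasurableSpace α] {γ b : ℝ} (h0 : 0 ≤ γ) (h1 : γ < 1)
    {F : ℕ → α → ℝ} (hF : ∀ t, BddMeas (F t) b) :
    (∀ x, HasSum (fun t => γ ^ t * F t x) (∑' t, γ ^ t * F t x)) ∧
      BddMeas (fun x => ∑' t, γ ^ t * F t x) (b / (1 - γ)) := by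
  have hs : ∀ x, Summable fun t => γ ^ t * F t x := fun x => by
    refine Summable.of_norm_bounded ((summable_geometric_of_lt_one h0 h1).mul_right b) fun t => ?_
    rw [norm_mul, norm_pow, Real.norm_of_nonneg h0]
    exact mul_le_mul_of_nonneg_left ((hF t).bound x) (pow_nonneg h0 t)
  refine ⟨fun x => (hs x).hasSum, ?_, fun x => ?_⟩
  · refine measurable_of_tendsto_metrizable
      (f := fun n x => ∑ t ∈ Finset.range n, γ ^ t * F t x)
      (fun n => Finset.measurable_sum _ fun t _ => (hF t).meas.const_mul _) ?_
    rw [tendsto_pi_nhds]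
    exact fun x => (hs x).hasSum.tendsto_sum_nat
  · refine (tsum_of_norm_bounded (f := fun t => γ ^ t * F t x) (g := fun t => γ ^ t * b)
      ?_ fun t => ?_)
    · rw [div_eq_inv_mul]
      exact (hasSum_geometric_of_lt_one h0 h1).mul_right b
    · rw [norm_mul, norm_pow, Real.norm_of_nonneg h0]
      exact mul_le_mul_of_nonneg_left ((hF t).bound x) (pow_nonneg h0 t)

theorem integral_tsum_discounted {α : Type*} [MeasurableSpace α] {γ b : ℝ} (h0 : 0 ≤ γ)
    (h1 : γ < 1) {F : ℕ → α → ℝ} (hF : ∀ t, BddMeas (F t) b) (μ : Measure α)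
    [IsProbabilityMeasure μ] :
    ∫ x, ∑' t, γ ^ t * F t x ∂μ = ∑' t, γ ^ t * ∫ x, F t x ∂μ := by
  have h := hasSum_integral_of_summable_integral_norm (μ := μ) (F := fun t x => γ ^ t * F t x)
    (fun t => ((hF t).integrable μ).const_mul _) ?_
  · rw [← h.tsum_eq]
    simp only [integral_const_mul]
  · refine Summable.of_norm_bounded ((summable_geometric_of_lt_one h0 h1).mul_right b) fun t => ?_
    have h2 : ∀ x, ‖γ ^ t * F t x‖ ≤ γ ^ t * b := fun x => by
      rw [norm_mul, norm_pow, Real.norm_of_nonneg h0]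
      exact mul_le_mul_of_nonneg_left ((hF t).bound x) (pow_nonneg h0 t)
    have := norm_integral_le_of_norm_le_const (μ := μ) (f := fun x => ‖γ ^ t * F t x‖)
      (C := γ ^ t * b) (Filter.Eventually.of_forall fun x => by rw [norm_norm]; exact h2 x)
    rwa [probReal_univ, mul_one] at this

/-! ### Transition operators of the state-action chain -/

namespace Model

variable {S A : Type*} [MeasurableSpace S] [MeasurableSpace A] {K p m : ℕ} (M : Model S A K p m)

/-- The average over the actions of the policy. -/
noncomputable def polAvg (θ : Vec p) (g : S × A → ℝ) (s : S) : ℝ :=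
  ∫ a, g (s, a) ∂M.policy (θ, s)

/-- The transition operator of the state-action chain. -/
noncomputable def transOp (k : Fin K) (θ : Vec p) (g : S × A → ℝ) (z : S × A) : ℝ :=
  ∫ y, g y ∂M.next k (θ, z)

variable {M} {k : Fin K} {θ : Vec p} {g : S × A → ℝ} {b : ℝ}

theorem integral_lawFirst (hg : BddMeas g b) (κ : Kernel (Vec p × S) (S × A))
    (hκ : κ = Kernel.deterministic Prod.snd measurable_snd ×ₖ M.policy) (s : S) :
    ∫ y, g y ∂κ (θ, s) = M.polAvg θ g s := by
  rw [hκ, Kernel.prod_apply, Kernel.deterministic_apply, Measure.dirac_prod,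
    integral_map (by fun_prop) hg.meas.aestronglyMeasurable]
  rfl

theorem polAvg_bdd (hg : BddMeas g b) (θ : Vec p) : BddMeas (M.polAvg θ g) b := by
  have h := hg.kernel (Kernel.deterministic Prod.snd measurable_snd ×ₖ M.policy)
  have h2 := h.comp (measurable_const.prodMk measurable_id : Measurable fun s : S => (θ, s))
  have e : M.polAvg θ g = fun s => ∫ y, g y ∂(Kernel.deterministic Prod.snd measurable_snd ×ₖ
      M.policy) (θ, s) := by
    funext s; exact (integral_lawFirst hg _ rfl s).symm
  rw [e]; exact h2

theorem transOp_bdd (hg : BddMeas g b) (k : Fin K) (θ : Vec p) : BddMeas (M.transOp k θ g) b :=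
  (hg.kernel (M.next k)).comp
    (measurable_const.prodMk measurable_id : Measurable fun z : S × A => (θ, z))

theorem transOp_eq (hg : BddMeas g b) (k : Fin K) (θ : Vec p) (z : S × A) :
    M.transOp k θ g z = ∫ s, M.polAvg θ g s ∂M.P k z := by
  rw [transOp, next, ProbabilityTheory.integral_compProd]
  · rfl
  · exact hg.integrable ((Kernel.prodMkLeft (Vec p) (M.P k) ⊗ₖ
      M.policy.comap (fun x : (Vec p × (S × A)) × S => (x.1.1, x.2)) (by fun_prop)) (θ, z))

theorem transOp_iterate_bdd (hg : BddMeas g b) (k : Fin K) (θ : Vec p) (t : ℕ) :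
    BddMeas ((M.transOp k θ)^[t] g) b := by
  induction t with
  | zero => exact hg
  | succ t ih => rw [Function.iterate_succ_apply']; exact transOp_bdd ih k θ

/-- All laws of the chain are handled through their action on bounded functions, where composing
kernels becomes iterating `transOp`. -/
theorem integral_steps (hg : BddMeas g b) (k : Fin K) (θ : Vec p) (t : ℕ) (z : S × A) :
    ∫ y, g y ∂M.steps k t (θ, z) = (M.transOp k θ)^[t] g z := by
  induction t generalizing g with
  | zero =>
    rw [steps, Kernel.deterministic_apply, integral_dirac' _ _ hg.meas.stronglyMeasurable]
    rfl
  | succ t ih =>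
    rw [Function.iterate_succ_apply, ← ih (transOp_bdd hg k θ), steps,
      Kernel.integral_comp (hg.integrable _), Kernel.prod_apply, Kernel.deterministic_apply,
      Measure.dirac_prod, integral_map (by fun_prop)
        (hg.kernel (M.next k)).meas.aestronglyMeasurable]
    rfl

theorem integral_lawInit (hg : BddMeas g b) (k : Fin K) (θ : Vec p) (t : ℕ) :
    ∫ y, g y ∂M.lawInit k t θ = ∫ s, M.polAvg θ ((M.transOp k θ)^[t] g) s ∂M.ξ k := by
  have h1 := hg.kernel (M.steps k t)
  have h2 := transOp_iterate_bdd (M := M) hg k θ t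
  rw [lawInit, Kernel.integral_comp (hg.integrable _), Kernel.prod_apply, Kernel.id_apply,
    Measure.dirac_prod, integral_map (by fun_prop) h1.meas.aestronglyMeasurable]
  simp only [integral_steps hg]
  rw [ProbabilityTheory.integral_compProd (h2.integrable ((Kernel.const (Vec p) (M.ξ k) ⊗ₖ
    M.policy) θ))]
  rfl

theorem integral_lawInit_succ (hg : BddMeas g b) (k : Fin K) (θ : Vec p) (t : ℕ) :
    ∫ y, g y ∂M.lawInit k (t + 1) θ = ∫ y, M.transOp k θ g y ∂M.lawInit k t θ := by
  rw [integral_lawInit hg, integral_lawInit (transOp_bdd hg k θ), Function.iterate_succ_apply]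

theorem integral_lawFrom (hg : BddMeas g b) (k : Fin K) (θ : Vec p) (t : ℕ) (s : S) :
    ∫ y, g y ∂M.lawFrom k t (θ, s) = M.polAvg θ ((M.transOp k θ)^[t] g) s := by
  have h1 := hg.kernel (M.steps k t)
  have h2 := transOp_iterate_bdd (M := M) hg k θ t
  have : IsMarkovKernel (M.lawFrom k t) := by unfold lawFrom; infer_instance
  rw [lawFrom, Kernel.integral_comp (by
      have := hg.integrable (M.lawFrom k t (θ, s)); rwa [lawFrom] at this),
    Kernel.prod_apply, Kernel.deterministic_apply,
    Measure.dirac_prod, integral_map (by fun_prop) h1.meas.aestronglyMeasurable]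
  simp only [integral_steps hg]
  exact integral_lawFirst h2 _ rfl s

theorem integral_visit (hg : BddMeas g b) (k : Fin K) (θ : Vec p) :
    HasSum (fun t => (1 - M.γ) * (M.γ ^ t * ∫ y, g y ∂M.lawInit k t θ))
      (∫ y, g y ∂M.visit k θ) := by
  have h := hasSum_integral_measure (f := g) (hg.integrable (M.visit k θ))
  have e : (fun t => (1 - M.γ) * (M.γ ^ t * ∫ y, g y ∂M.lawInit k t θ)) = fun t =>
      ∫ y, g y ∂(ENNReal.ofReal ((1 - M.γ) * M.γ ^ t) • M.lawInit k t θ) := by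
    funext t
    rw [integral_smul_measure, ENNReal.toReal_ofReal (mul_nonneg (by linarith [M.γ_lt_one])
      (pow_nonneg M.γ_nonneg t)), smul_eq_mul, mul_assoc]
  rw [e]
  exact h

end Model

/-! ### Functions with a quadratic first-order expansion -/

section Quadratic

variable {V : Type*} [NormedAddCommGroup V] [InnerProductSpace ℝ V] [CompleteSpace V]
  {F : V → ℝ} {G : V → V} {c L : ℝ}

theorem hasGradientAt_of_quadratic (h : ∀ x y, |F y - F x - ⟪G x, y - x⟫| ≤ c * ‖y - x‖ ^ 2)
    (x : V) : HasGradientAt F (G x) x := by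
  rw [hasGradientAt_iff_isLittleO]
  refine Asymptotics.IsBigO.trans_isLittleO (g := fun y => ‖y - x‖ ^ 2) ?_ ?_
  · exact Asymptotics.IsBigO.of_bound c (Filter.Eventually.of_forall fun y => by
      rw [Real.norm_eq_abs, norm_pow, norm_norm]; exact h x y)
  · exact Asymptotics.IsLittleO.of_norm_right
      (Asymptotics.isLittleO_norm_pow_id one_lt_two |>.comp_tendsto
        (tendsto_sub_nhds_zero_iff.2 Filter.tendsto_id) |>.norm_right)

/-- Expand F at x and at y towards one third point x + w, with w of length ‖x - y‖ along G x - G y,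
and expand at y towards x. The values of F cancel, leaving ⟨G x - G y, w⟩ bounded by (1 + 4 + 1) c
‖x - y‖². Neither differentiability nor continuity of G enters. -/
theorem lipschitz_of_quadratic (h : ∀ x y, |F y - F x - ⟪G x, y - x⟫| ≤ c * ‖y - x‖ ^ 2)
    (x y : V) : ‖G x - G y‖ ≤ 6 * c * ‖x - y‖ := by
  set v := G x - G y with hv
  set d := ‖x - y‖ with hd
  rcases eq_or_ne v 0 with h0 | h0
  · rw [h0, norm_zero]
    rcases (norm_nonneg (x - y)).eq_or_lt with h1 | h1
    · rw [hd, ← h1]; simp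
    · have := (abs_nonneg _).trans (h y x)
      have h2 : 0 ≤ c := by
        by_contra hc
        have : c * ‖x - y‖ ^ 2 < 0 := mul_neg_of_neg_of_pos (not_le.1 hc) (by positivity)
        linarith
      positivity
  have hv0 : 0 < ‖v‖ := norm_pos_iff.2 h0
  rcases (norm_nonneg (x - y)).eq_or_lt with h1 | h1
  · have : x = y := sub_eq_zero.1 (norm_eq_zero.1 h1.symm)
    exact absurd (by rw [hv, this, sub_self]) h0
  set w := (d / ‖v‖) • v with hw
  have hwn : ‖w‖ = d := by
    rw [hw, norm_smul, norm_div, norm_norm, Real.norm_of_nonneg (norm_nonneg _),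
      div_mul_cancel₀ _ hv0.ne']
  have hvw : ⟪v, w⟫ = ‖v‖ * d := by
    rw [hw, inner_smul_right, real_inner_self_eq_norm_sq]; field_simp
  have hc : 0 ≤ c := by
    by_contra hc
    have : c * ‖x - y‖ ^ 2 < 0 := mul_neg_of_neg_of_pos (not_le.1 hc) (by positivity)
    linarith [(abs_nonneg _).trans (h y x)]
  have a1 := abs_le.1 (h x (x + w))
  have a2 := abs_le.1 (h y (x + w))
  have a3 := abs_le.1 (h y x)
  have e1 : x + w - x = w := by abel
  have e2 : x + w - y = (x - y) + w := by abel
  rw [e1, hwn] at a1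
  rw [e2, inner_add_right] at a2
  have n2 : ‖x - y + w‖ ≤ 2 * d := (norm_add_le _ _).trans (by rw [hwn]; linarith)
  have n3 : c * ‖x - y + w‖ ^ 2 ≤ c * (2 * d) ^ 2 := by gcongr
  have key : ‖v‖ * d ≤ 6 * c * d * d := by
    rw [← hvw, hv, inner_sub_left]; nlinarith
  exact le_of_mul_le_mul_right key h1

/-- Along the segment, F minus its linearization plus the quadratic correction has nonnegative
derivative, so its value at 1 is at least that at 0. -/
theorem descent_of_lipschitz_gradient (hF : ∀ x, HasGradientAt F (G x) x)
    (hL : ∀ x y, ‖G x - G y‖ ≤ L * ‖x - y‖) (x y : V) :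
    F x + ⟪G x, y - x⟫ - L / 2 * ‖y - x‖ ^ 2 ≤ F y := by
  set d := y - x with hd
  have hder : ∀ t : ℝ, HasDerivAt (fun t : ℝ => F (x + t • d) - t * ⟪G x, d⟫
      + L / 2 * ‖d‖ ^ 2 * t ^ 2) (⟪G (x + t • d), d⟫ - ⟪G x, d⟫ + L * ‖d‖ ^ 2 * t) t := by
    intro t
    have h1 : HasDerivAt (fun t : ℝ => x + t • d) d t := by
      simpa using ((hasDerivAt_id t).smul_const d).const_add x
    have h2 := (hF (x + t • d)).hasFDerivAt.comp_hasDerivAt t h1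
    have h3 := (hasDerivAt_id t).mul_const ⟪G x, d⟫
    have h4 := (hasDerivAt_pow 2 t).const_mul (L / 2 * ‖d‖ ^ 2)
    refine ((h2.sub h3).add h4).congr_deriv ?_
    simp only [InnerProductSpace.toDual_apply_apply]
    norm_num; ring
  have hmono : MonotoneOn (fun t : ℝ => F (x + t • d) - t * ⟪G x, d⟫
      + L / 2 * ‖d‖ ^ 2 * t ^ 2) (Set.Icc 0 1) := by
    refine monotoneOn_of_deriv_nonneg (convex_Icc 0 1)
      (fun t _ => (hder t).continuousAt.continuousWithinAt)
      (fun t _ => (hder t).differentiableAt.differentiableWithinAt) fun t ht => ?_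
    rw [(hder t).deriv]
    rw [interior_Icc] at ht
    have h1 := abs_le.1 (abs_real_inner_le_norm (G (x + t • d) - G x) d)
    have h2 := hL (x + t • d) x
    rw [add_sub_cancel_left, norm_smul, Real.norm_of_nonneg ht.1.le] at h2
    rw [inner_sub_left] at h1
    have h3 := mul_le_mul_of_nonneg_right h2 (norm_nonneg d)
    nlinarith
  have h := hmono (Set.left_mem_Icc.2 zero_le_one) (Set.right_mem_Icc.2 zero_le_one) zero_le_one
  simp only [zero_smul, add_zero, zero_mul, sub_zero, one_smul, one_mul, one_pow, mul_one] at h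
  rw [hd, add_sub_cancel, ← hd] at h
  norm_num at h
  linarith

end Quadratic

/-! ### Value functions and the Bellman equation -/

namespace Model

variable {S A : Type*} [MeasurableSpace S] [MeasurableSpace A] {K p m : ℕ} {M : Model S A K p m}

theorem bddMeas_reward (M : Model S A K p m) (k : Fin K) : BddMeas (M.r k) 1 :=
  ⟨M.r_meas k, fun z => by rw [abs_of_nonneg (M.r_mem k z).1]; exact (M.r_mem k z).2⟩

theorem Q_eq (k : Fin K) (θ : Vec p) :
    M.Q k θ = fun z => ∑' t : ℕ, M.γ ^ t * (M.transOp k θ)^[t] (M.r k) z := by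
  funext z
  simp only [Q, integral_steps (bddMeas_reward M k)]

theorem Q_bdd (M : Model S A K p m) (k : Fin K) (θ : Vec p) : BddMeas (M.Q k θ) (1 / (1 - M.γ)) := by
  rw [Q_eq]
  exact (bddMeas_tsum M.γ_nonneg M.γ_lt_one
    fun t => transOp_iterate_bdd (M := M) (bddMeas_reward M k) k θ t).2

theorem Q_bellman (k : Fin K) (θ : Vec p) (z : S × A) :
    M.Q k θ z = M.r k z + M.γ * M.transOp k θ (M.Q k θ) z := by
  have hb := fun t => transOp_iterate_bdd (M := M) (bddMeas_reward M k) k θ t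
  have hs := (bddMeas_tsum M.γ_nonneg M.γ_lt_one hb).1 z
  have h1 : M.transOp k θ (M.Q k θ) z =
      ∑' t : ℕ, M.γ ^ t * (M.transOp k θ)^[t + 1] (M.r k) z := by
    rw [transOp, Q_eq, integral_tsum_discounted M.γ_nonneg M.γ_lt_one hb]
    simp only [Function.iterate_succ_apply']
    rfl
  rw [h1, Q_eq]
  change ∑' t : ℕ, M.γ ^ t * (M.transOp k θ)^[t] (M.r k) z = _
  rw [hs.summable.tsum_eq_zero_add, ← tsum_mul_left]
  simp [pow_succ, mul_assoc, mul_comm]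

theorem J_eq (k : Fin K) (θ : Vec p) :
    M.J k θ = ∫ s, M.polAvg θ (M.Q k θ) s ∂M.ξ k := by
  have hb := fun t => transOp_iterate_bdd (M := M) (bddMeas_reward M k) k θ t
  have h0 := integral_lawInit (M := M) (Q_bdd M k θ) k θ 0
  rw [Function.iterate_zero_apply] at h0
  rw [← h0, Q_eq, integral_tsum_discounted M.γ_nonneg M.γ_lt_one hb, J]
  refine tsum_congr fun t => ?_
  rw [integral_lawInit (bddMeas_reward M k), integral_lawInit (hb t)]
  rfl

theorem J_mem (k : Fin K) (θ : Vec p) : M.J k θ ∈ Set.Icc 0 (1 / (1 - M.γ)) := by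
  refine ⟨tsum_nonneg fun t => mul_nonneg (pow_nonneg M.γ_nonneg t)
    (integral_nonneg fun z => (M.r_mem k z).1), ?_⟩
  rw [J_eq]
  exact (le_abs_self _).trans ((polAvg_bdd (Q_bdd M k θ) θ).abs_integral_le _)

/-! ### Change of policy -/

variable (M) in
/-- The likelihood ratio of two policies. -/
noncomputable def ratio (θ θ' : Vec p) (z : S × A) : ℝ :=
  M.dens θ' z.1 z.2 / M.dens θ z.1 z.2

theorem measurable_dens (θ : Vec p) : Measurable fun z : S × A => M.dens θ z.1 z.2 :=
  M.dens_meas.comp (by fun_prop : Measurable fun z : S × A => ((θ, z.1), z.2))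

theorem polAvg_eq (θ : Vec p) (g : S × A → ℝ) (s : S) :
    M.polAvg θ g s = ∫ a, M.dens θ s a * g (s, a) ∂M.ν := by
  have hm : Measurable fun a => M.dens θ s a :=
    M.dens_meas.comp (by fun_prop : Measurable fun a : A => ((θ, s), a))
  rw [polAvg, policy_apply, integral_withDensity_eq_integral_toReal_smul hm.ennreal_ofReal
    (Filter.Eventually.of_forall fun _ => ENNReal.ofReal_lt_top)]
  simp only [ENNReal.toReal_ofReal (M.dens_pos _ _ _).le, smul_eq_mul]

/-- As the densities are positive everywhere, averages under a new policy are weighted averages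
under the old one. This lets two policies be compared entirely along the chain of θ. -/
theorem polAvg_change {θ θ' : Vec p} {g : S × A → ℝ} (s : S) :
    M.polAvg θ' g s = M.polAvg θ (fun z => M.ratio θ θ' z * g z) s := by
  rw [polAvg_eq, polAvg_eq]
  refine integral_congr_ae (Filter.Eventually.of_forall fun a => ?_)
  have := (M.dens_pos θ s a).ne'
  simp only [ratio]
  field_simp

theorem ratio_sub_one_bdd {θ θ' : Vec p} {ε : ℝ} (h : ∀ z, |M.ratio θ θ' z - 1| ≤ ε) :
    BddMeas (fun z => M.ratio θ θ' z - 1) ε :=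
  ⟨((measurable_dens θ').div (measurable_dens θ)).sub_const 1, h⟩

theorem polAvg_add {θ : Vec p} {f g : S × A → ℝ} {b b' : ℝ} (hf : BddMeas f b)
    (hg : BddMeas g b') (s : S) :
    M.polAvg θ (fun z => f z + g z) s = M.polAvg θ f s + M.polAvg θ g s := by
  have hm : Measurable fun a : A => (s, a) := by fun_prop
  exact integral_add ((hf.comp hm).integrable _) ((hg.comp hm).integrable _)

/-- Performance difference: the change of the action values and of the objective. -/
theorem performance_difference {k : Fin K} {θ θ' : Vec p} {ε : ℝ}
    (h : ∀ z, |M.ratio θ θ' z - 1| ≤ ε) :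
    (∀ z, |M.Q k θ' z - M.Q k θ z| ≤ (1 / (1 - M.γ)) ^ 2 * ε) ∧
      (1 - M.γ) * (M.J k θ' - M.J k θ) =
        ∫ z, M.Q k θ' z * (M.ratio θ θ' z - 1) ∂M.visit k θ := by
  have hγ0 := M.γ_nonneg
  have hγ1 := M.γ_lt_one
  set u := 1 / (1 - M.γ) with hu
  have hu0 : 0 < u := by rw [hu]; exact one_div_pos.2 (by linarith)
  have huγ : u * (1 - M.γ) = 1 := by rw [hu]; exact one_div_mul_cancel (by linarith)
  have hQ := Q_bdd M k θ
  have hQ' := Q_bdd M k θ'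
  rw [← hu] at hQ hQ'
  set g : S × A → ℝ := fun z => M.Q k θ' z * (M.ratio θ θ' z - 1) with hg
  have hgb : BddMeas g (u * ε) := hQ'.mul (ratio_sub_one_bdd h)
  set E : S × A → ℝ := fun z => M.Q k θ' z - M.Q k θ z with hE
  have hEb : BddMeas E (u + u) := hQ'.sub hQ
  have havg : ∀ s, M.polAvg θ' (M.Q k θ') s =
      M.polAvg θ (M.Q k θ) s + M.polAvg θ (fun z => E z + g z) s := fun s => by
    rw [polAvg_change, ← polAvg_add hQ (hEb.add hgb)]
    congr 1
    funext z
    simp only [hE, hg]; ring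
  -- Subtracting the two Bellman equations removes the reward. The change of values thus solves a
  -- discounted equation for the chain of θ, with source g.
  have hEeq : ∀ z, E z = M.γ * M.transOp k θ (fun z => E z + g z) z := fun z => by
    have h1 : M.transOp k θ' (M.Q k θ') z =
        M.transOp k θ (M.Q k θ) z + M.transOp k θ (fun z => E z + g z) z := by
      rw [transOp_eq hQ', transOp_eq hQ, transOp_eq (hEb.add hgb), ← integral_add
        ((polAvg_bdd hQ θ).integrable _) ((polAvg_bdd (hEb.add hgb) θ).integrable _)]
      simp only [havg]
    simp only [hE]
    rw [Q_bellman k θ' z, Q_bellman k θ z, h1]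
    simp only [hE]; ring
  constructor
  · intro z
    have : Nonempty (S × A) := ⟨z⟩
    have hbdd : BddAbove (Set.range fun z => |E z|) := ⟨u + u, by
      rintro _ ⟨y, rfl⟩; exact hEb.bound y⟩
    set c := ⨆ z, |E z| with hc
    have hEc : BddMeas E c := ⟨hEb.meas, fun y => le_ciSup hbdd y⟩
    -- The averaging operator is a contraction in sup norm, so the equation for E bounds its own
    -- supremum.
    have h1 : c ≤ M.γ * (c + u * ε) := ciSup_le fun y => by
      rw [hEeq y, abs_mul, abs_of_nonneg hγ0]
      exact mul_le_mul_of_nonneg_left ((transOp_bdd (hEc.add hgb) k θ).bound y) hγ0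
    have h2 : 0 ≤ u * ε := (abs_nonneg _).trans (hgb.bound z)
    have h3 : (1 - M.γ) * c ≤ u * ε := by nlinarith
    calc |E z| ≤ c := hEc.bound z
      _ = u * ((1 - M.γ) * c) := by rw [← mul_assoc, huγ, one_mul]
      _ ≤ u * (u * ε) := mul_le_mul_of_nonneg_left h3 hu0.le
      _ = u ^ 2 * ε := by ring
  · set a : ℕ → ℝ := fun t => ∫ z, (E z + g z) ∂M.lawInit k t θ with ha
    -- The equation for E turns its mean at time t into γ times the mean of E + g at time t + 1. The
    -- discounted sum of the means of g therefore telescopes to a 0, the change of the objective.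
    have hI : ∀ t, ∫ z, g z ∂M.lawInit k t θ = a t - M.γ * a (t + 1) := fun t => by
      simp only [ha]
      rw [integral_lawInit_succ (hEb.add hgb), integral_add (hEb.integrable _) (hgb.integrable _),
        ← integral_const_mul]
      simp only [← hEeq]
      ring
    have h0 : M.J k θ' - M.J k θ = a 0 := by
      rw [J_eq, J_eq, ← integral_sub ((polAvg_bdd hQ' θ').integrable _)
        ((polAvg_bdd hQ θ).integrable _)]
      simp only [ha]
      rw [integral_lawInit (hEb.add hgb)]
      simp only [havg, Function.iterate_zero_apply, add_sub_cancel_left]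
    have hab : ∀ t, |a t| ≤ u + u + u * ε := fun t => (hEb.add hgb).abs_integral_le _
    have hs := integral_visit (M := M) hgb k θ
    refine tendsto_nhds_unique ?_ hs.tendsto_sum_nat
    have hsum : ∀ n, ∑ t ∈ Finset.range n, (1 - M.γ) * (M.γ ^ t * ∫ z, g z ∂M.lawInit k t θ) =
        (1 - M.γ) * (a 0 - M.γ ^ n * a n) := fun n => by
      induction n with
      | zero => simp
      | succ n ih => rw [Finset.sum_range_succ, ih, hI]; ring
    simp only [hsum]
    rw [h0]
    have hz : Filter.Tendsto (fun n => M.γ ^ n * a n) Filter.atTop (nhds 0) := by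
      refine squeeze_zero_norm (a := fun n => M.γ ^ n * (u + u + u * ε)) (fun n => ?_) ?_
      · rw [norm_mul, norm_pow, Real.norm_of_nonneg hγ0]
        exact mul_le_mul_of_nonneg_left (hab n) (pow_nonneg hγ0 n)
      · simpa using (tendsto_pow_atTop_nhds_zero_of_lt_one hγ0 hγ1).mul_const (u + u + u * ε)
    simpa using (tendsto_const_nhds.sub hz).const_mul (1 - M.γ)

end Model

/-! ### Policy gradient formula and smoothness of the objectives -/

namespace Model

variable {S A : Type*} [MeasurableSpace S] [MeasurableSpace A] {K p m : ℕ} {M : Model S A K p m}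
  {Cφ Cπ Lφ : ℝ}

theorem measurable_score_right (θ : Vec p) : Measurable fun z : S × A => M.score θ z :=
  M.measurable_score.comp (measurable_const.prodMk measurable_id)

variable (M) in
/-- The policy gradient direction `𝔼[Q(s, a) ψ_θ(s, a)]`, equal to `(1 - γ) ∇J`. -/
noncomputable def polGrad (k : Fin K) (θ : Vec p) : Vec p :=
  ∫ z, M.Q k θ z • M.score θ z ∂M.visit k θ

/-- The mean value inequality is applied to the log-density. On the ball about θ of radius ‖θ' - θ‖
its gradient, the score, varies by at most Lφ‖θ' - θ‖, and it is bounded by Cφ throughout. -/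
theorem log_dens_expansion (h : M.Smooth Cφ Cπ Lφ) (hL : 0 ≤ Lφ) (θ θ' : Vec p) (z : S × A) :
    |Real.log (M.dens θ' z.1 z.2) - Real.log (M.dens θ z.1 z.2) - ⟪M.score θ z, θ' - θ⟫|
        ≤ Lφ * ‖θ' - θ‖ ^ 2 ∧
      |Real.log (M.dens θ' z.1 z.2) - Real.log (M.dens θ z.1 z.2)| ≤ Cφ * ‖θ' - θ‖ := by
  have hd : ∀ η, HasFDerivAt (fun η => Real.log (M.dens η z.1 z.2))
      (InnerProductSpace.toDual ℝ (Vec p) (M.score η z)) η := fun η =>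
    ((M.dens_diff z.1 z.2 η).log (M.dens_pos _ _ _).ne').hasGradientAt.hasFDerivAt
  constructor
  · have h1 := (convex_closedBall θ ‖θ' - θ‖).norm_image_sub_le_of_norm_hasFDerivWithin_le'
      (f := fun η => Real.log (M.dens η z.1 z.2))
      (φ := InnerProductSpace.toDual ℝ (Vec p) (M.score θ z)) (C := Lφ * ‖θ' - θ‖)
      (x := θ) (y := θ') (fun η _ => (hd η).hasFDerivWithinAt)
      (fun η hη => by
        rw [← map_sub, LinearIsometryEquiv.norm_map]
        refine (h.score_lip η θ z).trans (mul_le_mul_of_nonneg_left ?_ hL)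
        rwa [← dist_eq_norm])
      (Metric.mem_closedBall_self (norm_nonneg _)) (by rw [Metric.mem_closedBall, dist_eq_norm])
    rw [InnerProductSpace.toDual_apply_apply, Real.norm_eq_abs] at h1
    calc _ ≤ _ := h1
      _ = _ := by ring
  · have h1 := convex_univ.norm_image_sub_le_of_norm_hasFDerivWithin_le
      (f := fun η => Real.log (M.dens η z.1 z.2)) (C := Cφ)
      (x := θ) (y := θ') (fun η _ => (hd η).hasFDerivWithinAt)
      (fun η _ => by rw [LinearIsometryEquiv.norm_map]; exact h.score_le η z)
      (Set.mem_univ _) (Set.mem_univ _)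
    rwa [Real.norm_eq_abs] at h1

/-- The ratio is the exponential of the log-density increment x. The restriction on ‖θ' - θ‖ gives
|x| ≤ 1, where |e^x - 1 - x| ≤ x². -/
theorem ratio_expansion (h : M.Smooth Cφ Cπ Lφ) (hL : 0 ≤ Lφ) (θ θ' : Vec p)
    (hs : Cφ * ‖θ' - θ‖ ≤ 1) (z : S × A) :
    |M.ratio θ θ' z - 1 - ⟪M.score θ z, θ' - θ⟫| ≤ (Cφ ^ 2 + Lφ) * ‖θ' - θ‖ ^ 2 ∧
      |M.ratio θ θ' z - 1| ≤ 2 * (Cφ * ‖θ' - θ‖) := by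
  obtain ⟨h1, h2⟩ := log_dens_expansion h hL θ θ' z
  set x := Real.log (M.dens θ' z.1 z.2) - Real.log (M.dens θ z.1 z.2) with hx
  have hr : M.ratio θ θ' z = Real.exp x := by
    rw [hx, Real.exp_sub, Real.exp_log (M.dens_pos _ _ _), Real.exp_log (M.dens_pos _ _ _), ratio]
  have hx1 : |x| ≤ 1 := h2.trans hs
  rw [hr]
  constructor
  · have h3 := Real.abs_exp_sub_one_sub_id_le hx1
    have h4 : x ^ 2 ≤ (Cφ * ‖θ' - θ‖) ^ 2 := sq_le_sq' (by linarith [(abs_le.1 h2).1])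
      (abs_le.1 h2).2
    have h5 : Real.exp x - 1 - ⟪M.score θ z, θ' - θ⟫ =
        (Real.exp x - 1 - x) + (x - ⟪M.score θ z, θ' - θ⟫) := by ring
    rw [h5]
    refine (abs_add_le _ _).trans ?_
    nlinarith
  · have h3 := Real.abs_exp_sub_one_le hx1
    linarith

theorem integrable_smul_score (h : M.Smooth Cφ Cπ Lφ) {g : S × A → ℝ} {b : ℝ} (hg : BddMeas g b)
    (θ : Vec p) (μ : Measure (S × A)) [IsProbabilityMeasure μ] :
    Integrable (fun z => g z • M.score θ z) μ := by
  refine Integrable.of_bound (hg.meas.smul (measurable_score_right θ)).aestronglyMeasurable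
    (b * Cφ) (Filter.Eventually.of_forall fun z => ?_)
  rw [norm_smul, Real.norm_eq_abs]
  exact mul_le_mul (hg.bound z) (h.score_le θ z) (norm_nonneg _)
    ((abs_nonneg _).trans (hg.bound z))

theorem norm_integral_smul_score_le (h : M.Smooth Cφ Cπ Lφ) {g : S × A → ℝ} {b : ℝ}
    (hg : BddMeas g b) (θ : Vec p) (μ : Measure (S × A)) [IsProbabilityMeasure μ] :
    ‖∫ z, g z • M.score θ z ∂μ‖ ≤ b * Cφ := by
  have := norm_integral_le_of_norm_le_const (μ := μ) (f := fun z => g z • M.score θ z)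
    (C := b * Cφ) (Filter.Eventually.of_forall fun z => by
      rw [norm_smul, Real.norm_eq_abs]
      exact mul_le_mul (hg.bound z) (h.score_le θ z) (norm_nonneg _)
        ((abs_nonneg _).trans (hg.bound z)))
  rwa [probReal_univ, mul_one] at this

theorem inner_integral_smul_score (h : M.Smooth Cφ Cπ Lφ) {g : S × A → ℝ} {b : ℝ}
    (hg : BddMeas g b) (θ : Vec p) (μ : Measure (S × A)) [IsProbabilityMeasure μ] (x : Vec p) :
    ⟪∫ z, g z • M.score θ z ∂μ, x⟫ = ∫ z, g z * ⟪M.score θ z, x⟫ ∂μ := by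
  rw [real_inner_comm, ← integral_inner (integrable_smul_score h hg θ μ)]
  refine integral_congr_ae (Filter.Eventually.of_forall fun z => ?_)
  simp only [inner_smul_right]
  rw [real_inner_comm]

/-- In the performance difference, both the replacement of the ratio minus 1 by its linear part and
that of the new action values by the old ones cost O(‖θ' - θ‖²). The gradient formula, its Lipschitz
bound and the ascent inequality all follow from this one estimate. -/
theorem J_quadratic (h : M.Smooth Cφ Cπ Lφ) (hC : 0 ≤ Cφ) (hL : 0 ≤ Lφ) (k : Fin K)
    (θ θ' : Vec p) :
    |M.J k θ' - M.J k θ - ⟪(1 / (1 - M.γ)) • M.polGrad k θ, θ' - θ⟫| ≤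
      (1 / (1 - M.γ)) ^ 3 * (3 * Cφ ^ 2 + Lφ) * ‖θ' - θ‖ ^ 2 := by
  have hγ0 := M.γ_nonneg
  have hγ1 := M.γ_lt_one
  set u := 1 / (1 - M.γ) with hu
  have hu1 : 1 ≤ u := by rw [hu, le_div_iff₀ (by linarith)]; linarith
  have huγ : u * (1 - M.γ) = 1 := by rw [hu]; exact one_div_mul_cancel (by linarith)
  set d := ‖θ' - θ‖ with hd
  have hd0 : 0 ≤ d := norm_nonneg _
  have hQ := Q_bdd M k θ
  have hQ' := Q_bdd M k θ'
  rw [← hu] at hQ hQ'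
  have hψ : BddMeas (fun z : S × A => ⟪M.score θ z, θ' - θ⟫) (Cφ * d) :=
    ⟨(measurable_score_right θ).inner_const, fun z => (abs_real_inner_le_norm _ _).trans
      (mul_le_mul_of_nonneg_right (h.score_le θ z) hd0)⟩
  have hin : ⟪M.polGrad k θ, θ' - θ⟫ = ∫ z, M.Q k θ z * ⟪M.score θ z, θ' - θ⟫ ∂M.visit k θ :=
    inner_integral_smul_score h hQ θ _ _
  have main : |(1 - M.γ) * (M.J k θ' - M.J k θ) - ⟪M.polGrad k θ, θ' - θ⟫| ≤
      u ^ 2 * (3 * Cφ ^ 2 + Lφ) * d ^ 2 := by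
    -- For distant parameters the ratio is uncontrolled, but then (Cφ d)² > 1 and trivial bounds on
    -- J and its gradient already lie below the quadratic term.
    rcases le_or_gt (Cφ * d) 1 with hs | hs
    · have hr := fun z => (ratio_expansion h hL θ θ' hs z)
      obtain ⟨hE, hJ⟩ := performance_difference (k := k) fun z => (hr z).2
      have hρ := ratio_sub_one_bdd fun z => (hr z).2
      rw [hJ, hin, ← integral_sub ((hQ'.mul hρ).integrable _) ((hQ.mul hψ).integrable _)]
      refine BddMeas.abs_integral_le ⟨((hQ'.mul hρ).sub (hQ.mul hψ)).meas, fun z => ?_⟩ _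
      have e : M.Q k θ' z * (M.ratio θ θ' z - 1) - M.Q k θ z * ⟪M.score θ z, θ' - θ⟫ =
          M.Q k θ' z * (M.ratio θ θ' z - 1 - ⟪M.score θ z, θ' - θ⟫) +
            (M.Q k θ' z - M.Q k θ z) * ⟪M.score θ z, θ' - θ⟫ := by ring
      rw [e]
      refine (abs_add_le _ _).trans ?_
      rw [abs_mul, abs_mul]
      have i1 : |M.Q k θ' z| * |M.ratio θ θ' z - 1 - ⟪M.score θ z, θ' - θ⟫| ≤
          u * ((Cφ ^ 2 + Lφ) * d ^ 2) :=
        mul_le_mul (hQ'.bound z) (hr z).1 (abs_nonneg _) (by linarith)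
      have i2 : |M.Q k θ' z - M.Q k θ z| * |⟪M.score θ z, θ' - θ⟫| ≤
          (u ^ 2 * (2 * (Cφ * d))) * (Cφ * d) :=
        mul_le_mul (hE z) (hψ.bound z) (abs_nonneg _) (by positivity)
      have i3 : u * ((Cφ ^ 2 + Lφ) * d ^ 2) ≤ u ^ 2 * ((Cφ ^ 2 + Lφ) * d ^ 2) :=
        mul_le_mul_of_nonneg_right (by nlinarith) (by positivity)
      nlinarith
    · have h1 : |(1 - M.γ) * (M.J k θ' - M.J k θ)| ≤ 1 := by
        have a1 := J_mem (M := M) k θ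
        have a2 := J_mem (M := M) k θ'
        rw [← hu] at a1 a2
        have a3 : |M.J k θ' - M.J k θ| ≤ u := abs_sub_le_iff.2
          ⟨by linarith [a1.1, a2.2], by linarith [a2.1, a1.2]⟩
        rw [abs_mul, abs_of_nonneg (by linarith : 0 ≤ 1 - M.γ)]
        nlinarith
      have h2 : |⟪M.polGrad k θ, θ' - θ⟫| ≤ u * (Cφ * d) := by
        rw [hin]; exact (hQ.mul hψ).abs_integral_le _
      refine (abs_sub _ _).trans ?_
      have h3 : Cφ * d ≤ (Cφ * d) ^ 2 := by nlinarith
      have h4 : u * (Cφ * d) ≤ u ^ 2 * (Cφ * d) ^ 2 :=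
        mul_le_mul (by nlinarith) h3 (by positivity) (by positivity)
      have h5 : 1 ≤ u ^ 2 * (Cφ * d) ^ 2 := by nlinarith
      have h6 : 0 ≤ u ^ 2 * Lφ * d ^ 2 := by positivity
      nlinarith
  have e : M.J k θ' - M.J k θ - ⟪u • M.polGrad k θ, θ' - θ⟫ =
      u * ((1 - M.γ) * (M.J k θ' - M.J k θ) - ⟪M.polGrad k θ, θ' - θ⟫) := by
    rw [inner_smul_left, mul_sub, ← mul_assoc, huγ, one_mul]; simp
  rw [e, abs_mul, abs_of_nonneg (by linarith : 0 ≤ u)]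
  calc u * _ ≤ u * (u ^ 2 * (3 * Cφ ^ 2 + Lφ) * d ^ 2) :=
        mul_le_mul_of_nonneg_left main (by linarith)
    _ = _ := by ring

theorem hasGradientAt_J (h : M.Smooth Cφ Cπ Lφ) (hC : 0 ≤ Cφ) (hL : 0 ≤ Lφ) (k : Fin K)
    (θ : Vec p) : HasGradientAt (M.J k) ((1 / (1 - M.γ)) • M.polGrad k θ) θ :=
  hasGradientAt_of_quadratic (G := fun θ => (1 / (1 - M.γ)) • M.polGrad k θ)
    (fun x y => J_quadratic h hC hL k x y) θ

theorem gradient_J (h : M.Smooth Cφ Cπ Lφ) (hC : 0 ≤ Cφ) (hL : 0 ≤ Lφ) (k : Fin K)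
    (θ : Vec p) : gradient (M.J k) θ = (1 / (1 - M.γ)) • M.polGrad k θ :=
  (hasGradientAt_J h hC hL k θ).gradient

/-- `L_J` is a Lipschitz constant of the gradients of the objectives, and it is bounded by the
constants of the assumptions. -/
theorem LJ_spec (h : M.Smooth Cφ Cπ Lφ) (hC : 0 ≤ Cφ) (hL : 0 ≤ Lφ) :
    0 ≤ M.LJ ∧ M.LJ ≤ 6 * ((1 / (1 - M.γ)) ^ 3 * (3 * Cφ ^ 2 + Lφ)) ∧
      ∀ k θ θ', ‖gradient (M.J k) θ - gradient (M.J k) θ'‖ ≤ M.LJ * ‖θ - θ'‖ := by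
  set s := {L : ℝ | 0 ≤ L ∧ ∀ k θ θ',
    ‖gradient (M.J k) θ - gradient (M.J k) θ'‖ ≤ L * ‖θ - θ'‖} with hs
  have hγ1 := M.γ_lt_one
  have hmem : 6 * ((1 / (1 - M.γ)) ^ 3 * (3 * Cφ ^ 2 + Lφ)) ∈ s := by
    refine ⟨?_, fun k θ θ' => ?_⟩
    · have : 0 < 1 - M.γ := by linarith
      positivity
    · rw [gradient_J h hC hL, gradient_J h hC hL]
      exact lipschitz_of_quadratic (G := fun θ => (1 / (1 - M.γ)) • M.polGrad k θ)
        (fun x y => J_quadratic h hC hL k x y) θ θ'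
  have hbdd : BddBelow s := ⟨0, fun L hL => hL.1⟩
  refine ⟨le_csInf ⟨_, hmem⟩ fun L hL => hL.1, csInf_le hbdd hmem, fun k θ θ' => ?_⟩
  rcases (norm_nonneg (θ - θ')).eq_or_lt with h0 | h0
  · have : θ = θ' := sub_eq_zero.1 (norm_eq_zero.1 h0.symm)
    simp [this]
  · rw [← div_le_iff₀ h0]
    exact le_csInf ⟨_, hmem⟩ fun L hL => by rw [div_le_iff₀ h0]; exact hL.2 k θ θ'

theorem J_descent (h : M.Smooth Cφ Cπ Lφ) (hC : 0 ≤ Cφ) (hL : 0 ≤ Lφ) (k : Fin K)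
    (θ θ' : Vec p) :
    M.J k θ + ⟪gradient (M.J k) θ, θ' - θ⟫ - M.LJ / 2 * ‖θ' - θ‖ ^ 2 ≤ M.J k θ' :=
  descent_of_lipschitz_gradient (G := gradient (M.J k))
    (fun x => by rw [gradient_J h hC hL]; exact hasGradientAt_J h hC hL k x)
    ((LJ_spec h hC hL).2.2 k) θ θ'

/-- The norm of the minimal weighted gradient is a Lipschitz function of the parameter. -/
theorem continuous_min_norm (h : M.Smooth Cφ Cπ Lφ) (hC : 0 ≤ Cφ) (hL : 0 ≤ Lφ)
    {lamStar : Vec p → Vec K} (hl : ∀ θ, M.IsMinNormWeight θ (lamStar θ)) :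
    Continuous fun θ => ‖M.wgrad (lamStar θ) θ‖ := by
  have hwl : ∀ l ∈ simplex K, ∀ θ θ', ‖M.wgrad l θ - M.wgrad l θ'‖ ≤ M.LJ * ‖θ - θ'‖ := by
    intro l hl θ θ'
    rw [wgrad, wgrad, ← Finset.sum_sub_distrib]
    calc ‖∑ k, (l k • gradient (M.J k) θ - l k • gradient (M.J k) θ')‖
        ≤ ∑ k, ‖l k • gradient (M.J k) θ - l k • gradient (M.J k) θ'‖ := norm_sum_le _ _
      _ ≤ ∑ k, l k * (M.LJ * ‖θ - θ'‖) := Finset.sum_le_sum fun k _ => by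
          rw [← smul_sub, norm_smul, Real.norm_of_nonneg (hl.1 k)]
          exact mul_le_mul_of_nonneg_left ((LJ_spec h hC hL).2.2 k θ θ') (hl.1 k)
      _ = M.LJ * ‖θ - θ'‖ := by rw [← Finset.sum_mul, hl.2, one_mul]
  have key : ∀ θ θ', ‖M.wgrad (lamStar θ) θ‖ - ‖M.wgrad (lamStar θ') θ'‖ ≤ M.LJ * ‖θ - θ'‖ := by
    intro θ θ'
    have h1 : ‖M.wgrad (lamStar θ) θ‖ ≤ ‖M.wgrad (lamStar θ') θ‖ :=
      (sq_le_sq₀ (norm_nonneg _) (norm_nonneg _)).1 ((hl θ).2 (hl θ').1)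
    have h2 := hwl _ (hl θ').1 θ θ'
    have h3 := norm_sub_norm_le (M.wgrad (lamStar θ') θ) (M.wgrad (lamStar θ') θ')
    linarith
  refine (LipschitzWith.of_dist_le_mul (K := M.LJ.toNNReal) fun θ θ' => ?_).continuous
  rw [Real.dist_eq, dist_eq_norm, abs_sub_le_iff, Real.coe_toNNReal _ (LJ_spec h hC hL).1]
  exact ⟨key θ θ', by rw [norm_sub_rev]; exact key θ' θ⟩

end Model

/-! ### Total variation and geometric ergodicity -/

/-- Layer cake: the integral of g + b is the integral of the measures of its superlevel sets over
levels in (0, 2b], and these measures differ by at most ε at each level. -/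
theorem abs_integral_sub_le_of_real {α : Type*} [MeasurableSpace α] {μ ν : Measure α}
    [IsProbabilityMeasure μ] [IsProbabilityMeasure ν] {ε b : ℝ}
    (h : ∀ D, MeasurableSet D → |μ.real D - ν.real D| ≤ ε) {g : α → ℝ} (hg : BddMeas g b)
    (hb : 0 ≤ b) : |∫ x, g x ∂μ - ∫ x, g x ∂ν| ≤ 2 * b * ε := by
  have hrep : ∀ (η : Measure α) [IsProbabilityMeasure η],
      IntegrableOn (fun t => η.real {a | t ≤ g a + b}) (Set.Ioc 0 (2 * b)) ∧
      ∫ x, g x ∂η = (∫ t in Set.Ioc 0 (2 * b), η.real {a | t ≤ g a + b}) - b := by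
    intro η _
    have hi : Integrable (fun x => g x + b) η := (hg.integrable η).add (integrable_const b)
    constructor
    · have hanti : Antitone fun t => η.real {a | t ≤ g a + b} := fun s t hst =>
        measureReal_mono fun a (ha : t ≤ g a + b) => hst.trans ha
      exact Integrable.of_bound hanti.measurable.aestronglyMeasurable 1
        (Filter.Eventually.of_forall fun t => by
          rw [Real.norm_of_nonneg measureReal_nonneg]; exact measureReal_le_one)
    · have h1 := hi.integral_eq_integral_Ioc_meas_le (M := 2 * b)
        (Filter.Eventually.of_forall fun x => by
          have := (abs_le.1 (hg.bound x)).1; simp only [Pi.zero_apply]; linarith)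
        (Filter.Eventually.of_forall fun x => by
          have := (abs_le.1 (hg.bound x)).2; dsimp only; linarith)
      rw [← h1, integral_add (hg.integrable η) (integrable_const b)]
      simp
  rw [(hrep μ).2, (hrep ν).2, sub_sub_sub_cancel_right, ← integral_sub (hrep μ).1 (hrep ν).1]
  have h2 := norm_setIntegral_le_of_norm_le_const (μ := volume) (s := Set.Ioc (0 : ℝ) (2 * b))
    (f := fun t => μ.real {a | t ≤ g a + b} - ν.real {a | t ≤ g a + b}) (C := ε)
    measure_Ioc_lt_top fun t _ => h _ (measurableSet_le measurable_const (hg.meas.add_const b))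
  rw [Real.volume_real_Ioc_of_le (by linarith)] at h2
  calc _ ≤ _ := h2
    _ = _ := by ring

/-! ### Markov noise and the Poisson equation -/

section Markov

variable {Z : Type*} [MeasurableSpace Z]

/-- The averaging operator of a kernel. -/
noncomputable def kerOp (N : Kernel Z Z) (g : Z → ℝ) (z : Z) : ℝ := ∫ y, g y ∂N z

/-- The averages of bounded functions after `t + 1` steps are `κ ρ ^ t`-close to those of `d`. -/
def Mixing (N : Kernel Z Z) (d : Measure Z) (κ ρ : ℝ) : Prop :=
  ∀ (g : Z → ℝ) (b : ℝ), 0 ≤ b → BddMeas g b → ∀ t z,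
    |(kerOp N)^[t + 1] g z - ∫ y, g y ∂d| ≤ 2 * b * κ * ρ ^ t

variable {N : Kernel Z Z} [IsMarkovKernel N] {d : Measure Z} {κ ρ : ℝ}

theorem kerOp_bdd {g : Z → ℝ} {b : ℝ} (hg : BddMeas g b) : BddMeas (kerOp N g) b := hg.kernel N

theorem kerOp_iterate_bdd {g : Z → ℝ} {b : ℝ} (hg : BddMeas g b) (t : ℕ) :
    BddMeas ((kerOp N)^[t] g) b := by
  induction t with
  | zero => exact hg
  | succ t ih => rw [Function.iterate_succ_apply']; exact kerOp_bdd ih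

theorem kerOp_iterate_sub {f g : Z → ℝ} {b b' : ℝ} (hf : BddMeas f b) (hg : BddMeas g b')
    (t : ℕ) (z : Z) :
    (kerOp N)^[t] (fun z => f z - g z) z = (kerOp N)^[t] f z - (kerOp N)^[t] g z := by
  induction t generalizing z with
  | zero => rfl
  | succ t ih =>
    simp only [Function.iterate_succ_apply']
    rw [kerOp, kerOp, kerOp, ← integral_sub ((kerOp_iterate_bdd hf t).integrable _)
      ((kerOp_iterate_bdd hg t).integrable _)]
    simp only [ih]

/-- Averages of a function centred under d decay geometrically, so the partial sums are bounded
uniformly in T. -/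
theorem abs_sum_kerOp_le (hM : Mixing N d κ ρ) (hκ : 0 ≤ κ) (hρ0 : 0 ≤ ρ) (hρ1 : ρ < 1)
    {f : Z → ℝ} {b : ℝ} (hb : 0 ≤ b) (hf : BddMeas f b) (h0 : ∫ y, f y ∂d = 0) (T : ℕ) (z : Z) :
    |∑ t ∈ Finset.range T, (kerOp N)^[t] f z| ≤ (1 + 2 * κ / (1 - ρ)) * b := by
  have hρ : 0 < 1 - ρ := by linarith
  cases T with
  | zero => simp only [Finset.range_zero, Finset.sum_empty, abs_zero]; positivity
  | succ T =>
    -- The term t = 0 is split off, as `Mixing` only speaks of at least one step.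
    rw [Finset.sum_range_succ']
    have h1 : |∑ t ∈ Finset.range T, (kerOp N)^[t + 1] f z| ≤ 2 * b * κ * (1 - ρ)⁻¹ := by
      calc |∑ t ∈ Finset.range T, (kerOp N)^[t + 1] f z|
          ≤ ∑ t ∈ Finset.range T, |(kerOp N)^[t + 1] f z| := Finset.abs_sum_le_sum_abs _ _
        _ ≤ ∑ t ∈ Finset.range T, 2 * b * κ * ρ ^ t := Finset.sum_le_sum fun t _ => by
            simpa [h0] using hM f b hb hf t z
        _ = 2 * b * κ * ∑ t ∈ Finset.range T, ρ ^ t := by rw [Finset.mul_sum]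
        _ ≤ 2 * b * κ * (1 - ρ)⁻¹ := by
            refine mul_le_mul_of_nonneg_left ?_ (by positivity)
            rw [← tsum_geometric_of_lt_one hρ0 hρ1]
            exact (summable_geometric_of_lt_one hρ0 hρ1).sum_le_tsum _
              fun i _ => pow_nonneg hρ0 i
    have h2 : |(kerOp N)^[0] f z| ≤ b := hf.bound z
    refine (abs_add_le _ _).trans ((add_le_add h1 h2).trans (le_of_eq ?_))
    field_simp
    ring

variable {m : ℕ}

/-- The truncated solution of the Poisson equation for `n`. -/
noncomputable def poisson (N : Kernel Z Z) (n : Z × Vec m → ℝ) (T : ℕ) (y : Z × Vec m) : ℝ :=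
  ∑ t ∈ Finset.range T, (kerOp N)^[t] (fun z => n (z, y.2)) y.1

theorem section_bdd {n : Z × Vec m → ℝ} {b : ℝ} (hn : BddMeas n b) (w : Vec m) :
    BddMeas (fun z => n (z, w)) b := hn.comp (by fun_prop)

theorem measurable_kerOp_iterate {n : Z × Vec m → ℝ} (hn : Measurable n) (t : ℕ) :
    Measurable fun y : Z × Vec m => (kerOp N)^[t] (fun z => n (z, y.2)) y.1 := by
  induction t with
  | zero => exact hn
  | succ t ih =>
    simp only [Function.iterate_succ_apply']
    have h1 : StronglyMeasurable fun x : (Z × Vec m) × Z =>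
        (kerOp N)^[t] (fun z => n (z, x.1.2)) x.2 :=
      (ih.comp (by fun_prop : Measurable fun x : (Z × Vec m) × Z => (x.2, x.1.2))).stronglyMeasurable
    exact (h1.integral_kernel_prod_right' (κ := N.comap Prod.fst measurable_fst)).measurable

theorem poisson_bdd (hM : Mixing N d κ ρ) (hκ : 0 ≤ κ) (hρ0 : 0 ≤ ρ) (hρ1 : ρ < 1)
    {n : Z × Vec m → ℝ} {b : ℝ} (hb : 0 ≤ b) (hn : BddMeas n b)
    (h0 : ∀ w, ∫ z, n (z, w) ∂d = 0) (T : ℕ) :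
    BddMeas (poisson N n T) ((1 + 2 * κ / (1 - ρ)) * b) :=
  ⟨Finset.measurable_sum _ fun t _ => measurable_kerOp_iterate hn.meas t,
    fun y => abs_sum_kerOp_le hM hκ hρ0 hρ1 hb (section_bdd hn y.2) (h0 y.2) T y.1⟩

/-- The difference of two sections of n is again centred, with sup norm at most L‖w - w'‖, so the
uniform bound applies to it. -/
theorem poisson_lip [IsProbabilityMeasure d] (hM : Mixing N d κ ρ) (hκ : 0 ≤ κ) (hρ0 : 0 ≤ ρ)
    (hρ1 : ρ < 1) {n : Z × Vec m → ℝ} {b L : ℝ} (hL : 0 ≤ L) (hn : BddMeas n b)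
    (h0 : ∀ w, ∫ z, n (z, w) ∂d = 0) (hlip : ∀ z w w', |n (z, w) - n (z, w')| ≤ L * ‖w - w'‖)
    (T : ℕ) (z : Z) (w w' : Vec m) :
    |poisson N n T (z, w) - poisson N n T (z, w')| ≤ (1 + 2 * κ / (1 - ρ)) * (L * ‖w - w'‖) := by
  have h1 := section_bdd hn w
  have h2 := section_bdd hn w'
  have h := abs_sum_kerOp_le (f := fun z => n (z, w) - n (z, w')) hM hκ hρ0 hρ1
    (by positivity : 0 ≤ L * ‖w - w'‖) ⟨(h1.sub h2).meas, fun z => hlip z w w'⟩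
    (by rw [integral_sub (h1.integrable d) (h2.integrable d), h0, h0, sub_zero]) T z
  simp only [kerOp_iterate_sub h1 h2, Finset.sum_sub_distrib] at h
  exact h

/-- Telescoping. Truncation avoids infinite sums at the price of the last term, which is
geometrically small for centred n under mixing. -/
theorem poisson_eq {n : Z × Vec m → ℝ} {b : ℝ} (hn : BddMeas n b) (T : ℕ) (z : Z) (w : Vec m) :
    n (z, w) = poisson N n T (z, w) - ∫ z', poisson N n T (z', w) ∂N z +
      (kerOp N)^[T] (fun z => n (z, w)) z := by
  have h1 : ∫ z', poisson N n T (z', w) ∂N z =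
      ∑ t ∈ Finset.range T, (kerOp N)^[t + 1] (fun z => n (z, w)) z := by
    simp only [poisson]
    rw [integral_finsetSum _ fun t _ => (kerOp_iterate_bdd (section_bdd hn w) t).integrable _]
    simp only [Function.iterate_succ_apply']
    rfl
  have h2 := Finset.sum_range_succ (fun t => (kerOp N)^[t] (fun z => n (z, w)) z) T
  rw [Finset.sum_range_succ'] at h2
  rw [h1, poisson]
  simp only [Function.iterate_zero_apply] at h2
  linarith

/-- A stochastic recursion in `Z × ℝ^m` driven by a Markov chain, seen through bounded
functions: `(z, w)` moves to `(z', τ j ((z, w), z'))` with `z' ∼ N z`. -/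
structure MarkovRecursion (N : Kernel Z Z) (τ : ℕ → (Z × Vec m) × Z → Vec m)
    (μ : ℕ → Measure (Z × Vec m)) (B : ℝ) : Prop where
  prob : ∀ j, IsProbabilityMeasure (μ j)
  meas : ∀ j, Measurable (τ j)
  ball : ∀ j, ∀ᵐ y ∂μ j, ‖y.2‖ ≤ B
  step : ∀ j (F : Z × Vec m → ℝ) (b : ℝ), BddMeas F b →
    ∫ y, F y ∂μ (j + 1) = ∫ y, (∫ z', F (z', τ j (y, z')) ∂N y.1) ∂μ j

variable {τ : ℕ → (Z × Vec m) × Z → Vec m} {μ : ℕ → Measure (Z × Vec m)} {B : ℝ}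

/-- Averages over one step of the chain are measurable. -/
theorem bdd_step {F : (Z × Vec m) × Z → ℝ} {b : ℝ} (hF : BddMeas F b) :
    BddMeas (fun y : Z × Vec m => ∫ z', F (y, z') ∂N y.1) b :=
  ⟨(hF.meas.stronglyMeasurable.integral_kernel_prod_right'
    (κ := N.comap Prod.fst measurable_fst)).measurable,
    fun y => (hF.comp (by fun_prop : Measurable fun z' => (y, z'))).abs_integral_le _⟩

/-- The Poisson equation writes the noise at time j as V at the current state minus the mean of V
one chain step later with w held fixed, plus a small remainder. Letting w move in that second term
costs the Lipschitz constant of V times a_j. What is left telescopes, so the noise sums to a bounded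
amount plus the total movement of w. The horizon T is also the truncation level. -/
theorem MarkovRecursion.noise_le (h : MarkovRecursion N τ μ B) [IsProbabilityMeasure d]
    (hM : Mixing N d κ ρ) (hκ : 0 ≤ κ) (hρ0 : 0 ≤ ρ) (hρ1 : ρ < 1) {n : Z × Vec m → ℝ} {b L : ℝ}
    (hb : 0 ≤ b) (hL : 0 ≤ L) (hn : BddMeas n b) (h0 : ∀ w, ∫ z, n (z, w) ∂d = 0)
    (hlip : ∀ z w w', |n (z, w) - n (z, w')| ≤ L * ‖w - w'‖) {a : ℕ → ℝ}
    (ha : ∀ j y z', ‖y.2‖ ≤ B → ‖τ j (y, z') - y.2‖ ≤ a j) (T : ℕ) (hT : 1 ≤ T) :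
    ∑ j ∈ Finset.range T, ∫ y, n y ∂μ j ≤
      (1 + 2 * κ / (1 - ρ)) * (2 * b + L * ∑ j ∈ Finset.range T, a j)
        + 2 * b * κ * (1 - ρ)⁻¹ := by
  set Cm := 1 + 2 * κ / (1 - ρ) with hCm
  have hCm0 : 0 ≤ Cm := by have : 0 < 1 - ρ := by linarith
                           positivity
  set V := poisson N n T with hV
  have hVb : BddMeas V (Cm * b) := poisson_bdd hM hκ hρ0 hρ1 hb hn h0 T
  have hVl := poisson_lip hM hκ hρ0 hρ1 hL hn h0 hlip T
  have hstep : ∀ j, ∫ y, n y ∂μ j ≤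
      ∫ y, V y ∂μ j - ∫ y, V y ∂μ (j + 1) + Cm * L * a j + 2 * b * κ * ρ ^ (T - 1) := by
    intro j
    have := h.prob j
    have b1 : BddMeas (fun y : Z × Vec m => ∫ z', V (z', τ j (y, z')) ∂N y.1) (Cm * b) :=
      bdd_step (F := fun x => V (x.2, τ j x))
        (hVb.comp (measurable_snd.prodMk (h.meas j)))
    rw [h.step j V _ hVb, ← integral_sub (hVb.integrable _) (b1.integrable _)]
    have hpt : ∀ᵐ y ∂μ j, n y ≤ (V y - ∫ z', V (z', τ j (y, z')) ∂N y.1) +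
        (Cm * L * a j + 2 * b * κ * ρ ^ (T - 1)) := by
      filter_upwards [h.ball j] with y hy
      have e := poisson_eq (N := N) hn T y.1 y.2
      have m1 := (abs_le.1 (hM (fun z => n (z, y.2)) b hb (section_bdd hn y.2) (T - 1) y.1)).2
      rw [h0, sub_zero, Nat.sub_add_cancel hT] at m1
      have i1 : Integrable (fun z' => V (z', y.2)) (N y.1) := (section_bdd hVb y.2).integrable _
      have i2 : Integrable (fun z' => V (z', τ j (y, z'))) (N y.1) :=
        (hVb.comp (measurable_id.prodMk ((h.meas j).comp
          (by fun_prop : Measurable fun z' => (y, z'))))).integrable _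
      have m2 : ∫ z', V (z', τ j (y, z')) ∂N y.1 - ∫ z', V (z', y.2) ∂N y.1 ≤ Cm * L * a j := by
        rw [← integral_sub i2 i1]
        have h3 : ∀ z', V (z', τ j (y, z')) - V (z', y.2) ≤ Cm * L * a j := fun z' => by
          refine (le_abs_self _).trans ((hVl z' _ _).trans ?_)
          rw [mul_assoc]
          exact mul_le_mul_of_nonneg_left (mul_le_mul_of_nonneg_left (ha j y z' hy) hL) hCm0
        have h4 := integral_mono (i2.sub i1) (integrable_const (Cm * L * a j)) h3
        simpa using h4
      have e' : n y = n (y.1, y.2) := rfl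
      rw [e', e]
      linarith
    have iV : Integrable (fun y => V y - ∫ z', V (z', τ j (y, z')) ∂N y.1) (μ j) :=
      (hVb.integrable _).sub (b1.integrable _)
    have h5 := integral_mono_ae (hn.integrable _) (iV.add (integrable_const _)) hpt
    rw [integral_add' iV (integrable_const _)] at h5
    simp only [integral_const, probReal_univ, one_smul] at h5
    linarith
  have hsum : ∀ n', ∑ j ∈ Finset.range n', ∫ y, n y ∂μ j ≤ ∫ y, V y ∂μ 0 - ∫ y, V y ∂μ n' +
      Cm * L * ∑ j ∈ Finset.range n', a j + n' * (2 * b * κ * ρ ^ (T - 1)) := by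
    intro n'
    induction n' with
    | zero => simp
    | succ n' ih =>
      rw [Finset.sum_range_succ, Finset.sum_range_succ]
      have := hstep n'
      push_cast
      linarith
  have hV0 := abs_le.1 (have := h.prob 0; hVb.abs_integral_le (μ 0))
  have hVT := abs_le.1 (have := h.prob T; hVb.abs_integral_le (μ T))
  -- The T truncation remainders, each of order ρ^(T-1), together stay below one geometric series.
  have hgeo : (T : ℝ) * ρ ^ (T - 1) ≤ (1 - ρ)⁻¹ := by
    rw [← tsum_geometric_of_lt_one hρ0 hρ1]
    calc (T : ℝ) * ρ ^ (T - 1) = ∑ _i ∈ Finset.range T, ρ ^ (T - 1) := by simp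
      _ ≤ ∑ i ∈ Finset.range T, ρ ^ i := Finset.sum_le_sum fun i hi =>
          pow_le_pow_of_le_one hρ0 hρ1.le (Nat.le_sub_one_of_lt (Finset.mem_range.1 hi))
      _ ≤ _ := (summable_geometric_of_lt_one hρ0 hρ1).sum_le_tsum _ fun i _ => pow_nonneg hρ0 i
  have h6 := mul_le_mul_of_nonneg_left hgeo (by positivity : 0 ≤ 2 * b * κ)
  have := hsum T
  nlinarith

end Markov

/-! ### Projected stochastic approximation with Markov noise -/

/-- The growth is logarithmic, but √n suffices for the rate 1/√T aimed at and keeps logarithms out.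
-/
theorem sum_inv_succ_le (n : ℕ) : ∑ j ∈ Finset.range n, 1 / ((j : ℝ) + 1) ≤ 2 * √(n : ℝ) := by
  induction n with
  | zero => simp
  | succ n ih =>
    rw [Finset.sum_range_succ]
    push_cast
    have h1 := Real.sq_sqrt (by positivity : (0 : ℝ) ≤ n)
    have h2 := Real.sq_sqrt (by positivity : (0 : ℝ) ≤ (n : ℝ) + 1)
    have h3 := Real.sqrt_nonneg (n : ℝ)
    have h4 : 1 ≤ √((n : ℝ) + 1) := Real.one_le_sqrt.2 (by linarith [Nat.cast_nonneg (α := ℝ) n])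
    set x := √(n : ℝ)
    set y := √((n : ℝ) + 1)
    have h5 : 1 / ((n : ℝ) + 1) ≤ 2 * (y - x) := by
      rw [div_le_iff₀ (by positivity), ← h2]
      have h6 : x ≤ y := Real.sqrt_le_sqrt (by linarith)
      have h7 : (y - x) * (y + x) = 1 := by nlinarith
      have h8 : (y - x) * (y + x) ≤ (y - x) * (2 * y ^ 2) :=
        mul_le_mul_of_nonneg_left (by nlinarith) (by linarith)
      nlinarith
    linarith

section Markov

variable {Z : Type*} [MeasurableSpace Z] {N : Kernel Z Z} [IsMarkovKernel N] {d : Measure Z}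
  [IsProbabilityMeasure d] {m : ℕ} {μ : ℕ → Measure (Z × Vec m)} {B : ℝ}

/-- The constant of `projected_markov_recursion`. -/
noncomputable def criticConst (κ ρ lam B G L : ℝ) : ℝ :=
  1 / lam * ((1 + 2 * κ / (1 - ρ)) * (8 * B * G + 2 * (2 * B * L + G) * G / lam)
    + 8 * B * G * κ * (1 - ρ)⁻¹) + G ^ 2 / (2 * lam ^ 2)

/-- The step length is tuned so that the contraction factor 1 - 2αλ equals j/(j+1). Multiplied by j
+ 1, the error recursion telescopes, and T times the final error is the accumulated noise plus a
harmonic sum. Both are O(√T). -/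
theorem projected_markov_recursion {κ ρ lam G L : ℝ} (hM : Mixing N d κ ρ) (hκ : 0 ≤ κ)
    (hρ0 : 0 ≤ ρ) (hρ1 : ρ < 1) (hlam : 0 < lam) (hB : 0 ≤ B) (hG : 0 ≤ G) (hL : 0 ≤ L)
    {g : (Z × Vec m) × Z → Vec m} (hgm : Measurable g)
    (hgb : ∀ y z', ‖y.2‖ ≤ B → ‖g (y, z')‖ ≤ G)
    (hgl : ∀ z z' w w', ‖g ((z, w), z') - g ((z, w'), z')‖ ≤ L * ‖w - w'‖)
    (h : MarkovRecursion N (fun j x => nearest (Metric.closedBall 0 B)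
      (x.1.2 + (1 / (2 * lam * (j + 1)) : ℝ) • g x)) μ B)
    {wst : Vec m} (hw : ‖wst‖ ≤ B)
    (hneg : ∀ w, ‖w‖ ≤ B →
      ∫ z, (∫ z', ⟪g ((z, w), z'), w - wst⟫ ∂N z) ∂d ≤ -lam * ‖w - wst‖ ^ 2)
    (T : ℕ) (hT : 1 ≤ T) :
    ∫ y, ‖y.2 - wst‖ ^ 2 ∂μ T ≤ criticConst κ ρ lam B G L / √(T : ℝ) := by
  set C : Set (Vec m) := Metric.closedBall 0 B with hC
  have hne : C.Nonempty := ⟨0, Metric.mem_closedBall_self hB⟩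
  have hcl : IsClosed C := Metric.isClosed_closedBall
  have hcv : Convex ℝ C := convex_closedBall _ _
  -- The noise estimates require globally bounded functions, whereas g is bounded only for w in the
  -- ball. Composing with the projection extends everything and changes nothing along the iterates,
  -- which stay in the ball.
  set c : Vec m → Vec m := nearest C with hc
  have hcm : Measurable c := (continuous_nearest hcl hcv).measurable
  have hcB : ∀ w, ‖c w‖ ≤ B := fun w => mem_closedBall_zero_iff.1 (nearest_spec hne hcl hcv w).1
  have hceq : ∀ w, ‖w‖ ≤ B → c w = w := fun w hw => nearest_eq_self (mem_closedBall_zero_iff.2 hw)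
  have hcl1 : ∀ w w', ‖c w - c w'‖ ≤ ‖w - w'‖ := norm_nearest_sub_nearest_le hne hcl hcv
  have hcw : ∀ w, ‖c w - wst‖ ≤ 2 * B := fun w => (norm_sub_le _ _).trans (by linarith [hcB w])
  -- the noise
  set q : (Z × Vec m) × Z → ℝ := fun x => ⟪g ((x.1.1, c x.1.2), x.2), c x.1.2 - wst⟫ with hq
  have hqm : Measurable q := by
    refine Measurable.inner (hgm.comp ?_) ?_
    · exact (measurable_fst.fst.prodMk (hcm.comp measurable_fst.snd)).prodMk measurable_snd
    · exact (hcm.comp measurable_fst.snd).sub_const wst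
  have hqb : BddMeas q (2 * B * G) := ⟨hqm, fun x => (abs_real_inner_le_norm _ _).trans (by
    rw [mul_comm]
    exact mul_le_mul (hcw _) (hgb _ _ (hcB _)) (norm_nonneg _) (by positivity))⟩
  have hql : ∀ z z' w w', |q ((z, w), z') - q ((z, w'), z')| ≤ (2 * B * L + G) * ‖w - w'‖ := by
    intro z z' w w'
    have e : q ((z, w), z') - q ((z, w'), z') =
        ⟪g ((z, c w), z') - g ((z, c w'), z'), c w - wst⟫ + ⟪g ((z, c w'), z'), c w - c w'⟫ := by
      simp only [hq, inner_sub_left, inner_sub_right]; ring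
    rw [e]
    refine (abs_add_le _ _).trans ?_
    have h1 := (abs_real_inner_le_norm (g ((z, c w), z') - g ((z, c w'), z')) (c w - wst)).trans
      (mul_le_mul ((hgl z z' _ _).trans (mul_le_mul_of_nonneg_left (hcl1 w w') hL)) (hcw w)
        (norm_nonneg _) (by positivity))
    have h2 := (abs_real_inner_le_norm (g ((z, c w'), z')) (c w - c w')).trans
      (mul_le_mul (hgb (z, c w') z' (hcB _)) (hcl1 w w') (norm_nonneg _) hG)
    nlinarith
  set hh : Z × Vec m → ℝ := fun y => ∫ z', q (y, z') ∂N y.1 with hhh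
  have hhb : BddMeas hh (2 * B * G) := bdd_step hqb
  have hqi : ∀ y, Integrable (fun z' => q (y, z')) (N y.1) := fun y =>
    (hqb.comp (by fun_prop : Measurable fun z' => (y, z'))).integrable _
  have hhl : ∀ z w w', |hh (z, w) - hh (z, w')| ≤ (2 * B * L + G) * ‖w - w'‖ := by
    intro z w w'
    simp only [hhh]
    rw [← integral_sub (hqi (z, w)) (hqi (z, w'))]
    exact BddMeas.abs_integral_le ⟨((hqm.comp (by fun_prop :
      Measurable fun z' => ((z, w), z'))).sub (hqm.comp (by fun_prop :
      Measurable fun z' => ((z, w'), z')))), fun z' => hql z z' w w'⟩ _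
  have hbar_b : BddMeas (fun y : Z × Vec m => ∫ z, hh (z, y.2) ∂d) (2 * B * G) :=
    ⟨((hhb.meas.comp (by fun_prop : Measurable fun x : (Z × Vec m) × Z =>
      (x.2, x.1.2))).stronglyMeasurable.integral_prod_right' (ν := d)).measurable,
      fun y => (section_bdd hhb y.2).abs_integral_le d⟩
  -- The centred noise: the mean drift at the current chain state minus the drift averaged under d.
  set n : Z × Vec m → ℝ := fun y => hh y - ∫ z, hh (z, y.2) ∂d with hn
  have hnb : BddMeas n (2 * B * G + 2 * B * G) := hhb.sub hbar_b
  have hn0 : ∀ w, ∫ z, n (z, w) ∂d = 0 := fun w => by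
    simp only [hn]
    rw [integral_sub ((section_bdd hhb w).integrable d) (integrable_const _)]
    simp
  have hnl : ∀ z w w', |n (z, w) - n (z, w')| ≤ (2 * (2 * B * L + G)) * ‖w - w'‖ := by
    intro z w w'
    have e : n (z, w) - n (z, w') = (hh (z, w) - hh (z, w')) -
        (∫ z, hh (z, w) ∂d - ∫ z, hh (z, w') ∂d) := by simp only [hn]; ring
    have h1 : |∫ z, hh (z, w) ∂d - ∫ z, hh (z, w') ∂d| ≤ (2 * B * L + G) * ‖w - w'‖ := by
      rw [← integral_sub ((section_bdd hhb w).integrable d) ((section_bdd hhb w').integrable d)]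
      exact BddMeas.abs_integral_le ⟨(section_bdd hhb w).meas.sub (section_bdd hhb w').meas,
        fun z => hhl z w w'⟩ _
    rw [e]
    refine (abs_sub _ _).trans ?_
    linarith [hhl z w w']
  have hα : ∀ j : ℕ, 0 ≤ (1 / (2 * lam * (j + 1)) : ℝ) := fun j => by positivity
  have hstepB : ∀ (j : ℕ) (y : Z × Vec m) (z' : Z), ‖y.2‖ ≤ B →
      ‖(1 / (2 * lam * (j + 1)) : ℝ) • g (y, z')‖ ≤ 1 / (2 * lam * (j + 1)) * G := by
    intro j y z' hy
    rw [norm_smul, Real.norm_of_nonneg (hα j)]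
    exact mul_le_mul_of_nonneg_left (hgb y z' hy) (hα j)
  have hnoise := h.noise_le hM hκ hρ0 hρ1 (by positivity) (by positivity) hnb hn0 hnl
    (a := fun j => 1 / (2 * lam * (j + 1)) * G) (fun j y z' hy => by
      have h1 := hcl1 (y.2 + (1 / (2 * lam * (j + 1)) : ℝ) • g (y, z')) y.2
      rw [hceq _ hy, add_sub_cancel_left] at h1
      exact h1.trans (hstepB j y z' hy)) T hT
  -- the distance to the target
  set F : Z × Vec m → ℝ := fun y => ‖c y.2 - wst‖ ^ 2 with hF
  have hFb : BddMeas F ((2 * B) ^ 2) := ⟨((hcm.comp measurable_snd).sub_const wst).norm.pow_const 2,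
    fun y => by
      rw [abs_of_nonneg (by positivity)]
      exact pow_le_pow_left₀ (norm_nonneg _) (hcw _) 2⟩
  -- The coefficient j at j = 0 removes the initial error from the sum.
  have hrec : ∀ j : ℕ, ((j : ℝ) + 1) * ∫ y, F y ∂μ (j + 1) ≤ j * ∫ y, F y ∂μ j +
      1 / lam * ∫ y, n y ∂μ j + G ^ 2 / (4 * lam ^ 2) * (1 / ((j : ℝ) + 1)) := by
    intro j
    have := h.prob j
    set α : ℝ := 1 / (2 * lam * (j + 1)) with hαd
    have hα0 : 0 ≤ α := hα j
    have b1 := bdd_step (N := N) (F := fun x : (Z × Vec m) × Z =>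
      F (x.2, nearest C (x.1.2 + α • g x))) (hFb.comp (measurable_snd.prodMk (h.meas j)))
    have hpt : ∀ᵐ y ∂μ j, ∫ z', F (z', nearest C (y.2 + α • g (y, z'))) ∂N y.1 ≤
        ((1 - 2 * α * lam) * F y + 2 * α * n y) + α ^ 2 * G ^ 2 := by
      filter_upwards [h.ball j] with y hy
      have hpt' : ∀ z', F (z', nearest C (y.2 + α • g (y, z'))) ≤
          2 * α * q (y, z') + (F y + α ^ 2 * G ^ 2) := by
        intro z'
        have e1 : c (nearest C (y.2 + α • g (y, z'))) = c (y.2 + α • g (y, z')) :=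
          hceq _ (hcB _)
        have h1 := hcl1 (y.2 + α • g (y, z')) wst
        rw [hceq wst hw] at h1
        simp only [hF, e1, hq, hceq _ hy]
        have h2 : ‖y.2 + α • g (y, z') - wst‖ ^ 2 = ‖y.2 - wst‖ ^ 2 +
            2 * α * ⟪g (y, z'), y.2 - wst⟫ + ‖α • g (y, z')‖ ^ 2 := by
          rw [add_sub_right_comm, norm_add_sq_real, inner_smul_right, real_inner_comm]; ring
        have h3 := pow_le_pow_left₀ (norm_nonneg _) (hstepB j y z' hy) 2
        have h4 := pow_le_pow_left₀ (norm_nonneg _) h1 2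
        have e5 : ((y.1, y.2), z') = (y, z') := rfl
        rw [e5]
        rw [← hαd] at h3
        nlinarith
      have i1 : Integrable (fun z' => F (z', nearest C (y.2 + α • g (y, z')))) (N y.1) :=
        ((hFb.comp (measurable_snd.prodMk (h.meas j))).comp
          (by fun_prop : Measurable fun z' => (y, z'))).integrable _
      have h5 := integral_mono i1 (((hqi y).const_mul (2 * α)).add (integrable_const _)) hpt'
      rw [integral_add' ((hqi y).const_mul (2 * α)) (integrable_const _), integral_const_mul,
        integral_const, probReal_univ, one_smul] at h5
      have h6 : ∫ z', q (y, z') ∂N y.1 ≤ n y - lam * F y := by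
        have h7 := hneg y.2 hy
        have e8 : ∫ z, hh (z, y.2) ∂d = ∫ z, (∫ z', ⟪g ((z, y.2), z'), y.2 - wst⟫ ∂N z) ∂d := by
          simp only [hhh, hq, hceq _ hy]
        have e9 : ∫ z', q (y, z') ∂N y.1 = n y + ∫ z, hh (z, y.2) ∂d := by simp only [hn, hhh]; ring
        rw [e9, e8]
        simp only [hF, hceq _ hy]
        linarith
      have h10 := mul_le_mul_of_nonneg_left h6 (by positivity : 0 ≤ 2 * α)
      linarith
    have iF : Integrable (fun y => (1 - 2 * α * lam) * F y) (μ j) :=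
      (hFb.integrable _).const_mul _
    have iN : Integrable (fun y => 2 * α * n y) (μ j) := (hnb.integrable _).const_mul _
    have iFN : Integrable (fun y => (1 - 2 * α * lam) * F y + 2 * α * n y) (μ j) := iF.add iN
    have h11 := integral_mono_ae (b1.integrable _) (iFN.add (integrable_const _)) hpt
    rw [integral_add' iFN (integrable_const _), integral_add iF iN, integral_const_mul,
      integral_const_mul, integral_const, probReal_univ, one_smul] at h11
    rw [← h.step j F _ hFb] at h11
    have hj : (0 : ℝ) < (j : ℝ) + 1 := by positivity
    have e12 : ((j : ℝ) + 1) * ((1 - 2 * α * lam) * ∫ y, F y ∂μ j + 2 * α * ∫ y, n y ∂μ j +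
        α ^ 2 * G ^ 2) = j * ∫ y, F y ∂μ j + 1 / lam * ∫ y, n y ∂μ j +
          G ^ 2 / (4 * lam ^ 2) * (1 / ((j : ℝ) + 1)) := by
      rw [hαd]; field_simp; ring
    rw [← e12]
    exact mul_le_mul_of_nonneg_left h11 hj.le
  have hsum : ∀ t : ℕ, (t : ℝ) * ∫ y, F y ∂μ t ≤ 1 / lam * ∑ j ∈ Finset.range t, ∫ y, n y ∂μ j +
      G ^ 2 / (4 * lam ^ 2) * ∑ j ∈ Finset.range t, 1 / ((j : ℝ) + 1) := by
    intro t
    induction t with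
    | zero => simp
    | succ t ih =>
      rw [Finset.sum_range_succ, Finset.sum_range_succ]
      push_cast
      linarith [hrec t]
  have hFT : ∫ y, ‖y.2 - wst‖ ^ 2 ∂μ T = ∫ y, F y ∂μ T := by
    refine integral_congr_ae ?_
    filter_upwards [h.ball T] with y hy
    simp only [hF, hceq _ hy]
  rw [hFT]
  have hS := sum_inv_succ_le T
  have hs1 : 1 ≤ √(T : ℝ) := Real.one_le_sqrt.2 (by exact_mod_cast hT)
  have hsq := Real.mul_self_sqrt (Nat.cast_nonneg (α := ℝ) T)
  set s := √(T : ℝ)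
  have ha : ∑ j ∈ Finset.range T, 1 / (2 * lam * ((j : ℝ) + 1)) * G =
      G / (2 * lam) * ∑ j ∈ Finset.range T, 1 / ((j : ℝ) + 1) := by
    rw [Finset.mul_sum]
    refine Finset.sum_congr rfl fun j _ => ?_
    field_simp
  rw [ha] at hnoise
  set H := ∑ j ∈ Finset.range T, 1 / ((j : ℝ) + 1)
  have hρ : 0 < 1 - ρ := by linarith
  have h1 : G / (2 * lam) * H ≤ G / lam * s := by
    have := mul_le_mul_of_nonneg_left hS (by positivity : 0 ≤ G / (2 * lam))
    calc _ ≤ _ := this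
      _ = _ := by field_simp
  have h2 : G ^ 2 / (4 * lam ^ 2) * H ≤ G ^ 2 / (2 * lam ^ 2) * s := by
    have := mul_le_mul_of_nonneg_left hS (by positivity : 0 ≤ G ^ 2 / (4 * lam ^ 2))
    calc _ ≤ _ := this
      _ = _ := by field_simp; norm_num
  have h3 : (1 + 2 * κ / (1 - ρ)) * (2 * (2 * B * G + 2 * B * G) +
      2 * (2 * B * L + G) * (G / (2 * lam) * H)) + 2 * (2 * B * G + 2 * B * G) * κ * (1 - ρ)⁻¹ ≤
      ((1 + 2 * κ / (1 - ρ)) * (8 * B * G + 2 * (2 * B * L + G) * G / lam)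
        + 8 * B * G * κ * (1 - ρ)⁻¹) * s := by
    have a1 : 2 * (2 * B * G + 2 * B * G) + 2 * (2 * B * L + G) * (G / (2 * lam) * H) ≤
        (8 * B * G + 2 * (2 * B * L + G) * G / lam) * s := by
      have a2 := mul_le_mul_of_nonneg_left h1 (by positivity : 0 ≤ 2 * (2 * B * L + G))
      have a3 : 8 * B * G ≤ 8 * B * G * s := le_mul_of_one_le_right (by positivity) hs1
      have a4 : 2 * (2 * B * L + G) * (G / lam * s) = 2 * (2 * B * L + G) * G / lam * s := by
        ring
      linarith
    have a5 := mul_le_mul_of_nonneg_left a1 (by positivity : 0 ≤ 1 + 2 * κ / (1 - ρ))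
    have a6 : 8 * B * G * κ * (1 - ρ)⁻¹ ≤ 8 * B * G * κ * (1 - ρ)⁻¹ * s :=
      le_mul_of_one_le_right (by positivity) hs1
    linarith
  have h4 := mul_le_mul_of_nonneg_left (hnoise.trans h3) (by positivity : 0 ≤ 1 / lam)
  have h5 : s * (s * ∫ y, F y ∂μ T) ≤ s * criticConst κ ρ lam B G L := by
    rw [← mul_assoc, hsq, criticConst]
    linarith [hsum T]
  have hs0 : 0 < s := by linarith
  rw [le_div_iff₀ hs0, mul_comm]
  exact le_of_mul_le_mul_left h5 hs0

end Markov

theorem integral_sum_add_sum {α ι : Type*} [MeasurableSpace α] [Fintype ι] {μ : Measure α}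
    {a : ι → α → ℝ} {d : ι → ι → α → ℝ} (ha : ∀ i, Integrable (a i) μ)
    (hd : ∀ i j, Integrable (d i j) μ) (x : ι → ℝ) (y : ι → ι → ℝ) :
    ∫ z, ∑ i, (x i * a i z + ∑ j, y i j * d i j z) ∂μ =
      ∑ i, (x i * ∫ z, a i z ∂μ + ∑ j, y i j * ∫ z, d i j z ∂μ) := by
  have h1 : ∀ i, Integrable (fun z => x i * a i z) μ := fun i => (ha i).const_mul _
  have h2 : ∀ i j, Integrable (fun z => y i j * d i j z) μ := fun i j => (hd i j).const_mul _
  have h3 : ∀ i, Integrable (fun z => ∑ j, y i j * d i j z) μ := fun i =>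
    integrable_finsetSum _ fun j _ => h2 i j
  have h4 : ∀ i, Integrable (fun z => x i * a i z + ∑ j, y i j * d i j z) μ := fun i =>
    (h1 i).add (h3 i)
  rw [integral_finsetSum _ fun i _ => h4 i]
  refine Finset.sum_congr rfl fun i _ => ?_
  rw [integral_add (h1 i) (h3 i), integral_finsetSum _ fun j _ => h2 i j]
  simp only [integral_const_mul]

namespace Model

variable {S A : Type*} [MeasurableSpace S] [MeasurableSpace A] {K p m : ℕ} {M : Model S A K p m}
  {Cφ Cπ Lφ : ℝ}

/-! ### The critic -/

variable (M) in
/-- The chain of task `k` under a fixed policy. -/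
noncomputable def chain (k : Fin K) (θ : Vec p) : Kernel (S × A) (S × A) :=
  (M.next k).comap (fun z => (θ, z)) (by fun_prop)

instance (k : Fin K) (θ : Vec p) : IsMarkovKernel (M.chain k θ) := by
  unfold chain; infer_instance

/-- Ergodicity is assumed from a state with its action drawn from the policy. From a state-action
pair, one transition first leads to such a situation, which accounts for exponent t after t + 1
steps. -/
theorem mixing_chain {κ ρ : ℝ} (h : M.UniformlyErgodic κ ρ) (k : Fin K) (θ : Vec p) :
    Mixing (M.chain k θ) (M.visit k θ) κ ρ := by
  intro g b hb hg t z
  have e : (kerOp (M.chain k θ))^[t + 1] g z = ∫ s, M.polAvg θ ((M.transOp k θ)^[t] g) s ∂M.P k z := by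
    rw [← transOp_eq (transOp_iterate_bdd (M := M) hg k θ t), Function.iterate_succ_apply']
    rfl
  have hb1 := polAvg_bdd (M := M) (transOp_iterate_bdd (M := M) hg k θ t) θ
  set c := ∫ y, g y ∂M.visit k θ with hc
  have hmk : IsMarkovKernel (M.lawFrom k t) := by unfold lawFrom; infer_instance
  have h2 : BddMeas (fun s => M.polAvg θ ((M.transOp k θ)^[t] g) s - c) (2 * b * κ * ρ ^ t) :=
    ⟨hb1.meas.sub_const c, fun s => by
      rw [← integral_lawFrom hg k θ t s, mul_assoc]
      exact abs_integral_sub_le_of_real (h k θ s t) hg hb⟩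
  have h3 := h2.abs_integral_le (M.P k z)
  rw [integral_sub (hb1.integrable _) (integrable_const _)] at h3
  rw [e]
  simpa using h3

variable (M) in
/-- The TD(0) direction. -/
noncomputable def tdDir (k : Fin K) (x : ((S × A) × Vec m) × (S × A)) : Vec m :=
  (M.r k x.1.1 + M.γ * ⟪M.φ k x.2, x.1.2⟫ - ⟪M.φ k x.1.1, x.1.2⟫) • M.φ k x.1.1

theorem measurable_tdDir (k : Fin K) : Measurable (M.tdDir k) := by
  have h1 := M.r_meas k
  have h2 := M.φ_meas k
  unfold tdDir
  fun_prop

theorem norm_tdDir_le (h : M.Smooth Cφ Cπ Lφ) {B : ℝ} (k : Fin K)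
    (y : (S × A) × Vec m) (z' : S × A) (hy : ‖y.2‖ ≤ B) :
    ‖M.tdDir k (y, z')‖ ≤ (1 + 2 * (Cφ * B)) * Cφ := by
  have h1 := M.r_mem k y.1
  have hC : 0 ≤ Cφ := (norm_nonneg _).trans (h.feature_le k z')
  have h2 : ∀ z, |⟪M.φ k z, y.2⟫| ≤ Cφ * B := fun z => (abs_real_inner_le_norm _ _).trans
    (mul_le_mul (h.feature_le k z) hy (norm_nonneg _) hC)
  have h3 : |M.r k y.1| ≤ 1 := (bddMeas_reward M k).bound _
  have h4 : |M.γ * ⟪M.φ k z', y.2⟫| ≤ Cφ * B := by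
    rw [abs_mul, abs_of_nonneg M.γ_nonneg]
    exact (mul_le_of_le_one_left (abs_nonneg _) M.γ_lt_one.le).trans (h2 z')
  rw [tdDir, norm_smul, Real.norm_eq_abs]
  refine mul_le_mul ?_ (h.feature_le k _) (norm_nonneg _)
    (by linarith [(abs_nonneg _).trans h4])
  refine (abs_sub _ _).trans ?_
  linarith [abs_add_le (M.r k y.1) (M.γ * ⟪M.φ k z', y.2⟫), h2 y.1]

theorem tdDir_lip (h : M.Smooth Cφ Cπ Lφ) (k : Fin K) (z z' : S × A) (w w' : Vec m) :
    ‖M.tdDir k ((z, w), z') - M.tdDir k ((z, w'), z')‖ ≤ 2 * Cφ ^ 2 * ‖w - w'‖ := by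
  have hC : 0 ≤ Cφ := (norm_nonneg _).trans (h.feature_le k z')
  have e : M.tdDir k ((z, w), z') - M.tdDir k ((z, w'), z') =
      (M.γ * ⟪M.φ k z', w - w'⟫ - ⟪M.φ k z, w - w'⟫) • M.φ k z := by
    simp only [tdDir, ← sub_smul, inner_sub_right]
    congr 1; ring
  have h2 : ∀ z, |⟪M.φ k z, w - w'⟫| ≤ Cφ * ‖w - w'‖ := fun z => (abs_real_inner_le_norm _ _).trans
    (mul_le_mul_of_nonneg_right (h.feature_le k z) (norm_nonneg _))
  have h4 : |M.γ * ⟪M.φ k z', w - w'⟫| ≤ Cφ * ‖w - w'‖ := by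
    rw [abs_mul, abs_of_nonneg M.γ_nonneg]
    exact (mul_le_of_le_one_left (abs_nonneg _) M.γ_lt_one.le).trans (h2 z')
  rw [e, norm_smul, Real.norm_eq_abs]
  have h5 : |M.γ * ⟪M.φ k z', w - w'⟫ - ⟪M.φ k z, w - w'⟫| ≤ 2 * (Cφ * ‖w - w'‖) :=
    (abs_sub _ _).trans (by linarith [h2 z])
  calc _ ≤ 2 * (Cφ * ‖w - w'‖) * Cφ :=
        mul_le_mul h5 (h.feature_le k z) (norm_nonneg _) (by positivity)
    _ = _ := by ring

theorem bddMeas_coord (h : M.Smooth Cφ Cπ Lφ) (k : Fin K) (i : Fin m) :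
    BddMeas (fun z => M.φ k z i) Cφ :=
  ⟨(EuclideanSpace.proj (𝕜 := ℝ) i).continuous.measurable.comp (M.φ_meas k), fun z => by
    rw [← Real.norm_eq_abs]; exact (PiLp.norm_apply_le _ i).trans (h.feature_le k z)⟩

/-- The mean TD(0) direction is `b + A w`. -/
theorem integral_tdDir (h : M.Smooth Cφ Cπ Lφ) (k : Fin K) (θ : Vec p) (w x : Vec m) :
    ∫ z, (∫ z', ⟪M.tdDir k ((z, w), z'), x⟫ ∂M.chain k θ z) ∂M.visit k θ =
      dotProduct x (M.tdb k θ + (M.tdA k θ).mulVec w) := by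
  have hφ := bddMeas_coord h k
  have b1 : ∀ i, BddMeas (fun z => M.φ k z i * M.r k z) (Cφ * 1) := fun i =>
    (hφ i).mul (bddMeas_reward M k)
  have b2 : ∀ i j, BddMeas (fun y : (S × A) × (S × A) =>
      M.φ k y.1 i * (M.γ * M.φ k y.2 j - M.φ k y.1 j)) (Cφ * (|M.γ| * Cφ + Cφ)) := fun i j =>
    ((hφ i).comp measurable_fst).mul ((((hφ j).comp measurable_snd).const_mul _).sub
      ((hφ j).comp measurable_fst))
  have i2 : ∀ i j z, Integrable (fun z' => M.φ k z i * (M.γ * M.φ k z' j - M.φ k z j))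
      (M.chain k θ z) := fun i j z =>
    ((b2 i j).comp (by fun_prop : Measurable fun z' : S × A => (z, z'))).integrable _
  have b3 : ∀ i j, BddMeas (fun z => ∫ z', M.φ k z i * (M.γ * M.φ k z' j - M.φ k z j)
      ∂M.chain k θ z) (Cφ * (|M.γ| * Cφ + Cφ)) := fun i j =>
    ⟨((b2 i j).meas.stronglyMeasurable.integral_kernel_prod_right' (κ := M.chain k θ)).measurable,
      fun z => ((b2 i j).comp
        (by fun_prop : Measurable fun z' : S × A => (z, z'))).abs_integral_le _⟩
  have e1 : ∀ z z', ⟪M.tdDir k ((z, w), z'), x⟫ = ∑ i, (x i * (M.φ k z i * M.r k z) +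
      ∑ j, x i * w j * (M.φ k z i * (M.γ * M.φ k z' j - M.φ k z j))) := by
    intro z z'
    rw [tdDir, inner_smul_left]
    simp only [PiLp.inner_apply, RCLike.inner_apply, conj_trivial]
    rw [Finset.mul_sum]
    refine Finset.sum_congr rfl fun i _ => ?_
    have e2 : ∑ j, x i * w j * (M.φ k z i * (M.γ * M.φ k z' j - M.φ k z j)) =
        x i * M.φ k z i * (M.γ * ∑ j, w j * M.φ k z' j - ∑ j, w j * M.φ k z j) := by
      rw [Finset.mul_sum, ← Finset.sum_sub_distrib, Finset.mul_sum]
      exact Finset.sum_congr rfl fun j _ => by ring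
    rw [e2]
    ring
  have e3 : ∀ z, ∫ z', ⟪M.tdDir k ((z, w), z'), x⟫ ∂M.chain k θ z =
      ∑ i, (x i * (M.φ k z i * M.r k z) + ∑ j, x i * w j *
        ∫ z', M.φ k z i * (M.γ * M.φ k z' j - M.φ k z j) ∂M.chain k θ z) := by
    intro z
    simp only [e1]
    rw [integral_sum_add_sum (a := fun i _ => M.φ k z i * M.r k z)
      (d := fun i j z' => M.φ k z i * (M.γ * M.φ k z' j - M.φ k z j))
      (fun i => integrable_const _) (fun i j => i2 i j z) x fun i j => x i * w j]
    simp
  simp only [e3]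
  rw [integral_sum_add_sum (fun i => (b1 i).integrable _) (fun i j => (b3 i j).integrable _) x
    fun i j => x i * w j, dotProduct]
  refine Finset.sum_congr rfl fun i _ => ?_
  simp only [Pi.add_apply, Matrix.mulVec, dotProduct, mul_add, Finset.mul_sum]
  congr 1
  refine Finset.sum_congr rfl fun j _ => ?_
  rw [tdA]
  simp only [chain, Kernel.comap_apply]
  ring

/-- Definiteness makes the TD matrix injective, hence invertible. The matrix inverse in `wstar` is
then a genuine inverse rather than the default value 0. -/
theorem tdb_eq {lamA : ℝ} (h : M.Solvable lamA) (hl : 0 < lamA) (k : Fin K) (θ : Vec p) :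
    M.tdb k θ = -(M.tdA k θ).mulVec (M.wstar k θ) := by
  have hinj : Function.Injective (M.tdA k θ).mulVec := by
    intro x y hxy
    have h1 := h k θ (x - y)
    have hxy' : (M.tdA k θ).mulVec x = (M.tdA k θ).mulVec y := hxy
    rw [Matrix.mulVec_sub, hxy', sub_self, dotProduct_zero] at h1
    have h2 : 0 ≤ dotProduct (x - y) (x - y) := Finset.sum_nonneg fun i _ => mul_self_nonneg _
    exact sub_eq_zero.1 (dotProduct_self_eq_zero.1 (by nlinarith))
  have hu : IsUnit (M.tdA k θ) := Matrix.mulVec_injective_iff_isUnit.1 hinj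
  have hdet := (Matrix.isUnit_iff_isUnit_det _).1 hu
  simp only [wstar]
  rw [Matrix.mulVec_neg, neg_neg, Matrix.mulVec_mulVec, Matrix.mul_nonsing_inv _ hdet,
    Matrix.one_mulVec]

/-- Since b = -A w*, the mean direction is A(w - w*), and definiteness is exactly the drift the
recursion needs. -/
theorem integral_tdDir_le {lamA : ℝ} (hS : M.Smooth Cφ Cπ Lφ) (h : M.Solvable lamA)
    (hl : 0 < lamA) (k : Fin K) (θ : Vec p) (w : Vec m) :
    ∫ z, (∫ z', ⟪M.tdDir k ((z, w), z'), w - M.wstar k θ⟫ ∂M.chain k θ z) ∂M.visit k θ ≤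
      -lamA * ‖w - M.wstar k θ‖ ^ 2 := by
  rw [integral_tdDir hS, tdb_eq h hl, neg_add_eq_sub, ← Matrix.mulVec_sub]
  have h1 := h k θ (w - M.wstar k θ)
  refine h1.trans (le_of_eq ?_)
  rw [EuclideanSpace.real_norm_sq_eq, dotProduct]
  simp [pow_two]

theorem criticIter_recursion {B : ℝ} (lamA : ℝ) (hB : 0 ≤ B) (k : Fin K) (θ : Vec p) (w : Vec m)
    (hw : ‖w‖ ≤ B) :
    MarkovRecursion (M.chain k θ) (fun j x => nearest (Metric.closedBall 0 B)
      (x.1.2 + (1 / (2 * lamA * (j + 1)) : ℝ) • M.tdDir k x))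
      (fun j => M.criticIter B lamA k j (θ, w)) B where
  prob j := inferInstance
  meas j := (continuous_nearest Metric.isClosed_closedBall
    (convex_closedBall _ _)).measurable.comp
      (measurable_fst.snd.add ((measurable_tdDir k).fun_const_smul _))
  ball j := by
    have hm : MeasurableSet {y : (S × A) × Vec m | ‖y.2‖ ≤ B} :=
      measurableSet_le measurable_snd.norm measurable_const
    cases j with
    | zero =>
      rw [criticIter, Kernel.prod_apply, Kernel.deterministic_apply, Measure.prod_dirac,
        ae_map_iff (by fun_prop) hm]
      exact Filter.Eventually.of_forall fun _ => hw
    | succ j =>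
      rw [criticIter, Kernel.map_apply _ (M.measurable_tdUpdate B _ k),
        ae_map_iff (M.measurable_tdUpdate B _ k).aemeasurable hm]
      exact Filter.Eventually.of_forall fun x => mem_closedBall_zero_iff.1
        (nearest_spec ⟨0, Metric.mem_closedBall_self hB⟩ Metric.isClosed_closedBall
          (convex_closedBall _ _) _).1
  step j F b hF := by
    have hm := M.measurable_tdUpdate B (1 / (2 * lamA * (j + 1))) k
    rw [criticIter, Kernel.map_apply _ hm, integral_map hm.aemeasurable
      hF.meas.aestronglyMeasurable, ProbabilityTheory.integral_compProd
      ((hF.comp hm).integrable ((M.criticIter B lamA k j ⊗ₖ (M.next k).comap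
          (fun x : (Vec p × Vec m) × ((S × A) × Vec m) => (x.1.1, x.2.1)) (by fun_prop)) (θ, w)))]
    simp only [tdUpdate, tdDir, smul_smul]
    rfl

/-- The mean square error of the critic. -/
theorem critic_error {κ ρ lamA B : ℝ} (hS : M.Smooth Cφ Cπ Lφ) (hE : M.UniformlyErgodic κ ρ)
    (hA : M.Solvable lamA) (hC : 0 ≤ Cφ) (hκ : 0 ≤ κ) (hρ0 : 0 ≤ ρ) (hρ1 : ρ < 1)
    (hlamA : 0 < lamA) (hB : 0 ≤ B) (k : Fin K) (θ : Vec p) (w : Vec m) (hw : ‖w‖ ≤ B)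
    (hst : ‖M.wstar k θ‖ ≤ B) (N : ℕ) (hN : 1 ≤ N) :
    ∫ y, ‖y.2 - M.wstar k θ‖ ^ 2 ∂M.criticIter B lamA k N (θ, w) ≤
      criticConst κ ρ lamA B ((1 + 2 * (Cφ * B)) * Cφ) (2 * Cφ ^ 2) / √(N : ℝ) :=
  projected_markov_recursion (mixing_chain hE k θ) hκ hρ0 hρ1 hlamA hB (by positivity)
    (by positivity) (measurable_tdDir k) (fun y z' hy => norm_tdDir_le hS k y z' hy)
    (fun z z' w w' => tdDir_lip hS k z z' w w')
    (criticIter_recursion lamA hB k θ w hw) hst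
    (fun w _ => integral_tdDir_le hS hA hlamA k θ w) N hN

end Model

/-- The second moment of the mean of `N` independent copies of a bounded random vector. -/
theorem integral_norm_sq_mean_le {Ω : Type*} [MeasurableSpace Ω] {μ : Measure Ω}
    [IsProbabilityMeasure μ] {p : ℕ} {X : Ω → Vec p} {R : ℝ} (hX : Measurable X)
    (hR : ∀ ω, ‖X ω‖ ≤ R) {N : ℕ} (hN : 1 ≤ N) :
    ∫ ω, ‖(N : ℝ)⁻¹ • ∑ l, X (ω l)‖ ^ 2 ∂Measure.pi (fun _ : Fin N => μ) ≤
      ‖∫ ω, X ω ∂μ‖ ^ 2 + R ^ 2 / N := by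
  set P := Measure.pi (fun _ : Fin N => μ) with hP
  have hN0 : (0 : ℝ) < N := by exact_mod_cast hN
  obtain ⟨ω₀⟩ := nonempty_of_isProbabilityMeasure μ
  have hR0 : 0 ≤ R := (norm_nonneg _).trans (hR ω₀)
  have hi : Integrable X μ := Integrable.of_bound hX.aestronglyMeasurable R
    (Filter.Eventually.of_forall hR)
  have hm : ∀ i, Measurable fun ω => X ω i := fun i =>
    (EuclideanSpace.proj (𝕜 := ℝ) i).continuous.measurable.comp hX
  have hb : ∀ i ω, ‖X ω i‖ ≤ R := fun i ω => (PiLp.norm_apply_le _ i).trans (hR ω)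
  have hl : ∀ i, MemLp (fun ω => X ω i) 2 μ := fun i =>
    MemLp.of_bound (hm i).aestronglyMeasurable R (Filter.Eventually.of_forall (hb i))
  have hme : ∀ i l, Measurable fun ω : Fin N → Ω => X (ω l) i := fun i l =>
    (hm i).comp (measurable_pi_apply l)
  have hle : ∀ i l, MemLp (fun ω : Fin N → Ω => X (ω l) i) 2 P := fun i l =>
    MemLp.of_bound (hme i l).aestronglyMeasurable R (Filter.Eventually.of_forall fun ω => hb i _)
  have hsm : ∀ i, Measurable fun ω : Fin N → Ω => (N : ℝ)⁻¹ * ∑ l, X (ω l) i := fun i =>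
    (Finset.measurable_sum _ fun l _ => hme i l).const_mul _
  have hsl : ∀ i, MemLp (fun ω : Fin N → Ω => (N : ℝ)⁻¹ * ∑ l, X (ω l) i) 2 P := fun i =>
    (memLp_finsetSum _ fun l _ => hle i l).const_mul _
  -- Working by coordinates allows the scalar variance of a sum of independent variables to be used,
  -- with each variance bounded by the second moment.
  have hcoord : ∀ i, ∫ ω, ((N : ℝ)⁻¹ * ∑ l, X (ω l) i) ^ 2 ∂P ≤
      ((∫ ω, X ω ∂μ) i) ^ 2 + (N : ℝ)⁻¹ * ∫ ω, (X ω i) ^ 2 ∂μ := by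
    intro i
    have hmean : ∫ ω, (N : ℝ)⁻¹ * ∑ l, X (ω l) i ∂P = (∫ ω, X ω ∂μ) i := by
      rw [integral_const_mul, integral_finsetSum _ fun l _ => (hle i l).integrable one_le_two]
      have : ∀ l : Fin N, ∫ ω, X (ω l) i ∂P = (∫ ω, X ω ∂μ) i := fun l => by
        rw [hP, integral_comp_eval (μ := fun _ : Fin N => μ) (i := l) (f := fun ω => X ω i)
          (hm i).aestronglyMeasurable]
        exact ((EuclideanSpace.proj (𝕜 := ℝ) i).integral_comp_comm hi)
      simp only [this, Finset.sum_const, Finset.card_univ, Fintype.card_fin, nsmul_eq_mul]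
      field_simp
    have hvar := variance_eq_sub (hsl i)
    rw [hmean] at hvar
    have hind : iIndepFun (fun l (ω : Fin N → Ω) => X (ω l) i) P :=
      iIndepFun_pi (μ := fun _ : Fin N => μ) (X := fun _ ω => X ω i) fun _ => (hm i).aemeasurable
    have hvs := IndepFun.variance_sum (μ := P) (s := Finset.univ) (fun l _ => hle i l)
      (fun l _ l' _ hll => hind.indepFun hll)
    have hv : variance (fun ω : Fin N → Ω => (N : ℝ)⁻¹ * ∑ l, X (ω l) i) P ≤
        (N : ℝ)⁻¹ * ∫ ω, (X ω i) ^ 2 ∂μ := by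
      rw [variance_const_mul]
      have e : (fun ω : Fin N → Ω => ∑ l, X (ω l) i) =
          ∑ l, fun ω : Fin N → Ω => X (ω l) i := by funext ω; simp
      rw [e, hvs]
      have h1 : ∀ l : Fin N, variance (fun ω : Fin N → Ω => X (ω l) i) P ≤
          ∫ ω, (X ω i) ^ 2 ∂μ := fun l => by
        refine (variance_le_expectation_sq (hme i l).aestronglyMeasurable).trans (le_of_eq ?_)
        exact integral_comp_eval (μ := fun _ : Fin N => μ) (i := l) (f := fun ω => (X ω i) ^ 2)
          ((hm i).pow_const 2).aestronglyMeasurable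
      calc ((N : ℝ)⁻¹) ^ 2 * ∑ l, variance (fun ω : Fin N → Ω => X (ω l) i) P
          ≤ ((N : ℝ)⁻¹) ^ 2 * ∑ _l : Fin N, ∫ ω, (X ω i) ^ 2 ∂μ :=
            mul_le_mul_of_nonneg_left (Finset.sum_le_sum fun l _ => h1 l) (by positivity)
        _ = _ := by
            simp only [Finset.sum_const, Finset.card_univ, Fintype.card_fin, nsmul_eq_mul]
            field_simp
    have e2 : ∫ ω, ((N : ℝ)⁻¹ * ∑ l, X (ω l) i) ^ 2 ∂P =
        P[(fun ω : Fin N → Ω => (N : ℝ)⁻¹ * ∑ l, X (ω l) i) ^ 2] := rfl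
    rw [e2]
    linarith
  have e3 : ∀ ω : Fin N → Ω, ‖(N : ℝ)⁻¹ • ∑ l, X (ω l)‖ ^ 2 =
      ∑ i, ((N : ℝ)⁻¹ * ∑ l, X (ω l) i) ^ 2 := fun ω => by
    rw [EuclideanSpace.real_norm_sq_eq]
    refine Finset.sum_congr rfl fun i _ => ?_
    simp
  simp only [e3]
  rw [integral_finsetSum _ fun i _ => (hsl i).integrable_sq]
  refine (Finset.sum_le_sum fun i _ => hcoord i).trans ?_
  rw [Finset.sum_add_distrib, ← EuclideanSpace.real_norm_sq_eq, ← Finset.mul_sum,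
    ← integral_finsetSum _ fun i _ => (hl i).integrable_sq]
  simp only [← EuclideanSpace.real_norm_sq_eq]
  have h4 := norm_integral_le_of_norm_le_const (μ := μ) (f := fun ω => ‖X ω‖ ^ 2) (C := R ^ 2)
    (Filter.Eventually.of_forall fun ω => by
      rw [Real.norm_of_nonneg (by positivity)]
      exact pow_le_pow_left₀ (norm_nonneg _) (hR ω) 2)
  rw [probReal_univ, mul_one] at h4
  have h5 := mul_le_mul_of_nonneg_left ((le_abs_self _).trans h4)
    (by positivity : 0 ≤ (N : ℝ)⁻¹)
  rw [div_eq_inv_mul]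
  linarith

namespace Model

variable {S A : Type*} [MeasurableSpace S] [MeasurableSpace A] {K p m : ℕ} {M : Model S A K p m}
  {Cφ Cπ Lφ B : ℝ}

/-! ### The mean gradient estimates -/

variable (M) in
/-- The mean `G_k` of the gradient estimate of task `k` with critic parameter `w`. -/
noncomputable def meanGrad (θ : Vec p) (w : Fin K → Vec m) (k : Fin K) : Vec p :=
  ∫ z, ⟪M.φ k z, w k⟫ • M.score θ z ∂M.visit k θ

variable (M) in
/-- The weighted mean gradient `λ ↦ ∑ₖ λₖ Gₖ`. -/
noncomputable def meanGradMap (θ : Vec p) (w : Fin K → Vec m) : Vec K →L[ℝ] Vec p :=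
  ∑ k, (EuclideanSpace.proj (𝕜 := ℝ) k).smulRight (M.meanGrad θ w k)

theorem meanGradMap_apply (θ : Vec p) (w : Fin K → Vec m) (l : Vec K) :
    M.meanGradMap θ w l = ∑ k, l k • M.meanGrad θ w k := by
  simp [meanGradMap]

theorem bddMeas_value (h : M.Smooth Cφ Cπ Lφ) (hC : 0 ≤ Cφ) {w : Fin K → Vec m}
    (hw : ∀ k, ‖w k‖ ≤ B) (k : Fin K) : BddMeas (fun z => ⟪M.φ k z, w k⟫) (Cφ * B) :=
  ⟨(M.φ_meas k).inner_const, fun z => (abs_real_inner_le_norm _ _).trans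
    (mul_le_mul (h.feature_le k z) (hw k) (norm_nonneg _) hC)⟩

theorem norm_gradEst_le (h : M.Smooth Cφ Cπ Lφ) (hC : 0 ≤ Cφ) {w : Fin K → Vec m}
    (hw : ∀ k, ‖w k‖ ≤ B) (θ : Vec p) (z : Fin K → S × A) (k : Fin K) :
    ‖M.gradEst θ w z k‖ ≤ Cφ * B * Cφ := by
  rw [gradEst, norm_smul, Real.norm_eq_abs]
  have h1 := (bddMeas_value h hC hw k).bound (z k)
  exact mul_le_mul h1 (h.score_le _ _) (norm_nonneg _) ((abs_nonneg _).trans h1)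

theorem norm_weighted_le {l : Vec K} (hl : l ∈ simplex K) {x : Fin K → Vec p} {R : ℝ}
    (hx : ∀ k, ‖x k‖ ≤ R) : ‖∑ k, l k • x k‖ ≤ R := by
  calc ‖∑ k, l k • x k‖ ≤ ∑ k, ‖l k • x k‖ := norm_sum_le _ _
    _ ≤ ∑ k, l k * R := Finset.sum_le_sum fun k _ => by
        rw [norm_smul, Real.norm_of_nonneg (hl.1 k)]
        exact mul_le_mul_of_nonneg_left (hx k) (hl.1 k)
    _ = R := by rw [← Finset.sum_mul, hl.2, one_mul]

theorem measurable_weightedEst (θ : Vec p) (w : Fin K → Vec m) (l : Vec K) :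
    Measurable fun z : Fin K → S × A => ∑ k, l k • M.gradEst θ w z k :=
  Finset.measurable_sum _ fun k _ => (M.measurable_gradEst measurable_const measurable_const
    measurable_id k).fun_const_smul _

theorem integrable_gradEst (h : M.Smooth Cφ Cπ Lφ) (hC : 0 ≤ Cφ) {w : Fin K → Vec m}
    (hw : ∀ k, ‖w k‖ ≤ B) (θ : Vec p) (k : Fin K) :
    Integrable (fun z => M.gradEst θ w z k) (M.sample θ) :=
  Integrable.of_bound (M.measurable_gradEst measurable_const measurable_const
    measurable_id k).aestronglyMeasurable (Cφ * B * Cφ)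
    (Filter.Eventually.of_forall fun z => norm_gradEst_le h hC hw θ z k)

theorem integrable_weightedEst (h : M.Smooth Cφ Cπ Lφ) (hC : 0 ≤ Cφ) {w : Fin K → Vec m}
    (hw : ∀ k, ‖w k‖ ≤ B) (θ : Vec p) (l : Vec K) :
    Integrable (fun z => ∑ k, l k • M.gradEst θ w z k) (M.sample θ) :=
  integrable_finsetSum _ fun k _ => (integrable_gradEst h hC hw θ k).fun_smul _

theorem integral_weightedEst (h : M.Smooth Cφ Cπ Lφ) (hC : 0 ≤ Cφ) {w : Fin K → Vec m}
    (hw : ∀ k, ‖w k‖ ≤ B) (θ : Vec p) (l : Vec K) :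
    ∫ z, ∑ k, l k • M.gradEst θ w z k ∂M.sample θ = M.meanGradMap θ w l := by
  have hi : ∀ k, Integrable (fun z => l k • M.gradEst θ w z k) (M.sample θ) := fun k =>
    (integrable_gradEst h hC hw θ k).fun_smul _
  have hm : ∀ k, Measurable fun z => ⟪M.φ k z, w k⟫ • M.score θ z := fun k =>
    Measurable.smul (bddMeas_value h hC hw k).meas (measurable_score_right θ)
  rw [integral_finsetSum _ fun k _ => hi k, meanGradMap_apply]
  refine Finset.sum_congr rfl fun k _ => ?_
  rw [integral_smul]
  congr 1
  exact integral_comp_eval (μ := fun k => M.visit k θ) (i := k)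
    (f := fun z => ⟪M.φ k z, w k⟫ • M.score θ z)
    (hm k).aestronglyMeasurable

/-! ### The actor -/

theorem integral_actor {β : ℝ} {N : ℕ} {F : Vec p → ℝ} (hF : Measurable F) (x : State K p m) :
    ∫ η, F η ∂M.actor β N x = ∫ z, F (M.actorUpdate β x z)
      ∂Measure.pi (fun _ : Fin N => M.sample x.1) := by
  have hm := M.measurable_actorUpdate (K := K) (p := p) (m := m)
    (Ω := State K p m × (Fin N → Fin K → S × A)) β measurable_fst measurable_snd
  have hFm : Measurable fun y : State K p m × (Fin N → Fin K → S × A) =>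
      F (M.actorUpdate β y.1 y.2) := hF.comp hm
  rw [actor, Kernel.map_apply _ hm, integral_map hm.aemeasurable hF.aestronglyMeasurable,
    Kernel.prod_apply, Kernel.id_apply, Measure.dirac_prod,
    integral_map (by fun_prop) hFm.aestronglyMeasurable]
  rfl

/-- Averaging the ascent inequality over the samples: the linear term sees only their mean, the
quadratic one the second moment of a mean of N independent vectors. -/
theorem actor_ascent (h : M.Smooth Cφ Cπ Lφ) (hC : 0 ≤ Cφ) (hL : 0 ≤ Lφ) {β : ℝ}
    {N : ℕ} (hN : 1 ≤ N) (k : Fin K) {x : State K p m} (hw : ∀ k, ‖x.2.1 k‖ ≤ B)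
    (hl : x.2.2 ∈ simplex K) :
    M.J k x.1 + β * ⟪gradient (M.J k) x.1, M.meanGradMap x.1 x.2.1 x.2.2⟫ -
        M.LJ / 2 * β ^ 2 * (‖M.meanGradMap x.1 x.2.1 x.2.2‖ ^ 2 + (Cφ * B * Cφ) ^ 2 / N) ≤
      ∫ η, M.J k η ∂M.actor β N x := by
  have hcont : Continuous (M.J k) := continuous_iff_continuousAt.2 fun θ =>
    (hasGradientAt_J h hC hL k θ).hasFDerivAt.continuousAt
  have hJ : BddMeas (M.J k) (1 / (1 - M.γ)) := ⟨hcont.measurable, fun θ => by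
    rw [abs_of_nonneg (J_mem k θ).1]; exact (J_mem k θ).2⟩
  set P := Measure.pi (fun _ : Fin N => M.sample x.1) with hP
  set X : (Fin K → S × A) → Vec p := fun z => ∑ k, x.2.2 k • M.gradEst x.1 x.2.1 z k with hX
  have hXm : Measurable X := measurable_weightedEst x.1 x.2.1 x.2.2
  have hXb : ∀ z, ‖X z‖ ≤ Cφ * B * Cφ := fun z =>
    norm_weighted_le hl fun k => norm_gradEst_le h hC hw x.1 z k
  have hXi := integral_weightedEst h hC hw x.1 x.2.2
  set v := M.meanGradMap x.1 x.2.1 x.2.2 with hv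
  set Y : (Fin N → Fin K → S × A) → Vec p := fun z => (N : ℝ)⁻¹ • ∑ l, X (z l) with hY
  have hYm : Measurable Y := (Finset.measurable_sum _ fun l _ =>
    hXm.comp (measurable_pi_apply l)).fun_const_smul _
  have hN0 : (0 : ℝ) < N := by exact_mod_cast hN
  have hYb : ∀ z, ‖Y z‖ ≤ Cφ * B * Cφ := fun z => by
    rw [hY, norm_smul, Real.norm_of_nonneg (by positivity), inv_mul_le_iff₀ hN0]
    refine (norm_sum_le _ _).trans ((Finset.sum_le_sum fun l _ => hXb (z l)).trans ?_)
    simp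
  have hup : ∀ z, M.actorUpdate β x z = x.1 + β • Y z := fun z => by
    rw [actorUpdate]
    congr 2
    simp only [hY, hX]
    rw [Finset.sum_comm, Finset.smul_sum]
    refine Finset.sum_congr rfl fun k _ => ?_
    rw [smul_comm, Finset.smul_sum]
  have hYi : Integrable Y P := Integrable.of_bound hYm.aestronglyMeasurable _
    (Filter.Eventually.of_forall hYb)
  have hYmean : ∫ z, Y z ∂P = v := by
    simp only [hY]
    have hi : ∀ l : Fin N, Integrable (fun z : Fin N → Fin K → S × A => X (z l)) P := fun l =>
      Integrable.of_bound (hXm.comp (measurable_pi_apply l)).aestronglyMeasurable _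
        (Filter.Eventually.of_forall fun z => hXb (z l))
    rw [integral_smul, integral_finsetSum _ fun l _ => hi l]
    have : ∀ l : Fin N, ∫ z, X (z l) ∂P = v := fun l => by
      rw [hP, integral_comp_eval (μ := fun _ : Fin N => M.sample x.1) (i := l) (f := X)
        hXm.aestronglyMeasurable, ← hXi]
    simp only [this, Finset.sum_const, Finset.card_univ, Fintype.card_fin]
    rw [← Nat.cast_smul_eq_nsmul ℝ, smul_smul, inv_mul_cancel₀ hN0.ne', one_smul]
  have hYsq := integral_norm_sq_mean_le (μ := M.sample x.1) hXm hXb hN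
  rw [hXi] at hYsq
  rw [integral_actor hJ.meas]
  have hpt : ∀ z, (M.J k x.1 + β * ⟪gradient (M.J k) x.1, Y z⟫) + -(M.LJ / 2 * β ^ 2) * ‖Y z‖ ^ 2
      ≤ M.J k (M.actorUpdate β x z) := fun z => by
    rw [hup]
    have := J_descent h hC hL k x.1 (x.1 + β • Y z)
    rw [add_sub_cancel_left, inner_smul_right, norm_smul, mul_pow, Real.norm_eq_abs, sq_abs] at this
    linarith
  have i1 : Integrable (fun z => ⟪gradient (M.J k) x.1, Y z⟫) P := hYi.const_inner _
  have i2 : Integrable (fun z => ‖Y z‖ ^ 2) P := Integrable.of_bound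
    (hYm.norm.pow_const 2).aestronglyMeasurable ((Cφ * B * Cφ) ^ 2)
    (Filter.Eventually.of_forall fun z => by
      rw [Real.norm_of_nonneg (by positivity)]
      exact pow_le_pow_left₀ (norm_nonneg _) (hYb z) 2)
  have i3 : Integrable (fun z => M.J k x.1 + β * ⟪gradient (M.J k) x.1, Y z⟫) P :=
    (integrable_const _).add (i1.const_mul β)
  have i4 : Integrable (fun z => -(M.LJ / 2 * β ^ 2) * ‖Y z‖ ^ 2) P := i2.const_mul _
  have i5 : Integrable (fun z => M.J k (M.actorUpdate β x z)) P :=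
    (hJ.comp (M.measurable_actorUpdate β measurable_const measurable_id)).integrable _
  have h1 := integral_mono (i3.add i4) i5 hpt
  rw [integral_add' i3 i4, integral_add (integrable_const _) (i1.const_mul β),
    integral_const_mul, integral_const_mul, integral_const, probReal_univ, one_smul,
    integral_inner hYi, hYmean] at h1
  have h2 : M.LJ / 2 * β ^ 2 * ∫ z, ‖Y z‖ ^ 2 ∂P ≤
      M.LJ / 2 * β ^ 2 * (‖v‖ ^ 2 + (Cφ * B * Cφ) ^ 2 / N) :=
    mul_le_mul_of_nonneg_left hYsq (by have := (LJ_spec h hC hL).1; positivity)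
  linarith

end Model
namespace Model

variable {S A : Type*} [MeasurableSpace S] [MeasurableSpace A] {K p m : ℕ} {M : Model S A K p m}
  {Cφ Cπ Lφ B : ℝ}

/-! ### The conflict-avoidant weights -/

theorem norm_le_sum_abs {n : ℕ} (x : Vec n) : ‖x‖ ≤ ∑ i, |x i| := by
  have h0 : 0 ≤ ∑ i, |x i| := Finset.sum_nonneg fun i _ => abs_nonneg _
  refine (sq_le_sq₀ (norm_nonneg _) h0).1 ?_
  rw [EuclideanSpace.real_norm_sq_eq]
  refine le_trans (Finset.sum_le_sum fun i _ => (sq_abs (x i)).ge) ?_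
  exact Finset.sum_sq_le_sq_sum_of_nonneg fun i _ => abs_nonneg _

theorem sum_abs_le {n : ℕ} (x : Vec n) : ∑ i, |x i| ≤ n * ‖x‖ := by
  calc ∑ i, |x i| ≤ ∑ _i : Fin n, ‖x‖ := Finset.sum_le_sum fun i _ => by
        rw [← Real.norm_eq_abs]; exact PiLp.norm_apply_le _ i
    _ = n * ‖x‖ := by simp

theorem norm_le_one_of_mem_simplex {l : Vec K} (hl : l ∈ simplex K) : ‖l‖ ≤ 1 := by
  refine (norm_le_sum_abs l).trans (le_of_eq ?_)
  rw [← hl.2]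
  exact Finset.sum_congr rfl fun k _ => abs_of_nonneg (hl.1 k)

theorem single_mem_simplex (k : Fin K) : EuclideanSpace.single k (1 : ℝ) ∈ simplex K := by
  refine ⟨fun j => ?_, ?_⟩
  · by_cases h : j = k <;> simp [h]
  · simp

theorem isCompact_simplex (K : ℕ) : IsCompact (simplex K) :=
  Metric.isCompact_of_isClosed_isBounded (isClosed_simplex K)
    ((Metric.isBounded_closedBall (x := (0 : Vec K)) (r := 1)).subset fun _ hl =>
      mem_closedBall_zero_iff.2 (norm_le_one_of_mem_simplex hl))

variable (M) in
/-- The stochastic gradient of the weights. -/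
noncomputable def weightGrad (θ : Vec p) (w : Fin K → Vec m)
    (ω : (Fin K → S × A) × (Fin K → S × A)) (l : Vec K) : Vec K :=
  WithLp.toLp 2 fun k => ⟪∑ j, l j • M.gradEst θ w ω.1 j, M.gradEst θ w ω.2 k⟫

theorem weightGrad_sub (θ : Vec p) (w : Fin K → Vec m)
    (ω : (Fin K → S × A) × (Fin K → S × A)) (l l' : Vec K) :
    M.weightGrad θ w ω l - M.weightGrad θ w ω l' = M.weightGrad θ w ω (l - l') := by
  ext k
  simp [weightGrad, sub_smul, Finset.sum_sub_distrib, inner_sub_left]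

theorem inner_weightGrad (θ : Vec p) (w : Fin K → Vec m)
    (ω : (Fin K → S × A) × (Fin K → S × A)) (l y : Vec K) :
    ⟪M.weightGrad θ w ω l, y⟫ =
      ⟪∑ j, l j • M.gradEst θ w ω.1 j, ∑ k, y k • M.gradEst θ w ω.2 k⟫ := by
  rw [inner_sum]
  simp only [PiLp.inner_apply, RCLike.inner_apply, conj_trivial, inner_smul_right, weightGrad]

theorem norm_weightGrad_le (h : M.Smooth Cφ Cπ Lφ) (hC : 0 ≤ Cφ) {w : Fin K → Vec m}
    (hw : ∀ k, ‖w k‖ ≤ B) (θ : Vec p) (ω : (Fin K → S × A) × (Fin K → S × A)) (l : Vec K) :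
    ‖M.weightGrad θ w ω l‖ ≤ K * ((∑ j, |l j|) * (Cφ * B * Cφ) ^ 2) := by
  have hg := norm_gradEst_le h hC hw θ
  have hs : ‖∑ j, l j • M.gradEst θ w ω.1 j‖ ≤ (∑ j, |l j|) * (Cφ * B * Cφ) := by
    rw [Finset.sum_mul]
    refine (norm_sum_le _ _).trans (Finset.sum_le_sum fun j _ => ?_)
    rw [norm_smul, Real.norm_eq_abs]
    exact mul_le_mul_of_nonneg_left (hg ω.1 j) (abs_nonneg _)
  refine (norm_le_sum_abs _).trans ?_
  calc ∑ k, |M.weightGrad θ w ω l k| ≤ ∑ _k : Fin K, (∑ j, |l j|) * (Cφ * B * Cφ) ^ 2 :=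
        Finset.sum_le_sum fun k _ => by
          refine (abs_real_inner_le_norm _ _).trans ?_
          rw [pow_two, ← mul_assoc]
          exact mul_le_mul hs (hg ω.2 k) (norm_nonneg _) ((norm_nonneg _).trans hs)
    _ = _ := by simp

/-- Independence of the two sample families makes the mean of the product factor into ⟨G x, G y⟩. A
single family would add its covariance. -/
theorem isGradEstimator (h : M.Smooth Cφ Cπ Lφ) (hC : 0 ≤ Cφ) {w : Fin K → Vec m}
    (hw : ∀ k, ‖w k‖ ≤ B) (θ : Vec p) (hne : (simplex K).Nonempty) :
    IsGradEstimator (simplex K) ((M.sample θ).prod (M.sample θ)) (M.weightGrad θ w)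
      (M.meanGradMap θ w) ((K : ℝ) ^ 2 * (Cφ * B * Cφ) ^ 2) where
  nonempty := hne
  closed := isClosed_simplex K
  convex := convex_simplex K
  diam x hx y hy := (norm_sub_le _ _).trans (by
    linarith [norm_le_one_of_mem_simplex hx, norm_le_one_of_mem_simplex hy])
  meas := by
    refine (PiLp.continuous_toLp 2 _).measurable.comp (measurable_pi_lambda _ fun k => ?_)
    refine Measurable.inner (Finset.measurable_sum _ fun j _ => ?_)
      (M.measurable_gradEst measurable_const measurable_const measurable_snd.snd k)
    exact ((EuclideanSpace.proj (𝕜 := ℝ) j).continuous.measurable.comp measurable_fst).smul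
      (M.measurable_gradEst measurable_const measurable_const measurable_snd.fst j)
  bound ω x hx := by
    refine (norm_weightGrad_le h hC hw θ ω x).trans ?_
    have h1 : ∑ j, |x j| = 1 := by
      rw [← hx.2]
      exact Finset.sum_congr rfl fun k _ => abs_of_nonneg (hx.1 k)
    -- The norm bound has a factor K and the Lipschitz bound a factor K². K ≥ 1 lets one constant
    -- serve for both.
    have hK : (1 : ℝ) ≤ K := by
      rcases Nat.eq_zero_or_pos K with rfl | hK
      · simp at h1
      · exact_mod_cast hK
    rw [h1, one_mul]
    exact mul_le_mul_of_nonneg_right (by nlinarith) (by positivity)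
  lip ω x hx y hy := by
    rw [weightGrad_sub]
    refine (norm_weightGrad_le h hC hw θ ω (x - y)).trans ?_
    have h1 := sum_abs_le (x - y)
    calc (K : ℝ) * ((∑ j, |(x - y) j|) * (Cφ * B * Cφ) ^ 2)
        ≤ K * ((K * ‖x - y‖) * (Cφ * B * Cφ) ^ 2) := by gcongr
      _ = _ := by ring
  mean x hx y := by
    simp only [inner_weightGrad]
    have ha := integrable_weightedEst h hC hw θ x
    have hb := integrable_weightedEst h hC hw θ y
    have hwe := integral_weightedEst h hC hw θ
    have hi : Integrable (fun ω : (Fin K → S × A) × (Fin K → S × A) =>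
        ⟪∑ j, x j • M.gradEst θ w ω.1 j, ∑ k, y k • M.gradEst θ w ω.2 k⟫)
        ((M.sample θ).prod (M.sample θ)) := by
      have hbd : ∀ (l : Vec K) z, ‖∑ j, l j • M.gradEst θ w z j‖ ≤
          (∑ j, |l j|) * (Cφ * B * Cφ) := fun l z => by
        rw [Finset.sum_mul]
        refine (norm_sum_le _ _).trans (Finset.sum_le_sum fun j _ => ?_)
        rw [norm_smul, Real.norm_eq_abs]
        exact mul_le_mul_of_nonneg_left (norm_gradEst_le h hC hw θ z j) (abs_nonneg _)
      refine Integrable.of_bound (((measurable_weightedEst θ w x).comp measurable_fst).inner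
        ((measurable_weightedEst θ w y).comp measurable_snd)).aestronglyMeasurable
        ((∑ j, |x j|) * (Cφ * B * Cφ) * ((∑ j, |y j|) * (Cφ * B * Cφ)))
        (Filter.Eventually.of_forall fun ω => (norm_inner_le_norm _ _).trans ?_)
      exact mul_le_mul (hbd x _) (hbd y _) (norm_nonneg _) ((norm_nonneg _).trans (hbd x ω.1))
    rw [integral_prod _ hi]
    have e1 : ∀ z, ∫ z', ⟪∑ j, x j • M.gradEst θ w z j, ∑ k, y k • M.gradEst θ w z' k⟫
        ∂M.sample θ = ⟪M.meanGradMap θ w y, ∑ j, x j • M.gradEst θ w z j⟫ := fun z => by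
      rw [integral_inner hb, hwe, real_inner_comm]
    simp only [e1]
    rw [integral_inner ha, hwe, real_inner_comm]

theorem caIter_eq_sgLaw (h : M.Smooth Cφ Cπ Lφ) (hC : 0 ≤ Cφ) {x : State K p m}
    (hw : ∀ k, ‖x.2.1 k‖ ≤ B) (hl : x.2.2 ∈ simplex K) (c : ℝ) (i : ℕ) :
    M.caIter c i x = sgLaw (simplex K) ((M.sample x.1).prod (M.sample x.1))
      (M.weightGrad x.1 x.2.1) (stepLen c) x.2.2 i := by
  have hg := isGradEstimator h hC hw x.1 ⟨_, hl⟩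
  induction i with
  | zero => rw [caIter, Kernel.deterministic_apply]; rfl
  | succ i ih =>
    have hm : Measurable fun y : State K p m × Vec K × (Fin K → S × A) × (Fin K → S × A) =>
        M.weightUpdate (c / √((i : ℝ) + 1)) y.1.1 y.1.2.1 y.2.2.1 y.2.2.2 y.2.1 :=
      M.measurable_weightUpdate _ measurable_fst.fst
        measurable_fst.snd.fst measurable_snd.snd.fst measurable_snd.snd.snd measurable_snd.fst
    rw [caIter, Kernel.map_apply _ hm, Kernel.prod_apply, Kernel.id_apply, Kernel.prod_apply,
      Kernel.prod_apply, Kernel.comap_apply, Measure.dirac_prod, Measure.map_map hm (by fun_prop),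
      ih]
    rfl

/-- The constant of `caIter_regret`. -/
noncomputable def caConst (c L : ℝ) : ℝ :=
  (3 * L + 4 / c) * √(Real.exp (8 * (c * L) ^ 2) * (32 * (4 + 12 * (c * L) ^ 2)
    + 136 * (c * L) ^ 2)) + 8 * c * L ^ 2

theorem caIter_mem (h : M.Smooth Cφ Cπ Lφ) (hC : 0 ≤ Cφ) {x : State K p m}
    (hw : ∀ k, ‖x.2.1 k‖ ≤ B) (hl : x.2.2 ∈ simplex K) (c : ℝ) (i : ℕ) :
    ∀ᵐ l ∂M.caIter c i x, l ∈ simplex K := by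
  rw [caIter_eq_sgLaw h hC hw hl]
  exact ((isGradEstimator h hC hw x.1 ⟨_, hl⟩).sgLaw_spec (stepLen c) hl i).2

theorem norm_meanGrad_le (h : M.Smooth Cφ Cπ Lφ) (hC : 0 ≤ Cφ) {w : Fin K → Vec m}
    (hw : ∀ k, ‖w k‖ ≤ B) (θ : Vec p) (k : Fin K) : ‖M.meanGrad θ w k‖ ≤ Cφ * B * Cφ :=
  norm_integral_smul_score_le h (bddMeas_value h hC hw k) θ _

theorem norm_meanGradMap_le (h : M.Smooth Cφ Cπ Lφ) (hC : 0 ≤ Cφ) {w : Fin K → Vec m}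
    (hw : ∀ k, ‖w k‖ ≤ B) (θ : Vec p) {l : Vec K} (hl : l ∈ simplex K) :
    ‖M.meanGradMap θ w l‖ ≤ Cφ * B * Cφ := by
  rw [meanGradMap_apply]
  exact norm_weighted_le hl fun k => norm_meanGrad_le h hC hw θ k

/-- After `N` steps of the weight recursion the mean update direction is almost an ascent
direction for each task. -/
theorem caIter_regret (h : M.Smooth Cφ Cπ Lφ) (hC : 0 ≤ Cφ) {x : State K p m}
    (hw : ∀ k, ‖x.2.1 k‖ ≤ B) (hl : x.2.2 ∈ simplex K) {c : ℝ} (hc : 0 < c) {N : ℕ} (hN : 1 ≤ N)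
    (k : Fin K) :
    ∫ l, (‖M.meanGradMap x.1 x.2.1 l‖ ^ 2 -
        ⟪M.meanGrad x.1 x.2.1 k, M.meanGradMap x.1 x.2.1 l⟫) ∂M.caIter c N x ≤
      caConst c ((K : ℝ) ^ 2 * (Cφ * B * Cφ) ^ 2) / √√(N : ℝ) := by
  have hg := isGradEstimator h hC hw x.1 ⟨_, hl⟩
  obtain ⟨z₀, hz₀, hmin⟩ := (isCompact_simplex K).exists_isMinOn ⟨_, hl⟩
    (M.meanGradMap x.1 x.2.1).continuous.norm.continuousOn
  have hr := hg.regret_last_le hc hl hz₀ (fun y hy => hmin hy) hN (single_mem_simplex k)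
  rw [caIter_eq_sgLaw h hC hw hl]
  refine le_trans (le_of_eq (integral_congr_ae (Filter.Eventually.of_forall fun l => ?_))) hr
  have e : M.meanGradMap x.1 x.2.1 (EuclideanSpace.single k (1 : ℝ)) = M.meanGrad x.1 x.2.1 k := by
    rw [meanGradMap_apply, Finset.sum_eq_single k]
    · simp
    · intro j _ hj; simp [hj]
    · simp
  simp only [map_sub, inner_sub_right, e, real_inner_self_eq_norm_sq]
  rw [real_inner_comm]

end Model
namespace Model

variable {S A : Type*} [MeasurableSpace S] [MeasurableSpace A] {K p m : ℕ} {M : Model S A K p m}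
  {Cφ Cπ Lφ B : ℝ}

/-! ### Bias of the critic -/

theorem bddMeas_wstar (h : M.Smooth Cφ Cπ Lφ) (hC : 0 ≤ Cφ)
    (hst : ∀ k θ, ‖M.wstar k θ‖ ≤ B) (k : Fin K) (θ : Vec p) :
    BddMeas (fun z => ⟪M.φ k z, M.wstar k θ⟫ - M.Q k θ z) (Cφ * B + 1 / (1 - M.γ)) :=
  (bddMeas_value h hC (w := fun k => M.wstar k θ) (fun k => hst k θ) k).sub (Q_bdd M k θ)

theorem approx_le (h : M.Smooth Cφ Cπ Lφ) (hC : 0 ≤ Cφ)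
    (hst : ∀ k θ, ‖M.wstar k θ‖ ≤ B) (k : Fin K) (θ : Vec p) :
    √(∫ z, (⟪M.φ k z, M.wstar k θ⟫ - M.Q k θ z) ^ 2 ∂(M.visit k θ)) ≤
      Cφ * B + 1 / (1 - M.γ) := by
  have hb := bddMeas_wstar h hC hst k θ
  obtain ⟨z₀⟩ := nonempty_of_isProbabilityMeasure (M.visit k θ)
  have h0 := (abs_nonneg _).trans (hb.bound z₀)
  rw [Real.sqrt_le_left h0]
  have h1 := (hb.mul hb).abs_integral_le (M.visit k θ)
  simp only [← pow_two] at h1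
  exact (le_abs_self _).trans h1

/-- A real supremum of an unbounded family defaults to 0, so `epsApp` controls each single error
only because these errors are uniformly bounded. -/
theorem epsApp_spec (h : M.Smooth Cφ Cπ Lφ) (hC : 0 ≤ Cφ)
    (hst : ∀ k θ, ‖M.wstar k θ‖ ≤ B) (k₀ : Fin K) :
    (∀ k θ, √(∫ z, (⟪M.φ k z, M.wstar k θ⟫ - M.Q k θ z) ^ 2 ∂(M.visit k θ)) ≤ M.epsApp) ∧
      0 ≤ M.epsApp ∧ M.epsApp ≤ Cφ * B + 1 / (1 - M.γ) := by
  have : Nonempty (Fin K) := ⟨k₀⟩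
  have hb := approx_le h hC hst
  have h1 : ∀ θ, BddAbove (Set.range fun k =>
      √(∫ z, (⟪M.φ k z, M.wstar k θ⟫ - M.Q k θ z) ^ 2 ∂(M.visit k θ))) := fun θ =>
    ⟨_, by rintro _ ⟨k, rfl⟩; exact hb k θ⟩
  have h2 : BddAbove (Set.range fun θ : Vec p => ⨆ k,
      √(∫ z, (⟪M.φ k z, M.wstar k θ⟫ - M.Q k θ z) ^ 2 ∂(M.visit k θ))) :=
    ⟨_, by rintro _ ⟨θ, rfl⟩; exact ciSup_le fun k => hb k θ⟩
  have h3 : ∀ k θ, √(∫ z, (⟪M.φ k z, M.wstar k θ⟫ - M.Q k θ z) ^ 2 ∂(M.visit k θ)) ≤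
      M.epsApp := fun k θ => (le_ciSup (h1 θ) k).trans (le_ciSup h2 θ)
  exact ⟨h3, (Real.sqrt_nonneg _).trans (h3 k₀ 0), ciSup_le fun θ => ciSup_le fun k => hb k θ⟩

/-- The value error splits into the distance of the critic from the TD limit and the approximation
error of that limit. Jensen passes from the mean absolute to the mean square approximation error. -/
theorem norm_meanGrad_sub_polGrad_sq_le (h : M.Smooth Cφ Cπ Lφ) (hC : 0 ≤ Cφ)
    (hst : ∀ k θ, ‖M.wstar k θ‖ ≤ B) {w : Fin K → Vec m}
    (hw : ∀ k, ‖w k‖ ≤ B) (θ : Vec p) (k : Fin K) :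
    ‖M.meanGrad θ w k - M.polGrad k θ‖ ^ 2 ≤
      2 * Cφ ^ 4 * ‖w k - M.wstar k θ‖ ^ 2 + 2 * Cφ ^ 2 * M.epsApp ^ 2 := by
  obtain ⟨he, he0, -⟩ := epsApp_spec h hC hst k
  have hv := bddMeas_value h hC hw k
  have hQ := Q_bdd M k θ
  have hd := bddMeas_wstar h hC hst k θ
  set D : S × A → ℝ := fun z => ⟪M.φ k z, M.wstar k θ⟫ - M.Q k θ z with hD
  have e : M.meanGrad θ w k - M.polGrad k θ =
      ∫ z, (⟪M.φ k z, w k⟫ - M.Q k θ z) • M.score θ z ∂M.visit k θ := by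
    rw [meanGrad, polGrad, ← integral_sub (integrable_smul_score h hv θ _)
      (integrable_smul_score h hQ θ _)]
    simp only [sub_smul]
  have hDa : BddMeas (fun z => |D z|) (Cφ * B + 1 / (1 - M.γ)) :=
    ⟨hd.meas.abs, fun z => by rw [abs_abs]; exact hd.bound z⟩
  have h1 : ‖M.meanGrad θ w k - M.polGrad k θ‖ ≤
      Cφ * (Cφ * ‖w k - M.wstar k θ‖ + ∫ z, |D z| ∂M.visit k θ) := by
    rw [e]
    have hi : Integrable (fun z => Cφ * (Cφ * ‖w k - M.wstar k θ‖ + |D z|)) (M.visit k θ) :=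
      ((integrable_const _).add (hDa.integrable _)).const_mul _
    refine (norm_integral_le_of_norm_le hi (Filter.Eventually.of_forall fun z => ?_)).trans
      (le_of_eq ?_)
    · have e2 : ⟪M.φ k z, w k⟫ - M.Q k θ z = ⟪M.φ k z, w k - M.wstar k θ⟫ + D z := by
        simp only [hD, inner_sub_right]; ring
      have h3 := (abs_real_inner_le_norm (M.φ k z) (w k - M.wstar k θ)).trans
        (mul_le_mul_of_nonneg_right (h.feature_le k z) (norm_nonneg _))
      rw [norm_smul, Real.norm_eq_abs, mul_comm, e2]
      exact mul_le_mul (h.score_le θ z) ((abs_add_le _ _).trans (by linarith)) (abs_nonneg _) hC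
    · rw [integral_const_mul, integral_add (integrable_const _) (hDa.integrable _)]
      simp
  have h2 : ∫ z, |D z| ∂M.visit k θ ≤ M.epsApp := by
    refine le_trans (Real.le_sqrt_of_sq_le ?_) (he k θ)
    have h4 := sq_integral_le (hDa.integrable (M.visit k θ)) (by
      have := (hDa.mul hDa).integrable (M.visit k θ)
      simpa only [← pow_two] using this)
    simpa only [sq_abs] using h4
  set x := ‖w k - M.wstar k θ‖
  have h5 : ‖M.meanGrad θ w k - M.polGrad k θ‖ ≤ Cφ * (Cφ * x + M.epsApp) :=
    h1.trans (mul_le_mul_of_nonneg_left (by linarith) hC)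
  have h6 := pow_le_pow_left₀ (norm_nonneg _) h5 2
  nlinarith [sq_nonneg (Cφ * (Cφ * x - M.epsApp))]

/-! ### The critic of all tasks -/

theorem critic_ball (lamA : ℝ) (hB : 0 ≤ B) (N : ℕ) (θ : Vec p) {w : Fin K → Vec m}
    (hw : ∀ k, ‖w k‖ ≤ B) : ∀ᵐ w' ∂M.critic B lamA N (θ, w), ∀ k, ‖w' k‖ ≤ B := by
  rw [ae_all_iff]
  intro k
  have h1 := (criticIter_recursion (M := M) lamA hB k θ (w k) (hw k)).ball N
  have h2 : ∀ᵐ v ∂(M.criticIter B lamA k N).snd (θ, w k), ‖v‖ ≤ B := by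
    rw [Kernel.snd_apply, ae_map_iff (by fun_prop)
      (measurableSet_le measurable_norm measurable_const)]
    exact h1
  exact (measurePreserving_eval (fun k => ((M.criticIter B lamA k N).snd.comap
    (fun x : Vec p × (Fin K → Vec m) => (x.1, x.2 k)) (by fun_prop)) (θ, w))
    k).quasiMeasurePreserving.ae h2

theorem critic_error_all {κ ρ lamA : ℝ} (hS : M.Smooth Cφ Cπ Lφ) (hE : M.UniformlyErgodic κ ρ)
    (hA : M.Solvable lamA) (hC : 0 ≤ Cφ) (hκ : 0 ≤ κ) (hρ0 : 0 ≤ ρ) (hρ1 : ρ < 1)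
    (hlamA : 0 < lamA) (hB : 0 ≤ B) (θ : Vec p) {w : Fin K → Vec m} (hw : ∀ k, ‖w k‖ ≤ B)
    (hst : ∀ k θ, ‖M.wstar k θ‖ ≤ B) {N : ℕ} (hN : 1 ≤ N) :
    Integrable (fun w' : Fin K → Vec m => ∑ k, ‖w' k - M.wstar k θ‖ ^ 2)
        (M.critic B lamA N (θ, w)) ∧
      ∫ w', ∑ k, ‖w' k - M.wstar k θ‖ ^ 2 ∂M.critic B lamA N (θ, w) ≤
        K * (criticConst κ ρ lamA B ((1 + 2 * (Cφ * B)) * Cφ) (2 * Cφ ^ 2) / √(N : ℝ)) := by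
  have hm : ∀ k, Measurable fun v : Vec m => ‖v - M.wstar k θ‖ ^ 2 := fun k =>
    (measurable_id.sub_const _).norm.pow_const 2
  have hi : ∀ k, Integrable (fun w' : Fin K → Vec m => ‖w' k - M.wstar k θ‖ ^ 2)
      (M.critic B lamA N (θ, w)) := fun k => by
    refine Integrable.of_bound ((hm k).comp (measurable_pi_apply k)).aestronglyMeasurable
      ((B + B) ^ 2) ?_
    filter_upwards [critic_ball (M := M) lamA hB N θ hw] with w' hw'
    rw [Real.norm_of_nonneg (by positivity)]
    exact pow_le_pow_left₀ (norm_nonneg _)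
      ((norm_sub_le _ _).trans (add_le_add (hw' k) (hst k θ))) 2
  refine ⟨integrable_finsetSum _ fun k _ => hi k, ?_⟩
  rw [integral_finsetSum _ fun k _ => hi k]
  refine (Finset.sum_le_sum (g := fun _ => criticConst κ ρ lamA B ((1 + 2 * (Cφ * B)) * Cφ)
    (2 * Cφ ^ 2) / √(N : ℝ)) fun k _ => ?_).trans (by simp)
  have h1 := critic_error hS hE hA hC hκ hρ0 hρ1 hlamA hB k θ (w k) (hw k) (hst k θ) N hN
  have h2 : ∫ w', ‖w' k - M.wstar k θ‖ ^ 2 ∂M.critic B lamA N (θ, w) =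
      ∫ v, ‖v - M.wstar k θ‖ ^ 2 ∂(M.criticIter B lamA k N).snd (θ, w k) :=
    integral_comp_eval (μ := fun k => ((M.criticIter B lamA k N).snd.comap
      (fun x : Vec p × (Fin K → Vec m) => (x.1, x.2 k)) (by fun_prop)) (θ, w)) (i := k)
      (f := fun v => ‖v - M.wstar k θ‖ ^ 2) (hm k).aestronglyMeasurable
  rw [h2, Kernel.snd_apply, integral_map (by fun_prop) (hm k).aestronglyMeasurable]
  exact h1

/-! ### One outer iteration -/

theorem bddMeas_J (h : M.Smooth Cφ Cπ Lφ) (hC : 0 ≤ Cφ) (hL : 0 ≤ Lφ) (k : Fin K) :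
    BddMeas (M.J k) (1 / (1 - M.γ)) := by
  have hcont : Continuous (M.J k) := continuous_iff_continuousAt.2 fun θ =>
    (hasGradientAt_J h hC hL k θ).hasFDerivAt.continuousAt
  exact ⟨hcont.measurable, fun θ => by rw [abs_of_nonneg (J_mem k θ).1]; exact (J_mem k θ).2⟩

/-- With a = ‖v‖ and q = a² - ⟨G_k, v⟩, the actor gains at least β(u(a² - q - √D a) - a²/2) minus
the sampling error, where u = 1/(1-γ). Averaging over the weights turns q into the CA regret. The
minimizing weight enters only through the inequality between its norm and that of any other weight.
-/
theorem weights_ascent (h : M.Smooth Cφ Cπ Lφ) (hC : 0 ≤ Cφ) (hL : 0 ≤ Lφ) {β c : ℝ}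
    (hβ : 0 < β) (hβL : β * M.LJ ≤ 1) (hc : 0 < c) {Na Nc : ℕ} (hNa : 1 ≤ Na) (hNc : 1 ≤ Nc)
    (k : Fin K) {x : State K p m} (hw : ∀ k, ‖x.2.1 k‖ ≤ B) (hl : x.2.2 ∈ simplex K) {D : ℝ}
    (hD : ∀ k, ‖M.meanGrad x.1 x.2.1 k - M.polGrad k x.1‖ ^ 2 ≤ D) {ls : Vec K}
    (hls : M.IsMinNormWeight x.1 ls) :
    M.J k x.1 + β * ((1 - M.γ) / 8 * ‖M.wgrad ls x.1‖ ^ 2 - 5 / 4 * (1 / (1 - M.γ)) * D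
        - 1 / (1 - M.γ) * (caConst c ((K : ℝ) ^ 2 * (Cφ * B * Cφ) ^ 2) / √√(Nc : ℝ))
        - M.LJ / 2 * β * ((Cφ * B * Cφ) ^ 2 / Na)) ≤
      ∫ l, (∫ η, M.J k η ∂M.actor β Na (x.1, x.2.1, l)) ∂M.caIter c Nc x := by
  have hγ0 := M.γ_nonneg
  have hγ1 := M.γ_lt_one
  set u := 1 / (1 - M.γ) with hu
  have hu1 : 1 ≤ u := by rw [hu, le_div_iff₀ (by linarith)]; linarith
  have huγ : 1 - M.γ = 1 / u := by rw [hu, one_div_one_div]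
  have hLJ := (LJ_spec h hC hL).1
  set Y := ‖M.wgrad ls x.1‖ ^ 2 with hY
  set R := Cφ * B * Cφ with hR
  set q : Vec K → ℝ := fun l => ‖M.meanGradMap x.1 x.2.1 l‖ ^ 2 -
    ⟪M.meanGrad x.1 x.2.1 k, M.meanGradMap x.1 x.2.1 l⟫ with hq
  have hD0 : 0 ≤ D := (by positivity : (0 : ℝ) ≤ _).trans (hD k)
  set e := √D with he
  have he0 : 0 ≤ e := Real.sqrt_nonneg D
  have hes : e ^ 2 = D := Real.sq_sqrt hD0
  have hde : ∀ k, ‖M.polGrad k x.1 - M.meanGrad x.1 x.2.1 k‖ ≤ e := fun k => by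
    rw [norm_sub_rev]; exact Real.le_sqrt_of_sq_le (hD k)
  have hpt : ∀ l ∈ simplex K, (M.J k x.1 + β * (Y / (8 * u) - 5 / 4 * u * D
      - M.LJ / 2 * β * (R ^ 2 / Na))) + -(β * u) * q l ≤
      ∫ η, M.J k η ∂M.actor β Na (x.1, x.2.1, l) := by
    intro l hl'
    refine le_trans ?_ (actor_ascent h hC hL hNa k (x := (x.1, x.2.1, l)) hw hl')
    simp only [gradient_J h hC hL, ← hu]
    set v := M.meanGradMap x.1 x.2.1 l with hv
    set a := ‖v‖ with ha
    have ha0 : 0 ≤ a := norm_nonneg v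
    have h1 : ⟪M.meanGrad x.1 x.2.1 k, v⟫ - e * a ≤ ⟪M.polGrad k x.1, v⟫ := by
      have h2 := abs_le.1 (abs_real_inner_le_norm (M.polGrad k x.1 - M.meanGrad x.1 x.2.1 k) v)
      have h3 := mul_le_mul_of_nonneg_right (hde k) ha0
      rw [inner_sub_left] at h2
      linarith
    -- The minimal weighted gradient is no larger than the one weighted by l, which differs from u v
    -- by at most u√D.
    have h4 : Y ≤ 2 * u ^ 2 * (a ^ 2 + D) := by
      have h5 : Y ≤ ‖M.wgrad l x.1‖ ^ 2 := hls.2 hl'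
      have h6 : M.wgrad l x.1 = u • (v + ∑ j, l j • (M.polGrad j x.1 - M.meanGrad x.1 x.2.1 j)) := by
        rw [wgrad, hv, meanGradMap_apply, ← Finset.sum_add_distrib, Finset.smul_sum]
        refine Finset.sum_congr rfl fun j _ => ?_
        rw [gradient_J h hC hL, ← smul_add, add_sub_cancel, smul_comm]
      have h7 : ‖M.wgrad l x.1‖ ≤ u * (a + e) := by
        rw [h6, norm_smul, Real.norm_of_nonneg (by linarith)]
        exact mul_le_mul_of_nonneg_left ((norm_add_le _ _).trans
          (add_le_add le_rfl (norm_weighted_le hl' hde))) (by linarith)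
      have h8 := pow_le_pow_left₀ (norm_nonneg _) h7 2
      have h9 : (a + e) ^ 2 ≤ 2 * (a ^ 2 + D) := by nlinarith [sq_nonneg (a - e)]
      have h10 := mul_le_mul_of_nonneg_left h9 (by positivity : 0 ≤ u ^ 2)
      nlinarith
    have h11 : Y / (8 * u) ≤ u / 4 * (a ^ 2 + D) := by
      rw [div_le_iff₀ (by linarith)]
      nlinarith
    -- The step-size condition is used here: the curvature loss costs at most half of the main gain,
    -- because u ≥ 1.
    have h12 : M.LJ / 2 * β ^ 2 * a ^ 2 ≤ β / 2 * a ^ 2 := by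
      have := mul_le_mul_of_nonneg_right hβL (by positivity : 0 ≤ β / 2 * a ^ 2)
      nlinarith
    have h13 : β * (u * (⟪M.meanGrad x.1 x.2.1 k, v⟫ - e * a)) ≤
        β * ⟪u • M.polGrad k x.1, v⟫ := by
      rw [inner_smul_left]
      exact mul_le_mul_of_nonneg_left (mul_le_mul_of_nonneg_left h1 (by linarith)) hβ.le
    have h14 : Y / (8 * u) - 5 / 4 * u * D - u * q l ≤
        u * (⟪M.meanGrad x.1 x.2.1 k, v⟫ - e * a) - 1 / 2 * a ^ 2 := by
      simp only [hq, ← hv, ← ha]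
      -- Young's inequality spends a further quarter of u a². The last quarter pays for Y/(8u) up to
      -- u D/4, whence the total 5/4 u D.
      have h15 : u * e * a ≤ u / 4 * a ^ 2 + u * D := by
        nlinarith [mul_nonneg (by linarith : 0 ≤ u) (sq_nonneg (a / 2 - e))]
      nlinarith
    have h16 := mul_le_mul_of_nonneg_left h14 hβ.le
    linarith
  have hmem := caIter_mem h hC hw hl c Nc
  have hqm : Measurable q := by
    have := (M.meanGradMap x.1 x.2.1).continuous.measurable
    exact (this.norm.pow_const 2).sub (measurable_const.inner this)
  have hqi : Integrable q (M.caIter c Nc x) := by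
    refine Integrable.of_bound hqm.aestronglyMeasurable (R ^ 2 + R * R) ?_
    filter_upwards [hmem] with l hl'
    have h1 := norm_meanGradMap_le h hC hw x.1 hl'
    have h2 := norm_meanGrad_le h hC hw x.1 k
    refine (norm_sub_le _ _).trans (add_le_add ?_ ?_)
    · rw [Real.norm_of_nonneg (by positivity)]
      exact pow_le_pow_left₀ (norm_nonneg _) h1 2
    · exact (norm_inner_le_norm _ _).trans (mul_le_mul h2 h1 (norm_nonneg _)
        ((norm_nonneg _).trans h2))
  have hJb : BddMeas (fun l => ∫ η, M.J k η ∂M.actor β Na (x.1, x.2.1, l)) u :=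
    ((bddMeas_J h hC hL k).kernel (M.actor β Na)).comp
      (by fun_prop : Measurable fun l : Vec K => ((x.1, x.2.1, l) : State K p m))
  have h1 := integral_mono_ae ((integrable_const _).add (hqi.const_mul (-(β * u))))
    (hJb.integrable _) (by filter_upwards [hmem] with l hl' using hpt l hl')
  rw [integral_add' (integrable_const _) (hqi.const_mul _), integral_const_mul, integral_const,
    probReal_univ, one_smul] at h1
  have h2 := mul_le_mul_of_nonneg_left (caIter_regret h hC hw hl hc hNc k)
    (by positivity : 0 ≤ β * u)
  refine le_trans ?_ h1
  rw [huγ]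
  have e3 : 1 / u / 8 * Y = Y / (8 * u) := by field_simp
  rw [e3]
  have h4 : ∫ l, q l ∂M.caIter c Nc x = ∫ l, (‖M.meanGradMap x.1 x.2.1 l‖ ^ 2 -
    ⟪M.meanGrad x.1 x.2.1 k, M.meanGradMap x.1 x.2.1 l⟫) ∂M.caIter c Nc x := rfl
  rw [h4]
  linarith

end Model
-- The potential argument along the run
namespace Model

variable {S A : Type*} [MeasurableSpace S] [MeasurableSpace A] {K p m : ℕ} {M : Model S A K p m}
  {Cφ Cπ Lφ B : ℝ}

theorem integral_outer {q : Params} {F : Vec p → ℝ} {b : ℝ} (hF : BddMeas F b)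
    (x : State K p m) :
    ∫ y, F y.1 ∂M.outer q x = ∫ w, (∫ l, (∫ η, F η ∂M.actor q.β q.Nactor (x.1, w, l))
      ∂M.caIter q.c q.NCA (x.1, w, x.2.2)) ∂M.critic q.B q.lamA q.Ncritic (x.1, x.2.1) := by
  have hm : Measurable fun y : ((Fin K → Vec m) × Vec K) × Vec p =>
      ((y.2, y.1.1, y.1.2) : State K p m) := by fun_prop
  have h1 : BddMeas (fun y : ((Fin K → Vec m) × Vec K) × Vec p => F y.2) b :=
    hF.comp measurable_snd
  have h2 := (hF.kernel (M.actor q.β q.Nactor)).comp (by fun_prop : Measurable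
    fun y : (Fin K → Vec m) × Vec K => ((x.1, y.1, y.2) : State K p m))
  have hFm : Measurable fun y : State K p m => F y.1 := hF.meas.comp measurable_fst
  rw [outer, Kernel.map_apply _ hm, integral_map hm.aemeasurable hFm.aestronglyMeasurable,
    ProbabilityTheory.integral_compProd (h1.integrable _)]
  simp only [Kernel.comap_apply]
  rw [ProbabilityTheory.integral_compProd (h2.integrable _)]
  rfl

theorem measurableSet_ball_simplex (B : ℝ) :
    MeasurableSet {y : (Fin K → Vec m) × Vec K | (∀ k, ‖y.1 k‖ ≤ B) ∧ y.2 ∈ simplex K} := by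
  have h1 : MeasurableSet {y : (Fin K → Vec m) × Vec K | ∀ k, ‖y.1 k‖ ≤ B} := by
    rw [Set.ofPred_forall]
    exact MeasurableSet.iInter fun k => measurableSet_le
      ((measurable_pi_apply k).comp measurable_fst).norm measurable_const
  exact h1.inter (measurable_snd (isClosed_simplex K).measurableSet)

theorem measurableSet_good (B : ℝ) :
    MeasurableSet {y : State K p m | (∀ k, ‖y.2.1 k‖ ≤ B) ∧ y.2.2 ∈ simplex K} :=
  measurable_snd (measurableSet_ball_simplex B)

theorem outer_good (h : M.Smooth Cφ Cπ Lφ) (hC : 0 ≤ Cφ) {q : Params} (hB : 0 ≤ q.B)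
    {x : State K p m} (hw : ∀ k, ‖x.2.1 k‖ ≤ q.B) (hl : x.2.2 ∈ simplex K) :
    ∀ᵐ y ∂M.outer q x, (∀ k, ‖y.2.1 k‖ ≤ q.B) ∧ y.2.2 ∈ simplex K := by
  have hm : Measurable fun y : ((Fin K → Vec m) × Vec K) × Vec p =>
      ((y.2, y.1.1, y.1.2) : State K p m) := by fun_prop
  have hg := measurableSet_good (K := K) (p := p) (m := m) q.B
  have hg2 := measurableSet_ball_simplex (K := K) (m := m) q.B
  have hg3 : MeasurableSet {z : ((Fin K → Vec m) × Vec K) × Vec p |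
      (∀ k, ‖z.1.1 k‖ ≤ q.B) ∧ z.1.2 ∈ simplex K} := 
    measurable_fst hg2
  rw [outer, Kernel.map_apply _ hm, ae_map_iff hm.aemeasurable hg]
  refine Kernel.ae_compProd_of_ae_ae hg3 ?_
  refine Filter.Eventually.mono (p := fun y : (Fin K → Vec m) × Vec K =>
    (∀ k, ‖y.1 k‖ ≤ q.B) ∧ y.2 ∈ simplex K) (Kernel.ae_compProd_of_ae_ae hg2 ?_)
    fun y hy => Filter.Eventually.of_forall fun _ => hy
  refine (critic_ball (M := M) q.lamA hB q.Ncritic x.1 hw).mono fun w hw' => ?_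
  exact (caIter_mem h hC (x := (x.1, w, x.2.2)) hw' hl q.c q.NCA).mono fun l hl' => ⟨hw', hl'⟩

theorem stateLaw_good (h : M.Smooth Cφ Cπ Lφ) (hC : 0 ≤ Cφ) {q : Params} (hB : 0 ≤ q.B)
    {x₀ : State K p m} (hw : ∀ k, ‖x₀.2.1 k‖ ≤ q.B) (hl : x₀.2.2 ∈ simplex K) (t : ℕ) :
    ∀ᵐ y ∂M.stateLaw q x₀ t, (∀ k, ‖y.2.1 k‖ ≤ q.B) ∧ y.2.2 ∈ simplex K := by
  induction t with
  | zero => exact (ae_dirac_iff (measurableSet_good q.B)).2 ⟨hw, hl⟩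
  | succ t ih =>
    refine Measure.ae_comp_of_ae_ae (measurableSet_good q.B) ?_
    filter_upwards [ih] with y hy
    exact outer_good h hC hB hy.1 hy.2

theorem integral_stateLaw_succ {q : Params} {F : State K p m → ℝ} {b : ℝ} (hF : BddMeas F b)
    (x₀ : State K p m) (t : ℕ) :
    ∫ y, F y ∂M.stateLaw q x₀ (t + 1) = ∫ x, (∫ y, F y ∂M.outer q x) ∂M.stateLaw q x₀ t := by
  have h1 := hF.integrable (M.stateLaw q x₀ (t + 1))
  rw [stateLaw, Measure.comp_eq_comp_const_apply] at h1 ⊢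
  rw [Kernel.integral_comp h1, Kernel.const_apply]

/-- The error of one outer iteration. -/
noncomputable def stepError (M : Model S A K p m) (Cφ κ ρ : ℝ) (q : Params) : ℝ :=
  5 / 4 * (1 / (1 - M.γ)) * (2 * Cφ ^ 4 *
      (K * (criticConst κ ρ q.lamA q.B ((1 + 2 * (Cφ * q.B)) * Cφ) (2 * Cφ ^ 2) /
        √(q.Ncritic : ℝ))) + 2 * Cφ ^ 2 * M.epsApp ^ 2) +
    1 / (1 - M.γ) * (caConst q.c ((K : ℝ) ^ 2 * (Cφ * q.B * Cφ) ^ 2) / √√(q.NCA : ℝ)) +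
    M.LJ / 2 * q.β * ((Cφ * q.B * Cφ) ^ 2 / q.Nactor)

/-- In `weights_ascent` the error D may depend on the critic output, and the bound is affine in it.
Averaging therefore involves only the mean square critic error, without a square root, and gives
1/√N_critic. -/
theorem outer_ascent {κ ρ : ℝ} {q : Params} (h : M.Smooth Cφ Cπ Lφ)
    (hE : M.UniformlyErgodic κ ρ) (hA : M.Solvable q.lamA) (hC : 0 ≤ Cφ) (hL : 0 ≤ Lφ)
    (hκ : 0 ≤ κ) (hρ0 : 0 ≤ ρ) (hρ1 : ρ < 1) (hlamA : 0 < q.lamA) (hB : 0 ≤ q.B)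
    (hst : ∀ k θ, ‖M.wstar k θ‖ ≤ q.B) (hβ : 0 < q.β) (hβL : q.β * M.LJ ≤ 1) (hc : 0 < q.c)
    (hNa : 1 ≤ q.Nactor) (hNc : 1 ≤ q.Ncritic) (hNCA : 1 ≤ q.NCA) (k : Fin K)
    {x : State K p m} (hw : ∀ k, ‖x.2.1 k‖ ≤ q.B) (hl : x.2.2 ∈ simplex K) {ls : Vec K}
    (hls : M.IsMinNormWeight x.1 ls) :
    M.J k x.1 + q.β * ((1 - M.γ) / 8 * ‖M.wgrad ls x.1‖ ^ 2 - M.stepError Cφ κ ρ q) ≤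
      ∫ y, M.J k y.1 ∂M.outer q x := by
  have hγ1 := M.γ_lt_one
  have hu0 : 0 < 1 / (1 - M.γ) := one_div_pos.2 (by linarith)
  have hJ := bddMeas_J h hC hL k
  rw [integral_outer hJ]
  obtain ⟨hi, hle⟩ := critic_error_all h hE hA hC hκ hρ0 hρ1 hlamA hB x.1 hw hst hNc
  set μ := M.critic q.B q.lamA q.Ncritic (x.1, x.2.1) with hμ
  set Dw : (Fin K → Vec m) → ℝ := fun w => ∑ k, ‖w k - M.wstar k x.1‖ ^ 2 with hDw
  set a : ℝ := M.J k x.1 + q.β * ((1 - M.γ) / 8 * ‖M.wgrad ls x.1‖ ^ 2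
        - 5 / 4 * (1 / (1 - M.γ)) * (2 * Cφ ^ 2 * M.epsApp ^ 2)
        - 1 / (1 - M.γ) * (caConst q.c ((K : ℝ) ^ 2 * (Cφ * q.B * Cφ) ^ 2) / √√(q.NCA : ℝ))
        - M.LJ / 2 * q.β * ((Cφ * q.B * Cφ) ^ 2 / q.Nactor)) with ha
  set b : ℝ := -(q.β * (5 / 4 * (1 / (1 - M.γ)) * (2 * Cφ ^ 4))) with hb
  have hpt : ∀ᵐ w ∂μ, a + b * Dw w ≤ ∫ l, (∫ η, M.J k η ∂M.actor q.β q.Nactor (x.1, w, l))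
      ∂M.caIter q.c q.NCA (x.1, w, x.2.2) := by
    filter_upwards [critic_ball (M := M) q.lamA hB q.Ncritic x.1 hw] with w hw'
    have h1 := weights_ascent h hC hL hβ hβL hc hNa hNCA k (x := (x.1, w, x.2.2)) hw' hl
      (D := 2 * Cφ ^ 4 * Dw w + 2 * Cφ ^ 2 * M.epsApp ^ 2) (fun j =>
        (norm_meanGrad_sub_polGrad_sq_le h hC hst hw' x.1 j).trans (by
          have h2 : ‖w j - M.wstar j x.1‖ ^ 2 ≤ Dw w :=
            Finset.single_le_sum (f := fun k => ‖w k - M.wstar k x.1‖ ^ 2)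
              (fun _ _ => by positivity) (Finset.mem_univ j)
          have := mul_le_mul_of_nonneg_left h2 (by positivity : 0 ≤ 2 * Cφ ^ 4)
          linarith)) hls
    refine le_trans (le_of_eq ?_) h1
    simp only [ha, hb]
    ring
  have hJb : BddMeas (fun w : Fin K → Vec m =>
      ∫ l, (∫ η, M.J k η ∂M.actor q.β q.Nactor (x.1, w, l))
        ∂M.caIter q.c q.NCA (x.1, w, x.2.2)) (1 / (1 - M.γ)) := by
    have h1 : BddMeas (fun y : (Fin K → Vec m) × Vec K =>
        ∫ η, M.J k η ∂M.actor q.β q.Nactor (x.1, y.1, y.2)) (1 / (1 - M.γ)) :=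
      (hJ.kernel (M.actor q.β q.Nactor)).comp (by fun_prop : Measurable
        fun y : (Fin K → Vec m) × Vec K => ((x.1, y.1, y.2) : State K p m))
    exact ⟨(h1.meas.stronglyMeasurable.integral_kernel_prod_right'
      (κ := (M.caIter q.c q.NCA).comap (fun w : Fin K → Vec m =>
        ((x.1, w, x.2.2) : State K p m)) (by fun_prop))).measurable, fun w =>
      (h1.comp (by fun_prop : Measurable fun l : Vec K => (w, l))).abs_integral_le
        (M.caIter q.c q.NCA (x.1, w, x.2.2))⟩
  have h3 := integral_mono_ae ((integrable_const a).add (hi.const_mul b)) (hJb.integrable _) hpt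
  rw [integral_add' (integrable_const a) (hi.const_mul b), integral_const_mul, integral_const,
    probReal_univ, one_smul] at h3
  refine le_trans ?_ h3
  have h4 := mul_le_mul_of_nonneg_left hle
    (by positivity : 0 ≤ q.β * (5 / 4 * (1 / (1 - M.γ)) * (2 * Cφ ^ 4)))
  simp only [ha, hb, stepError]
  linarith

/-- The selection `lamStar` is arbitrary and need not be measurable, but the minimal norm does not
depend on the minimizer chosen and is continuous in θ. -/
theorem bddMeas_min_norm_sq (h : M.Smooth Cφ Cπ Lφ) (hC : 0 ≤ Cφ) (hL : 0 ≤ Lφ)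
    {lamStar : Vec p → Vec K} (hl : ∀ θ, M.IsMinNormWeight θ (lamStar θ)) :
    BddMeas (fun x : State K p m => ‖M.wgrad (lamStar x.1) x.1‖ ^ 2)
      ((1 / (1 - M.γ) * (1 / (1 - M.γ) * Cφ)) ^ 2) := by
  refine ⟨((continuous_min_norm h hC hL hl).measurable.comp measurable_fst).pow_const 2,
    fun x => ?_⟩
  rw [abs_of_nonneg (by positivity)]
  refine pow_le_pow_left₀ (norm_nonneg _) (norm_weighted_le (hl x.1).1 fun k => ?_) 2
  have hγ1 := M.γ_lt_one
  have hu0 : 0 < 1 / (1 - M.γ) := one_div_pos.2 (by linarith)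
  rw [gradient_J h hC hL, norm_smul, Real.norm_of_nonneg hu0.le]
  exact mul_le_mul_of_nonneg_left (norm_integral_smul_score_le h (Q_bdd M k x.1) x.1 _) hu0.le

/-- The average squared norm of the common descent direction along the iterates. -/
theorem average_min_norm_le {κ ρ : ℝ} {q : Params} (h : M.Smooth Cφ Cπ Lφ)
    (hE : M.UniformlyErgodic κ ρ) (hA : M.Solvable q.lamA) (hC : 0 ≤ Cφ) (hL : 0 ≤ Lφ)
    (hκ : 0 ≤ κ) (hρ0 : 0 ≤ ρ) (hρ1 : ρ < 1) (hlamA : 0 < q.lamA) (hB : 0 ≤ q.B)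
    (hst : ∀ k θ, ‖M.wstar k θ‖ ≤ q.B) (hβ : 0 < q.β) (hβL : q.β * M.LJ ≤ 1) (hc : 0 < q.c)
    (hNa : 1 ≤ q.Nactor) (hNc : 1 ≤ q.Ncritic) (hNCA : 1 ≤ q.NCA) (k : Fin K)
    {x₀ : State K p m} (hw : ∀ k, ‖x₀.2.1 k‖ ≤ q.B) (hl : x₀.2.2 ∈ simplex K)
    {lamStar : Vec p → Vec K} (hls : ∀ θ, M.IsMinNormWeight θ (lamStar θ)) {T : ℕ} (hT : 1 ≤ T) :
    (1 / (T : ℝ)) * ∑ t ∈ Finset.range T,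
        ∫ x, ‖M.wgrad (lamStar x.1) x.1‖ ^ 2 ∂M.stateLaw q x₀ t ≤
      8 * (1 / (1 - M.γ)) * (1 / (1 - M.γ) * (1 / (q.β * T)) + M.stepError Cφ κ ρ q) := by
  have hγ1 := M.γ_lt_one
  set u := 1 / (1 - M.γ) with hu
  have hu0 : 0 < u := one_div_pos.2 (by linarith)
  have huγ : 1 - M.γ = 1 / u := by rw [hu, one_div_one_div]
  set err := M.stepError Cφ κ ρ q
  have hJ := (bddMeas_J h hC hL k).comp (measurable_fst : Measurable fun x : State K p m => x.1)
  have hY := bddMeas_min_norm_sq h hC hL hls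
  set y : ℕ → ℝ := fun t => ∫ x, ‖M.wgrad (lamStar x.1) x.1‖ ^ 2 ∂M.stateLaw q x₀ t with hy
  set j : ℕ → ℝ := fun t => ∫ x, M.J k x.1 ∂M.stateLaw q x₀ t with hj
  have hstep : ∀ t, j t + q.β * ((1 - M.γ) / 8 * y t - err) ≤ j (t + 1) := by
    intro t
    have i1 : Integrable (fun x : State K p m => q.β * ((1 - M.γ) / 8) *
        ‖M.wgrad (lamStar x.1) x.1‖ ^ 2) (M.stateLaw q x₀ t) := (hY.integrable _).const_mul _
    have i2 : Integrable (fun x : State K p m => M.J k x.1 + q.β * ((1 - M.γ) / 8) *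
        ‖M.wgrad (lamStar x.1) x.1‖ ^ 2) (M.stateLaw q x₀ t) := (hJ.integrable _).add i1
    have h1 := integral_mono_ae (i2.add (integrable_const (-(q.β * err))))
      ((hJ.kernel (M.outer q)).integrable (M.stateLaw q x₀ t)) (by
        filter_upwards [stateLaw_good h hC hB hw hl t] with x hx
        refine le_trans (le_of_eq ?_) (outer_ascent h hE hA hC hL hκ hρ0 hρ1 hlamA hB hst hβ hβL
          hc hNa hNc hNCA k hx.1 hx.2 (hls x.1))
        simp only [Pi.add_apply]
        ring)
    rw [integral_add' i2 (integrable_const _), integral_add (hJ.integrable _) i1,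
      integral_const_mul, integral_const, probReal_univ, one_smul,
      ← integral_stateLaw_succ hJ] at h1
    simp only [hj, hy]
    linarith
  have hsum : ∀ n : ℕ, j 0 + q.β * ((1 - M.γ) / 8 * ∑ t ∈ Finset.range n, y t - n * err) ≤ j n := by
    intro n
    induction n with
    | zero => simp
    | succ n ih =>
      rw [Finset.sum_range_succ]
      push_cast
      linarith [hstep n]
  have h0 : 0 ≤ j 0 := integral_nonneg fun x => (J_mem k x.1).1
  have hTu : j T ≤ u := (le_abs_self _).trans (hJ.abs_integral_le _)
  have hT0 : (0 : ℝ) < T := by exact_mod_cast hT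
  have hs := hsum T
  rw [huγ] at hs
  set s := ∑ t ∈ Finset.range T, y t
  have h1 : q.β * (1 / u / 8 * s - T * err) ≤ u := by linarith
  have h2 : 1 / u / 8 * s ≤ u / q.β + T * err := by
    rw [← le_div_iff₀' hβ] at h1
    linarith
  have h3 : s ≤ 8 * u * (u / q.β + T * err) := by
    have := mul_le_mul_of_nonneg_left h2 (by positivity : 0 ≤ 8 * u)
    calc s = 8 * u * (1 / u / 8 * s) := by field_simp
      _ ≤ _ := this
  calc 1 / (T : ℝ) * s ≤ 1 / (T : ℝ) * (8 * u * (u / q.β + T * err)) :=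
        mul_le_mul_of_nonneg_left h3 (by positivity)
    _ = 8 * u * (u * (1 / (q.β * T)) + err) := by field_simp

end Model

/-! ### Collecting the constants -/

theorem criticConst_nonneg {κ ρ lam B G L : ℝ} (hκ : 0 ≤ κ) (hρ1 : ρ < 1) (hlam : 0 < lam)
    (hB : 0 ≤ B) (hG : 0 ≤ G) (hL : 0 ≤ L) : 0 ≤ criticConst κ ρ lam B G L := by
  have hρ : 0 < 1 - ρ := by linarith
  unfold criticConst
  positivity

theorem sqrt_sqrt_eq_rpow (n : ℕ) : √√(n : ℝ) = (n : ℝ) ^ (1 / 4 : ℝ) := by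
  rw [Real.sqrt_eq_rpow, Real.sqrt_eq_rpow, ← Real.rpow_mul (Nat.cast_nonneg n)]
  norm_num

namespace Model

variable {S A : Type*} [MeasurableSpace S] [MeasurableSpace A] {K p m : ℕ} {M : Model S A K p m}
  {Cφ Cπ Lφ : ℝ}

theorem caConst_nonneg {c L : ℝ} (hc : 0 < c) (hL : 0 ≤ L) : 0 ≤ caConst c L := by
  unfold caConst
  positivity

/-- The error of one outer iteration in terms of the numbers of samples and inner iterations. -/
theorem stepError_le {κ ρ : ℝ} {q : Params} (h : M.Smooth Cφ Cπ Lφ) (hC : 0 ≤ Cφ) (hL : 0 ≤ Lφ)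
    (hst : ∀ k θ, ‖M.wstar k θ‖ ≤ q.B) (hβ : 0 < q.β) (k : Fin K) :
    M.stepError Cφ κ ρ q ≤
      5 / 4 * (1 / (1 - M.γ)) * (2 * Cφ ^ 2 * (Cφ * q.B + 1 / (1 - M.γ))) * M.epsApp +
      3 * ((1 / (1 - M.γ)) ^ 3 * (3 * Cφ ^ 2 + Lφ)) * (Cφ * q.B * Cφ) ^ 2 * (q.β / q.Nactor) +
      5 / 4 * (1 / (1 - M.γ)) * (2 * Cφ ^ 4 * (K * criticConst κ ρ q.lamA q.B
        ((1 + 2 * (Cφ * q.B)) * Cφ) (2 * Cφ ^ 2))) * (1 / √(q.Ncritic : ℝ)) +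
      1 / (1 - M.γ) * caConst q.c ((K : ℝ) ^ 2 * (Cφ * q.B * Cφ) ^ 2) *
        (1 / (q.NCA : ℝ) ^ (1 / 4 : ℝ)) := by
  have hγ1 := M.γ_lt_one
  have hu0 : 0 < 1 / (1 - M.γ) := one_div_pos.2 (by linarith)
  obtain ⟨-, he0, he1⟩ := epsApp_spec h hC hst k
  -- The approximation error enters squared. Its a priori bound reduces it to first order.
  have h1 : M.epsApp ^ 2 ≤ (Cφ * q.B + 1 / (1 - M.γ)) * M.epsApp := by
    rw [pow_two]; exact mul_le_mul_of_nonneg_right he1 he0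
  have h2 := mul_le_mul_of_nonneg_left h1
    (by positivity : 0 ≤ 5 / 4 * (1 / (1 - M.γ)) * (2 * Cφ ^ 2))
  have h3 := mul_le_mul_of_nonneg_right (LJ_spec h hC hL).2.1
    (by positivity : 0 ≤ 1 / 2 * ((Cφ * q.B * Cφ) ^ 2 * (q.β / q.Nactor)))
  have e1 : M.LJ / 2 * q.β * ((Cφ * q.B * Cφ) ^ 2 / q.Nactor) =
      M.LJ * (1 / 2 * ((Cφ * q.B * Cφ) ^ 2 * (q.β / q.Nactor))) := by ring
  rw [stepError, sqrt_sqrt_eq_rpow, e1]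
  refine le_trans (add_le_add le_rfl h3) ?_
  simp only [div_eq_mul_inv, one_mul] at h2 ⊢
  linarith

end Model
end MTAC

theorem mainTheorem1 (K : ℕ) (γ Cφ Cπ Lφ κ ρ lamA B c : ℝ)
    (hCφ : 0 < Cφ) (hCπ : 0 < Cπ) (hLφ : 0 < Lφ) (hκ : 0 < κ) (hρ0 : 0 < ρ) (hρ1 : ρ < 1)
    (hlamA : 0 < lamA) (hB : 0 < B) (hc : 0 < c) :
    ∃ C : ℝ, 0 < C ∧
      ∀ (S A : Type*) [MeasurableSpace S] [MeasurableSpace A] (p m : ℕ)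
        (M : MTAC.Model S A K p m),
        M.γ = γ →
        M.Smooth Cφ Cπ Lφ →
        M.UniformlyErgodic κ ρ →
        M.Solvable lamA →
        (∀ k θ, ‖M.wstar k θ‖ ≤ B) →
        ∀ (β : ℝ) (T Nactor Ncritic NCA : ℕ),
          0 < β → β * M.LJ ≤ 1 → 1 ≤ T → 1 ≤ Nactor → 1 ≤ Ncritic → 1 ≤ NCA →
          ∀ (θ₀ : MTAC.Vec p) (w₀ : Fin K → MTAC.Vec m) (l₀ : MTAC.Vec K),
            (∀ k, ‖w₀ k‖ ≤ B) → l₀ ∈ MTAC.simplex K →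
            ∀ lamStar : MTAC.Vec p → MTAC.Vec K, (∀ θ, M.IsMinNormWeight θ (lamStar θ)) →
              (∀ t : ℕ, MeasureTheory.Integrable
                (fun x : MTAC.Model.State K p m => ‖M.wgrad (lamStar x.1) x.1‖ ^ 2)
                (M.stateLaw ⟨B, lamA, β, c, Ncritic, NCA, Nactor⟩ (θ₀, w₀, l₀) t)) ∧
              (1 / (T : ℝ)) * ∑ t ∈ Finset.range T,
                  ∫ x, ‖M.wgrad (lamStar x.1) x.1‖ ^ 2
                    ∂(M.stateLaw ⟨B, lamA, β, c, Ncritic, NCA, Nactor⟩ (θ₀, w₀, l₀) t)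
                ≤ C * (1 / (β * T) + M.epsApp + β / Nactor + 1 / √(Ncritic : ℝ)
                    + 1 / (NCA : ℝ) ^ (1 / 4 : ℝ)) := by
  -- For γ ≥ 1 no model has this discount factor, so any constant will do.
  by_cases hγ : γ < 1
  swap
  · exact ⟨1, one_pos, fun S A _ _ p m M hM => absurd (hM ▸ M.γ_lt_one) hγ⟩
  set u := 1 / (1 - γ) with hu
  have hu0 : 0 < u := one_div_pos.2 (by linarith)
  set c₁ := u with hc₁
  set c₂ := 5 / 4 * u * (2 * Cφ ^ 2 * (Cφ * B + u)) with hc₂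
  set c₃ := 3 * (u ^ 3 * (3 * Cφ ^ 2 + Lφ)) * (Cφ * B * Cφ) ^ 2 with hc₃
  set c₄ := 5 / 4 * u * (2 * Cφ ^ 4 * (K * MTAC.criticConst κ ρ lamA B
    ((1 + 2 * (Cφ * B)) * Cφ) (2 * Cφ ^ 2))) with hc₄
  set c₅ := u * MTAC.Model.caConst c ((K : ℝ) ^ 2 * (Cφ * B * Cφ) ^ 2) with hc₅
  have h₂ : 0 ≤ c₂ := by positivity
  have h₃ : 0 ≤ c₃ := by positivity
  have h₄ : 0 ≤ c₄ := by
    have := MTAC.criticConst_nonneg hκ.le hρ1 hlamA hB.le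
      (by positivity : 0 ≤ (1 + 2 * (Cφ * B)) * Cφ) (by positivity : 0 ≤ 2 * Cφ ^ 2)
    positivity
  have h₅ : 0 ≤ c₅ := by
    have := MTAC.Model.caConst_nonneg hc (by positivity : 0 ≤ (K : ℝ) ^ 2 * (Cφ * B * Cφ) ^ 2)
    positivity
  refine ⟨8 * u * (c₁ + c₂ + c₃ + c₄ + c₅), by positivity, ?_⟩
  intro S A _ _ p m M hM hS hE hA hst β T Nactor Ncritic NCA hβ hβL hT hNa hNc hNCA θ₀ w₀ l₀
    hw₀ hl₀ lamStar hls
  refine ⟨fun t => (MTAC.Model.bddMeas_min_norm_sq hS hCφ.le hLφ.le hls).integrable _, ?_⟩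
  -- An initial weight in the simplex forces K ≥ 1. Any one task then supplies the potential.
  obtain ⟨k⟩ : Nonempty (Fin K) := by
    by_contra hne
    have hemp : IsEmpty (Fin K) := not_nonempty_iff.1 hne
    have := hl₀.2
    simp at this
  set q : MTAC.Params := ⟨B, lamA, β, c, Ncritic, NCA, Nactor⟩ with hq
  have h1 := MTAC.Model.average_min_norm_le (q := q) hS hE hA hCφ.le hLφ.le hκ.le hρ0.le hρ1 hlamA
    hB.le hst hβ hβL hc hNa hNc hNCA k (x₀ := (θ₀, w₀, l₀)) hw₀ hl₀ hls hT
  have h2 := MTAC.Model.stepError_le (κ := κ) (ρ := ρ) (q := q) hS hCφ.le hLφ.le hst hβ k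
  have he0 := (MTAC.Model.epsApp_spec hS hCφ.le hst k).2.1
  rw [hM] at h1 h2
  simp only [hq, ← hu] at h1 h2
  rw [← hc₂, ← hc₃, ← hc₄, ← hc₅] at h2
  refine h1.trans ?_
  rw [mul_assoc (8 * u)]
  refine mul_le_mul_of_nonneg_left ?_ (by positivity)
  have n1 : 0 ≤ 1 / (β * T) := by positivity
  have n3 : 0 ≤ β / Nactor := by positivity
  have n4 : 0 ≤ 1 / √(Ncritic : ℝ) := by positivity
  have n5 : 0 ≤ 1 / (NCA : ℝ) ^ (1 / 4 : ℝ) := by positivity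
  set x₁ := 1 / (β * (T : ℝ))
  set x₂ := M.epsApp
  set x₃ := β / (Nactor : ℝ)
  set x₄ := 1 / √(Ncritic : ℝ)
  set x₅ := 1 / (NCA : ℝ) ^ (1 / 4 : ℝ)
  have key : ∀ a x : ℝ, 0 ≤ a → 0 ≤ x → x ≤ x₁ + x₂ + x₃ + x₄ + x₅ →
      a * x ≤ a * (x₁ + x₂ + x₃ + x₄ + x₅) := fun a x ha _ hx => mul_le_mul_of_nonneg_left hx ha
  have k1 := key c₁ x₁ hu0.le n1 (by linarith)
  have k2 := key c₂ x₂ h₂ he0 (by linarith)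
  have k3 := key c₃ x₃ h₃ n3 (by linarith)
  have k4 := key c₄ x₄ h₄ n4 (by linarith)
  have k5 := key c₅ x₅ h₅ n5 (by linarith)
  linarith
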